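/- \textbf{General sieve lemma.} Setting. Let $k\ge 1$, let $0<\theta<1/18$ be fixed, let $N$ be a large integer, and put $R=N^{\theta/2}$, $D_0=(\log\log N)^3$, $$W=\prod_{2<p\le D_0}p,\qquad W_3=\prod_{\substack{p\le D_0\\ p\equiv 3\,(\mathrm{mod}\,4)}}p,\qquad A=\frac1{\sqrt2}\prod_{p\equiv 3\,(\mathrm{mod}\,4)}\Bigl(1-\frac1{p^2}\Bigr)^{-1/2},\qquad B=\frac{2A}{\pi}\cdot\frac{\varphi(W_3)(\log R)^{1/2}}{W_3}.$$ Let $F$ be a smooth real function on $[0,1]^k$ (smooth up to the boundary of the cube) that vanishes outside the simplex $\{x\in[0,1]^k:\sum_i x_i\le 1\}$ and is extended by $0$ outside the cube, and let $$F_{\max}=\sup_{t\in[0,1]^k}\Bigl(|F(t)|+\sum_{i=1}^k\Bigl|\frac{\partial F}{\partial t_i}(t)\Bigr|\Bigr).$$ If $\prod_i d_i\le R$ is squarefree, coprime to $W$ and has only prime factors $\equiv 3\pmod 4$, define $$\lambda_{d_1,\dots,d_k}=\Bigl(\prod_{i=1}^k\mu(d_i)d_i\Bigr)\sum_{\substack{r_1,\dots,r_k\ge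 1\\ d_i\mid r_i,\ (r_i,W)=1\ \forall i\\ p\mid r_i\Rightarrow p\equiv 3\,(\mathrm{mod}\,4)\ \forall i}}\frac{\mu(\prod_i r_i)^2}{\prod_i\varphi(r_i)}\,F\Bigl(\frac{\log r_1}{\log R},\dots,\frac{\log r_k}{\log R}\Bigr),$$ and otherwise put $\lambda_{d_1,\dots,d_k}=0$. Let $J\subseteq\{1,\dots,k\}$ with $|J|\le 2$, let $I=\{1,\dots,k\}\setminus J$, let $m\in\{1,\dots,k\}$, and let each of $p_1,p_2$ be a prime or $1$. If $J=\emptyset$, let $f$ be a multiplicative function with $f(p)=1/p$ for all primes $p$ (and $g$ plays no role). If $J\ne\emptyset$, let $f,g$ be real multiplicative functions, non-zero at every prime, such that for a constant $K$ and all primes $p$ $$\Bigl|f(p)-\frac1p\Bigr|\le\frac K{p^2},\qquad \Bigl|g(p)-\frac1{p^2}\Bigr|\le\frac K{p^3},$$ and $f(p)\ne 1/p$ for all primes $p\equiv 3\pmod 4$. Define $$S_{J,p_1,p_2,m}=\sum_{\substack{d_1,\dots,d_k\ge 1,\ e_1,\dots,e_k\ge 1\\ W,[d_1,e_1],\dots,[d_k,e_k]\text{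 pairwise coprime}\\ p_1\mid d_m,\ p_2\mid e_m}}\lambda_{d_1,\dots,d_k}\lambda_{e_1,\dots,e_k}\prod_{i\in I}f([d_i,e_i])\prod_{j\in J}g([d_j,e_j]),\qquad S_J=S_{J,1,1,m},$$ where $[a,b]$ is the least common multiple ($S_J$ does not depend on $m$), and $$L_J(F)=\int_{[0,1]^{I}}\Bigl(\int_{[0,1]^{J}}F(x_1,\dots,x_k)\prod_{j\in J}\frac{dx_j}{\sqrt{x_j}}\Bigr)^2\prod_{i\in I}\frac{dx_i}{\sqrt{x_i}}.$$ Then the following hold. (i) If $m\in J$, then $\displaystyle |S_{J,p_1,p_2,m}|\le C\,\frac{F_{\max}^2\,B^{k+|J|}(\log\log R)^2}{[p_1,p_2]^2}$ for all $N\ge N_0$. (ii) If $m\notin J$, then $\displaystyle |S_{J,p_1,p_2,m}|\le C\,\frac{F_{\max}^2\,B^{k+|J|}(\log\log R)^2}{[p_1,p_2]}$ for all $N\ge N_0$. (iii) If $L_J(F)\neq 0$, then for fixed $\theta,f,g,F$ we have $S_J=(1+o(1))\,B^{k+|J|}L_J(F)$ as $N\to\infty$. In (i) and (ii) the constant $C$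 depends only on $k$, $J$ and $K$, and $N_0$ depends only on $k$, $J$, $K$ and $\theta$; in particular both are uniform in $p_1,p_2,m,F$ and in the functions $f,g$. -/

import Mathlib

open scoped ContDiff

noncomputable section

namespace HalfSieve

/-- `D₀ = (log log N)³`. -/
def D0 (N : ℕ) : ℝ := (Real.log (Real.log N)) ^ 3

/-- `W`, the product of the primes `2 < p ≤ D₀`. -/
def W (N : ℕ) : ℕ :=
  ∏ p ∈ (Finset.range (⌊D0 N⌋₊ + 1)).filter (fun p => p.Prime ∧ 2 < p), p

/-- `W₃`, the product of the primes `p ≤ D₀` with `p ≡ 3 (mod 4)`. -/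
def W3 (N : ℕ) : ℕ :=
  ∏ p ∈ (Finset.range (⌊D0 N⌋₊ + 1)).filter (fun p => p.Prime ∧ p % 4 = 3), p

/-- The sieve level `R = N^{θ/2}`. -/
def R (θ : ℝ) (N : ℕ) : ℝ := (N : ℝ) ^ (θ / 2)

/-- The Ramanujan-Landau constant `A = 2^{-1/2} ∏_{p ≡ 3 (4)} (1 - p⁻²)^{-1/2}`. -/
def A : ℝ :=
  1 / √2 * ∏' p : {p : ℕ // p.Prime ∧ p % 4 = 3}, (1 - 1 / ((p : ℕ) : ℝ) ^ 2) ^ (-(1 / 2) : ℝ)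

/-- The normalising constant `B = (2A/π) φ(W₃) (log R)^{1/2} / W₃`. -/
def B (θ : ℝ) (N : ℕ) : ℝ :=
  2 * A / Real.pi * ((Nat.totient (W3 N) : ℝ) * √(Real.log (R θ N)) / (W3 N : ℝ))

/-- Every prime factor of `n` is `≡ 3 (mod 4)`. -/
def OnlyPrimes3Mod4 (n : ℕ) : Prop := ∀ p : ℕ, p.Prime → p ∣ n → p % 4 = 3

/-- The simplex `{x ∈ [0,1]^k : ∑ x_i ≤ 1}`. -/
def simplex (k : ℕ) : Set (Fin k → ℝ) := {x | x ∈ Set.Icc 0 1 ∧ ∑ i, x i ≤ 1}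

/-- `F` is a smooth function on the cube `[0,1]^k`, supported on the simplex
(and extended by zero outside the cube). Smoothness is not required across the faces `x_i = 0`
and `x_i = 1` of the cube. -/
structure IsSieveFunction {k : ℕ} (F : (Fin k → ℝ) → ℝ) : Prop where
  smooth : ContDiffOn ℝ ∞ F (Set.Icc 0 1)
  supported : ∀ x, x ∉ simplex k → F x = 0

/-- `F_max = sup_{t ∈ [0,1]^k} (|F(t)| + ∑ |∂F/∂t_i(t)|)`; on the faces of the cube the partial
derivatives are taken within the cube. -/
def Fmax {k : ℕ} (F : (Fin k → ℝ) → ℝ) : ℝ :=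
  sSup ((fun t => |F t| + ∑ i, |fderivWithin ℝ F (Set.Icc 0 1) t (Pi.single i 1)|) ''
    Set.Icc (0 : Fin k → ℝ) 1)

/-- The `k`-tuples of positive integers that are at most `R`. -/
def box (k : ℕ) (θ : ℝ) (N : ℕ) : Finset (Fin k → ℕ) :=
  Fintype.piFinset fun _ => Finset.Icc 1 ⌊R θ N⌋₊

open Classical in
/-- The weights `λ_{d_1,…,d_k}`. As `F` vanishes off the simplex, only tuples `r` with
`∏ r_i ≤ R` contribute to the inner sum, so that its restriction to `box` loses nothing. -/
def lam {k : ℕ} (θ : ℝ) (N : ℕ) (F : (Fin k → ℝ) → ℝ) (d : Fin k → ℕ) : ℝ :=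
  if ((∏ i, d i : ℕ) : ℝ) ≤ R θ N ∧ Squarefree (∏ i, d i) ∧ Nat.Coprime (∏ i, d i) (W N) ∧
      OnlyPrimes3Mod4 (∏ i, d i) then
    (∏ i, (ArithmeticFunction.moebius (d i) : ℝ) * (d i : ℝ)) *
      ∑ r ∈ (box k θ N).filter (fun r => ∀ i,
          d i ∣ r i ∧ Nat.Coprime (r i) (W N) ∧ OnlyPrimes3Mod4 (r i)),
        (ArithmeticFunction.moebius (∏ i, r i) : ℝ) ^ 2 / (∏ i, (Nat.totient (r i) : ℝ)) *
          F (fun i => Real.log (r i) / Real.log (R θ N))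
  else 0

/-- `W, [d_1,e_1], …, [d_k,e_k]` are pairwise coprime. -/
def CoprimeLcms {k : ℕ} (N : ℕ) (d e : Fin k → ℕ) : Prop :=
  (∀ i, Nat.Coprime (W N) (Nat.lcm (d i) (e i))) ∧
    ∀ i j, i ≠ j → Nat.Coprime (Nat.lcm (d i) (e i)) (Nat.lcm (d j) (e j))

open Classical in
/-- The sieve sum `S_{J,p₁,p₂,m}`. As `lam` vanishes when `∏ d_i > R`, the restriction
to `box` loses nothing. -/
def S {k : ℕ} (θ : ℝ) (N : ℕ) (F : (Fin k → ℝ) → ℝ) (f g : ArithmeticFunction ℝ)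
    (J : Finset (Fin k)) (p₁ p₂ : ℕ) (m : Fin k) : ℝ :=
  ∑ d ∈ box k θ N, ∑ e ∈ box k θ N,
    if CoprimeLcms N d e ∧ p₁ ∣ d m ∧ p₂ ∣ e m then
      lam θ N F d * lam θ N F e *
        ((∏ i ∈ Jᶜ, f (Nat.lcm (d i) (e i))) * ∏ j ∈ J, g (Nat.lcm (d j) (e j)))
    else 0

/-- The conditions on the arithmetic weights `f, g` attached to `J`, with `K` the implied constant
in `f(p) = 1/p + O(1/p²)` and `g(p) = 1/p² + O(1/p³)`. If `J` is empty, then `f(p) = 1/p`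
and `g` plays no role. -/
structure IsWeightPair {k : ℕ} (K : ℝ) (J : Finset (Fin k)) (f g : ArithmeticFunction ℝ) :
    Prop where
  mult_f : f.IsMultiplicative
  empty_case : J = ∅ → ∀ p : ℕ, p.Prime → f p = 1 / (p : ℝ)
  mult_g : J.Nonempty → g.IsMultiplicative
  f_ne_zero : J.Nonempty → ∀ p : ℕ, p.Prime → f p ≠ 0
  g_ne_zero : J.Nonempty → ∀ p : ℕ, p.Prime → g p ≠ 0
  f_approx : J.Nonempty → ∀ p : ℕ, p.Prime → |f p - 1 / (p : ℝ)| ≤ K / (p : ℝ) ^ 2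
  g_approx : J.Nonempty → ∀ p : ℕ, p.Prime → |g p - 1 / (p : ℝ) ^ 2| ≤ K / (p : ℝ) ^ 3
  f_ne_inv : J.Nonempty → ∀ p : ℕ, p.Prime → p % 4 = 3 → f p ≠ 1 / (p : ℝ)

/-- The point of `ℝ^k` with coordinates `y_j` for `j ∈ J` and `x_i` for `i ∉ J`. -/
def glue {k : ℕ} (J : Finset (Fin k)) (x : {i // i ∉ J} → ℝ) (y : {j // j ∈ J} → ℝ) :
    Fin k → ℝ :=
  fun i => if h : i ∈ J then y ⟨i, h⟩ else x ⟨i, h⟩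

/-- `L_J(F) = ∫_{[0,1]^I} (∫_{[0,1]^J} F ∏_{j ∈ J} dx_j/√x_j)² ∏_{i ∈ I} dx_i/√x_i`, where `I` is
the complement of `J`. -/
def L {k : ℕ} (J : Finset (Fin k)) (F : (Fin k → ℝ) → ℝ) : ℝ :=
  ∫ x : {i // i ∉ J} → ℝ in Set.Icc 0 1,
    (∫ y : {j // j ∈ J} → ℝ in Set.Icc 0 1, F (glue J x y) * ∏ j, (√(y j))⁻¹) ^ 2 *
      ∏ i, (√(x i))⁻¹

end HalfSieve

end

noncomputable section

namespace HalfSieve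

open Filter Topology

/-! ### Dirichlet series of completely multiplicative functions at real arguments -/

/-! Opening both weights turns `S` into a quadratic form in the values of `F` at the points `(log
r_i / log R)` and `(log s_i / log R)`. Squarefree numbers are finite sets of primes, and every
condition linking r, s, d, e can be checked one prime at a time. So the sums over d and e collapse:
the coefficient of F(r)F(s) is a product over the primes D₀ < q ≤ R, q ≡ 3 mod 4, of local factors
that depend only on which r_i and s_i are divisible by q (`S_eq_sum_prod`).

Write h_i for f off `J` and for g on `J`. If q divides a single r_i and no s_j, the factor is (1 - q
h_i(q))/(q - 1): this is O(q⁻²) off `J`, where h_i ≈ 1/q, and 1/(q - 1) + O(q⁻²) on `J`, where h_i ≈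
1/q². If q divides r_i and s_i, it is 1/(q - 1) + O(q⁻²) off `J` and O(q⁻²) on `J`. Up to O(q⁻²),
then, r_i = s_i is forced off `J`, while r_j and s_j are independent on `J` (`LocalBounds.close`).
This leaves k + |J| free variables, each weighted by 1/φ, and since q > D₀ the local errors multiply
to exp(O(1/D₀)).

Absolute convergence comes from Rankin's trick: on the simplex |F| is at most e · `Fmax F` · ∏
r_i^(-1/log R), after which everything is an Euler product comparable with B^(k + |J|) (`abs_S_le`,
`abs_S_sub_mainTerm_le`). A prescribed prime p₁ or p₂ forces the factor h_m(p), which gains 1/p or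
1/p²; this gives (i) and (ii).

For (iii), the measures B⁻¹ ∑ φ(n)⁻¹ δ_{log n / log R} must tend to t^(-1/2) dt on [0, 1]. Their
Laplace transforms are Euler products, compared with the Dirichlet series over integers with prime
factors ≡ 3 mod 4. The square of that series is ζ(σ)/L(σ, χ₄) up to regular factors, so the pole of
ζ and L(1, χ₄) = π/4 give its growth (`tendsto_laplace`). Karamata's theorem
(`LaplaceConverges.tendsto_cut`) recovers the measures, and powers of weakly convergent measures
converge weakly (`tendsto_sum_pi`). The limit is L_J(F), the squared inner integral being two
independent copies of the variables in `J`. -/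

/-- The Dirichlet series `∑ χ(n) n^{-σ}` at a real argument. -/
def dirichletSum (χ : ℕ →*₀ ℝ) (σ : ℝ) : ℝ := ∑' n : ℕ, χ n * (n : ℝ) ^ (-σ)

/-- The completely multiplicative function `χ(n) n^{-σ}`. -/
def twist (χ : ℕ →*₀ ℝ) (σ : ℝ) : ℕ →*₀ ℝ where
  toFun n := χ n * (n : ℝ) ^ (-σ)
  map_zero' := by simp
  map_one' := by simp
  map_mul' m n := by
    rw [map_mul, Nat.cast_mul, Real.mul_rpow (Nat.cast_nonneg _) (Nat.cast_nonneg _)]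
    ring

lemma summable_norm_twist {χ : ℕ →*₀ ℝ} (hχ : ∀ n, |χ n| ≤ 1) {σ : ℝ} (hσ : 1 < σ) :
    Summable fun n => ‖twist χ σ n‖ := by
  refine Summable.of_nonneg_of_le (fun _ => norm_nonneg _) (fun n => ?_)
    (Real.summable_nat_rpow.2 (neg_lt_neg hσ))
  have h0 : (0 : ℝ) ≤ (n : ℝ) ^ (-σ) := Real.rpow_nonneg (Nat.cast_nonneg _) _
  change ‖χ n * (n : ℝ) ^ (-σ)‖ ≤ _
  rw [norm_mul, Real.norm_eq_abs, Real.norm_of_nonneg h0]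
  exact mul_le_of_le_one_left h0 (hχ n)

lemma hasProd_dirichletSum {χ : ℕ →*₀ ℝ} (hχ : ∀ n, |χ n| ≤ 1) {σ : ℝ} (hσ : 1 < σ) :
    HasProd (fun p : Nat.Primes => (1 - χ p * ((p : ℕ) : ℝ) ^ (-σ))⁻¹) (dirichletSum χ σ) :=
  EulerProduct.eulerProduct_completely_multiplicative_hasProd (summable_norm_twist hχ hσ)

open Classical in
/-- The indicator function of the integers all of whose prime factors are `≡ 3 (mod 4)`. -/
def chiThree : ℕ →*₀ ℝ where
  toFun n := if OnlyPrimes3Mod4 n then 1 else 0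
  map_zero' := by
    rw [if_neg]
    intro h
    have := h 2 Nat.prime_two (dvd_zero _)
    omega
  map_one' := by
    rw [if_pos]
    intro p hp h
    exact absurd (Nat.dvd_one.1 h) hp.one_lt.ne'
  map_mul' m n := by
    have : OnlyPrimes3Mod4 (m * n) ↔ OnlyPrimes3Mod4 m ∧ OnlyPrimes3Mod4 n :=
      ⟨fun h => ⟨fun p hp hd => h p hp (hd.mul_right _), fun p hp hd => h p hp (hd.mul_left _)⟩,
        fun h p hp hd => (hp.dvd_mul.1 hd).elim (h.1 p hp) (h.2 p hp)⟩
    by_cases h1 : OnlyPrimes3Mod4 m <;> by_cases h2 : OnlyPrimes3Mod4 n <;> simp [this, h1, h2]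

/-- The indicator function of the positive integers. -/
def chiOne : ℕ →*₀ ℝ where
  toFun n := if n = 0 then 0 else 1
  map_zero' := by simp
  map_one' := by simp
  map_mul' m n := by by_cases h1 : m = 0 <;> by_cases h2 : n = 0 <;> simp [h1, h2]

/-- The non-trivial character modulo 4. -/
def chiFour : ℕ →*₀ ℝ where
  toFun n := ((ZMod.χ₄ (n : ZMod 4) : ℤ) : ℝ)
  map_zero' := by simp
  map_one' := by simp
  map_mul' m n := by rw [Nat.cast_mul, map_mul, Int.cast_mul]

lemma chiFour_apply (n : ℕ) :
    chiFour n = if n % 2 = 0 then 0 else if n % 4 = 1 then 1 else -1 := by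
  change ((ZMod.χ₄ (n : ZMod 4) : ℤ) : ℝ) = _
  rw [ZMod.χ₄_nat_eq_if_mod_four]
  split_ifs <;> simp

open Classical in
lemma chiThree_apply (n : ℕ) : chiThree n = if OnlyPrimes3Mod4 n then 1 else 0 := rfl

lemma abs_chiThree_le (n : ℕ) : |chiThree n| ≤ 1 := by
  rw [chiThree_apply]
  split_ifs <;> simp

lemma abs_chiOne_le (n : ℕ) : |chiOne n| ≤ 1 := by
  change |ite _ _ _| ≤ (1 : ℝ)
  split_ifs <;> simp

lemma abs_chiFour_le (n : ℕ) : |chiFour n| ≤ 1 := by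
  rw [chiFour_apply]
  split_ifs <;> simp

lemma chiThree_prime {p : ℕ} (hp : p.Prime) : chiThree p = if p % 4 = 3 then 1 else 0 := by
  rw [chiThree_apply]
  congr 1
  exact propext ⟨fun h => h p hp dvd_rfl, fun h q hq hd => by
    rwa [(Nat.prime_dvd_prime_iff_eq hq hp).1 hd]⟩

lemma rpow_neg_prime_lt_one {p : ℕ} (hp : p.Prime) {σ : ℝ} (hσ : 0 < σ) :
    (p : ℝ) ^ (-σ) < 1 :=
  Real.rpow_lt_one_of_one_lt_of_neg (by exact_mod_cast hp.one_lt) (neg_neg_of_pos hσ)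

/-- Euler factors agree prime by prime. With u = p^(-σ), at p ≡ 3 mod 4 this is 1 - u² = (1 - u)(1 +
u); at p = 2 the character vanishes and the extra factor compensates. Only the square of the wanted
series is related to ζ, whence its half-order singularity. -/
lemma dirichletSum_identity {σ : ℝ} (hσ : 1 < σ) :
    dirichletSum chiOne σ * dirichletSum chiThree (2 * σ) =
      dirichletSum chiFour σ * (1 - (2 : ℝ) ^ (-σ))⁻¹ * dirichletSum chiThree σ ^ 2 := by
  have h2 : HasProd (fun p : Nat.Primes => if (p : ℕ) = 2 then
      (1 - (2 : ℝ) ^ (-σ))⁻¹ else 1) (1 - (2 : ℝ) ^ (-σ))⁻¹ := by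
    have := hasProd_single (f := fun p : Nat.Primes => if (p : ℕ) = 2 then
      (1 - (2 : ℝ) ^ (-σ))⁻¹ else 1) ⟨2, Nat.prime_two⟩ fun p hp =>
        if_neg fun h => hp (Subtype.ext h)
    simpa using this
  have hl := (hasProd_dirichletSum abs_chiOne_le hσ).mul
    (hasProd_dirichletSum abs_chiThree_le (by linarith : 1 < 2 * σ))
  have hr := ((hasProd_dirichletSum abs_chiFour_le hσ).mul h2).mul
    ((hasProd_dirichletSum abs_chiThree_le hσ).mul (hasProd_dirichletSum abs_chiThree_le hσ))
  rw [sq]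
  refine hl.unique ?_
  convert hr using 2 with p
  have hp := p.2
  have hu1 := rpow_neg_prime_lt_one hp (by linarith : 0 < σ)
  have hu0 : 0 < ((p : ℕ) : ℝ) ^ (-σ) := Real.rpow_pos_of_pos (by exact_mod_cast hp.pos) _
  have hsq : ((p : ℕ) : ℝ) ^ (-(2 * σ)) = (((p : ℕ) : ℝ) ^ (-σ)) ^ 2 := by
    rw [← Real.rpow_natCast, ← Real.rpow_mul (Nat.cast_nonneg _)]
    congr 1; push_cast; ring
  have h1 : chiOne p = 1 := by
    change (ite _ _ _ : ℝ) = _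
    rw [if_neg hp.ne_zero]
  rw [hsq, h1, chiThree_prime hp, chiFour_apply]
  rcases hp.eq_two_or_odd with h | hodd
  · simp [h]
  · have hne : (p : ℕ) ≠ 2 := by omega
    rw [if_neg hne]
    set u := ((p : ℕ) : ℝ) ^ (-σ)
    have h3 : (1 - u) ≠ 0 := by linarith
    have h4 : (1 + u) ≠ 0 := by linarith
    rcases (by omega : (p : ℕ) % 4 = 1 ∨ (p : ℕ) % 4 = 3) with h | h
    · simp [h, hodd]
    · have h5 : 1 - u ^ 2 = (1 - u) * (1 + u) := by ring
      simp only [h, hodd]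
      norm_num [h5]
      field_simp

lemma tendsto_dirichletSum_chiOne :
    Tendsto (fun σ : ℝ => (σ - 1) * dirichletSum chiOne σ) (𝓝[>] 1) (𝓝 1) := by
  refine tendsto_sub_mul_tsum_nat_rpow.congr' ?_
  filter_upwards [self_mem_nhdsWithin] with σ (hσ : 1 < σ)
  congr 1
  refine tsum_congr fun n => ?_
  change _ = (ite _ _ _ : ℝ) * _
  split_ifs with h
  · subst h
    simp [Real.zero_rpow (by linarith : σ ≠ 0)]
  · rw [Real.rpow_neg (Nat.cast_nonneg _), one_div, one_mul]

lemma tendsto_dirichletSum_chiThree_two_mul :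
    Tendsto (fun σ : ℝ => dirichletSum chiThree (2 * σ)) (𝓝[>] 1)
      (𝓝 (dirichletSum chiThree 2)) := by
  refine tendsto_tsum_of_dominated_convergence (bound := fun n : ℕ => ‖twist chiThree 2 n‖)
    (summable_norm_twist abs_chiThree_le one_lt_two) (fun n => ?_) ?_
  · rcases Nat.eq_zero_or_pos n with rfl | hn
    · simp
    · have : Continuous fun σ : ℝ => chiThree n * (n : ℝ) ^ (-(2 * σ)) := by
        refine continuous_const.mul ?_
        exact (Real.continuous_const_rpow (by positivity)).comp
          (by fun_prop : Continuous fun σ : ℝ => -(2 * σ))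
      have h := (this.tendsto 1).mono_left (nhdsWithin_le_nhds (s := Set.Ioi 1))
      simpa using h
  · filter_upwards [self_mem_nhdsWithin] with σ (hσ : 1 < σ) n
    change ‖_‖ ≤ ‖chiThree n * (n : ℝ) ^ (-(2 : ℝ))‖
    rw [norm_mul, norm_mul]
    refine mul_le_mul_of_nonneg_left ?_ (norm_nonneg _)
    rw [Real.norm_of_nonneg (by positivity), Real.norm_of_nonneg (by positivity)]
    rcases Nat.eq_zero_or_pos n with rfl | hn
    · rw [Nat.cast_zero, Real.zero_rpow (by linarith), Real.zero_rpow (by norm_num)]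
    · exact Real.rpow_le_rpow_of_exponent_le (by exact_mod_cast hn) (by linarith)

/-- A bound uniform in σ ∈ [1, 2]. It dominates the paired terms of L(σ, χ₄), which converges only
conditionally at σ = 1, so that the limit σ → 1 may be taken termwise. -/
lemma rpow_neg_sub_rpow_neg_bound {a b σ : ℝ} (ha : 1 ≤ a) (hb : b = a + 2) (h1 : 1 ≤ σ)
    (h2 : σ ≤ 2) : |a ^ (-σ) - b ^ (-σ)| ≤ 4 / a ^ 2 := by
  have ha0 : 0 < a := by linarith
  have hb0 : 0 < b := by linarith
  have hq : 0 < a / b := by positivity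
  have hq1 : a / b ≤ 1 := by rw [div_le_one hb0]; linarith
  have e : a ^ (-σ) - b ^ (-σ) = a ^ (-σ) * (1 - (a / b) ^ σ) := by
    rw [Real.div_rpow ha0.le hb0.le, Real.rpow_neg ha0.le, Real.rpow_neg hb0.le]
    have := (Real.rpow_pos_of_pos ha0 σ).ne'
    have := (Real.rpow_pos_of_pos hb0 σ).ne'
    field_simp
  have h3 : (a / b) ^ σ ≤ 1 := Real.rpow_le_one hq.le hq1 (by linarith)
  have h4 : (a / b) ^ (2 : ℝ) ≤ (a / b) ^ σ := Real.rpow_le_rpow_of_exponent_ge hq hq1 h2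
  have h5 : a ^ (-σ) ≤ a⁻¹ := by
    rw [← Real.rpow_neg_one]
    exact Real.rpow_le_rpow_of_exponent_le ha (by linarith)
  have h6 : 0 < a ^ (-σ) := Real.rpow_pos_of_pos ha0 _
  have h7 : 1 - (a / b) ^ σ ≤ 4 / a := by
    rw [Real.rpow_two] at h4
    have : 1 - (a / b) ^ 2 ≤ 4 / a := by
      have h8 : a / b = 1 - 2 / b := by field_simp; linarith
      have h9 : 2 / b ≤ 2 / a := div_le_div_of_nonneg_left (by norm_num) ha0 (by linarith)
      have h10 : 4 / a = 2 * (2 / a) := by ring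
      rw [h8]
      nlinarith [sq_nonneg (2 / b)]
    linarith
  rw [e, abs_of_nonneg (mul_nonneg h6.le (by linarith))]
  calc a ^ (-σ) * (1 - (a / b) ^ σ) ≤ a⁻¹ * (4 / a) :=
        mul_le_mul h5 h7 (by linarith) (by positivity)
    _ = 4 / a ^ 2 := by field_simp

lemma dirichletSum_chiFour_eq {σ : ℝ} (hσ : 1 < σ) :
    dirichletSum chiFour σ =
      ∑' j : ℕ, ((4 * j + 1 : ℝ) ^ (-σ) - (4 * j + 3 : ℝ) ^ (-σ)) := by
  have hs : Summable fun n => twist chiFour σ n := (summable_norm_twist abs_chiFour_le hσ).of_norm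
  have h := Nat.sumByResidueClasses hs 4
  have h4 : ∀ f : ZMod 4 → ℝ, ∑ j, f j = f 0 + f 1 + f 2 + f 3 := fun f => by
    exact Fin.sum_univ_four f
  rw [h4] at h
  have e0 : ∀ m : ℕ, twist chiFour σ ((0 : ZMod 4).val + 4 * m) = 0 := fun m => by
    change chiFour _ * _ = _
    rw [chiFour_apply, if_pos, zero_mul]
    change (0 + 4 * m) % 2 = 0
    omega
  have e2 : ∀ m : ℕ, twist chiFour σ ((2 : ZMod 4).val + 4 * m) = 0 := fun m => by
    change chiFour _ * _ = _
    rw [chiFour_apply, if_pos, zero_mul]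
    change (2 + 4 * m) % 2 = 0
    omega
  have e1 : ∀ m : ℕ, twist chiFour σ ((1 : ZMod 4).val + 4 * m) = (4 * m + 1 : ℝ) ^ (-σ) :=
    fun m => by
      change chiFour (1 + 4 * m) * ((1 + 4 * m : ℕ) : ℝ) ^ (-σ) = _
      rw [chiFour_apply, if_neg (by omega), if_pos (by omega), one_mul]
      push_cast
      rw [add_comm]
  have e3 : ∀ m : ℕ, twist chiFour σ ((3 : ZMod 4).val + 4 * m) = -(4 * m + 3 : ℝ) ^ (-σ) :=
    fun m => by
      change chiFour (3 + 4 * m) * ((3 + 4 * m : ℕ) : ℝ) ^ (-σ) = _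
      rw [chiFour_apply, if_neg (by omega), if_neg (by omega)]
      push_cast
      rw [add_comm, neg_one_mul]
  have hinj : ∀ r : ℕ, Function.Injective fun m : ℕ => r + 4 * m := fun r a b h => by
    simp only at h
    omega
  have s1 : Summable fun m : ℕ => (4 * m + 1 : ℝ) ^ (-σ) := by
    refine (hs.comp_injective (hinj 1)).congr fun m => e1 m
  have s3 : Summable fun m : ℕ => -(4 * m + 3 : ℝ) ^ (-σ) := by
    refine (hs.comp_injective (hinj 3)).congr fun m => e3 m
  simp only [e0, e1, e2, e3, tsum_zero, zero_add, add_zero] at h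
  rw [← s1.tsum_add s3] at h
  exact h

lemma tsum_leibniz_pairs :
    ∑' j : ℕ, ((4 * j + 1 : ℝ) ^ (-(1 : ℝ)) - (4 * j + 3 : ℝ) ^ (-(1 : ℝ))) = Real.pi / 4 := by
  have hsum : Summable fun j : ℕ => (4 * j + 1 : ℝ) ^ (-(1 : ℝ)) - (4 * j + 3 : ℝ) ^ (-(1 : ℝ)) := by
    refine Summable.of_norm_bounded (g := fun j : ℕ => 4 * (1 / ((j : ℝ) + 1) ^ 2)) ?_ fun j => ?_
    · refine Summable.mul_left _ ?_
      have := (summable_nat_add_iff 1).2 (Real.summable_one_div_nat_pow.2 one_lt_two)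
      simpa using this
    · rw [Real.norm_eq_abs]
      refine (rpow_neg_sub_rpow_neg_bound (a := 4 * j + 1) (by
        have : (0 : ℝ) ≤ j := Nat.cast_nonneg _
        linarith) (by ring) le_rfl one_le_two).trans ?_
      rw [mul_one_div]
      have : (0 : ℝ) ≤ j := Nat.cast_nonneg _
      gcongr
      linarith
  have h1 := hsum.hasSum.tendsto_sum_nat
  -- Leibniz partial sums of even length: two consecutive terms make one pair.
  have h2 := Real.tendsto_sum_pi_div_four.comp
    (tendsto_id.const_mul_atTop' (two_pos : (0 : ℕ) < 2))
  refine tendsto_nhds_unique h1 (h2.congr fun n => ?_)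
  simp only [Function.comp, id]
  induction n with
  | zero => simp
  | succ n ih =>
    rw [Finset.sum_range_succ (n := n), ← ih, mul_add, mul_one,
      show 2 * n + 2 = 2 * n + 1 + 1 from rfl, Finset.sum_range_succ (n := 2 * n + 1), Finset.sum_range_succ (n := 2 * n), Real.rpow_neg_one, Real.rpow_neg_one]
    push_cast
    rw [pow_succ, pow_mul]
    norm_num
    ring_nf

lemma tendsto_dirichletSum_chiFour :
    Tendsto (fun σ : ℝ => dirichletSum chiFour σ) (𝓝[>] 1) (𝓝 (Real.pi / 4)) := by
  rw [← tsum_leibniz_pairs]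
  have : Tendsto (fun σ : ℝ => ∑' j : ℕ, ((4 * j + 1 : ℝ) ^ (-σ) - (4 * j + 3 : ℝ) ^ (-σ)))
      (𝓝[>] 1)
      (𝓝 (∑' j : ℕ, ((4 * j + 1 : ℝ) ^ (-(1 : ℝ)) - (4 * j + 3 : ℝ) ^ (-(1 : ℝ))))) := by
    refine tendsto_tsum_of_dominated_convergence
      (bound := fun j : ℕ => 4 * (1 / ((j : ℝ) + 1) ^ 2)) ?_ (fun j => ?_) ?_
    · refine Summable.mul_left _ ?_
      have := (summable_nat_add_iff 1).2 (Real.summable_one_div_nat_pow.2 one_lt_two)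
      simpa using this
    · have : Continuous fun σ : ℝ => (4 * j + 1 : ℝ) ^ (-σ) - (4 * j + 3 : ℝ) ^ (-σ) :=
        ((Real.continuous_const_rpow (by positivity)).comp continuous_neg).sub
          ((Real.continuous_const_rpow (by positivity)).comp continuous_neg)
      exact (this.tendsto 1).mono_left nhdsWithin_le_nhds
    · have h2 : ∀ᶠ σ : ℝ in 𝓝[>] 1, σ < 2 :=
        nhdsWithin_le_nhds (eventually_lt_nhds one_lt_two)
      filter_upwards [self_mem_nhdsWithin, h2] with σ (hσ : 1 < σ) hσ2 j
      rw [Real.norm_eq_abs]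
      have : (0 : ℝ) ≤ j := Nat.cast_nonneg _
      refine (rpow_neg_sub_rpow_neg_bound (a := 4 * j + 1) (by linarith) (by ring) hσ.le
        hσ2.le).trans ?_
      rw [mul_one_div]
      gcongr
      linarith
  refine this.congr' ?_
  filter_upwards [self_mem_nhdsWithin] with σ (hσ : 1 < σ)
  exact (dirichletSum_chiFour_eq hσ).symm

lemma dirichletSum_chiThree_pos {σ : ℝ} (hσ : 1 < σ) : 1 ≤ dirichletSum chiThree σ := by
  have hs : Summable fun n => twist chiThree σ n :=
    (summable_norm_twist abs_chiThree_le hσ).of_norm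
  have h := hs.le_tsum 1 fun n _ => by
    change 0 ≤ chiThree n * (n : ℝ) ^ (-σ)
    rw [chiThree_apply]
    split_ifs <;> positivity
  rwa [map_one] at h

lemma hasProd_chiThree {σ : ℝ} (hσ : 1 < σ) :
    HasProd (fun p : ℕ => if p.Prime ∧ p % 4 = 3 then (1 - (p : ℝ) ^ (-σ))⁻¹ else 1)
      (dirichletSum chiThree σ) := by
  have h := hasProd_dirichletSum abs_chiThree_le hσ
  have h2 : HasProd ((fun p : ℕ => if p.Prime ∧ p % 4 = 3 then (1 - (p : ℝ) ^ (-σ))⁻¹ else 1) ∘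
      (Subtype.val : {p : ℕ | p.Prime} → ℕ)) (dirichletSum chiThree σ) := by
    refine h.congr_fun ?_ |> fun h => h
    intro p
    simp only [Function.comp]
    rw [chiThree_prime p.2]
    by_cases h3 : (p : ℕ) % 4 = 3
    · have : (p : ℕ).Prime := p.2
      simp [h3, this]
    · simp [h3]
  rw [hasProd_subtype_iff_mulIndicator] at h2
  convert h2 using 2 with p
  by_cases hp : p.Prime <;> simp [Set.mulIndicator, hp]

/-- The square root is continuous and multiplicative on finite partial products, so it passes
through the Euler product at σ = 2. -/
lemma A_eq : A = 1 / √2 * √(dirichletSum chiThree 2) := by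
  have h : HasProd (fun p : {p : ℕ // p.Prime ∧ p % 4 = 3} => (1 - ((p : ℕ) : ℝ) ^ (-(2 : ℝ)))⁻¹)
      (dirichletSum chiThree 2) := by
    have h1 := hasProd_chiThree one_lt_two
    have h2 : HasProd ((fun p : ℕ => (1 - (p : ℝ) ^ (-(2 : ℝ)))⁻¹) ∘
        (Subtype.val : {p : ℕ | p.Prime ∧ p % 4 = 3} → ℕ)) (dirichletSum chiThree 2) := by
      rw [hasProd_subtype_iff_mulIndicator]
      convert h1 using 2 with p
      simp [Set.mulIndicator]
    exact h2
  have h3 : HasProd (fun p : {p : ℕ // p.Prime ∧ p % 4 = 3} =>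
      (1 - 1 / ((p : ℕ) : ℝ) ^ 2) ^ (-(1 / 2) : ℝ)) (√(dirichletSum chiThree 2)) := by
    refine ((Real.continuous_sqrt.tendsto _).comp h).congr fun s => ?_
    have hpos : ∀ p : {p : ℕ // p.Prime ∧ p % 4 = 3},
        0 ≤ (1 - ((p : ℕ) : ℝ) ^ (-(2 : ℝ)))⁻¹ := fun p =>
      inv_nonneg.2 (sub_nonneg.2 (rpow_neg_prime_lt_one p.2.1 two_pos).le)
    simp only [Function.comp]
    rw [Real.sqrt_eq_rpow, ← Real.finsetProd_rpow _ _ fun p _ => hpos p]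
    refine Finset.prod_congr rfl fun p _ => ?_
    have h4 := (rpow_neg_prime_lt_one p.2.1 two_pos).le
    rw [Real.rpow_neg (Nat.cast_nonneg _), Real.rpow_two, inv_eq_one_div] at h4
    rw [Real.rpow_neg (Nat.cast_nonneg _), Real.rpow_two, inv_eq_one_div (_ ^ 2)]
    rw [Real.rpow_neg (sub_nonneg.2 h4), Real.inv_rpow (sub_nonneg.2 h4)]
  rw [A, h3.tprod_eq]

lemma A_pos : 0 < A := by
  rw [A_eq]
  have := dirichletSum_chiThree_pos one_lt_two
  positivity

lemma A_sq : A ^ 2 = dirichletSum chiThree 2 / 2 := by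
  have := dirichletSum_chiThree_pos one_lt_two
  rw [A_eq, mul_pow, div_pow, Real.sq_sqrt two_pos.le, Real.sq_sqrt (by linarith)]
  ring

/-- The Dirichlet series over integers with prime factors `≡ 3 (mod 4)` grows like
`2A (π (σ - 1))^{-1/2}` as `σ → 1⁺`. -/
lemma tendsto_dirichletSum_chiThree :
    Tendsto (fun σ : ℝ => √(σ - 1) * dirichletSum chiThree σ) (𝓝[>] 1)
      (𝓝 (2 * A / √Real.pi)) := by
  have hc : Tendsto (fun σ : ℝ => 1 - (2 : ℝ) ^ (-σ)) (𝓝[>] 1) (𝓝 (1 - (2 : ℝ) ^ (-(1 : ℝ)))) :=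
    ((continuous_const.sub ((Real.continuous_const_rpow two_ne_zero).comp
      continuous_neg)).tendsto 1).mono_left nhdsWithin_le_nhds
  have hpi := Real.pi_pos
  -- `dirichletSum_identity` solved for (σ - 1) times the square of the series; the limit is 4A²/π
  -- and the root is taken last.
  have hq := ((tendsto_dirichletSum_chiOne.mul tendsto_dirichletSum_chiThree_two_mul).mul
    hc).div tendsto_dirichletSum_chiFour (by positivity)
  have hs := hq.sqrt
  have hval : √(1 * dirichletSum chiThree 2 * (1 - (2 : ℝ) ^ (-(1 : ℝ))) / (Real.pi / 4)) =
      2 * A / √Real.pi := by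
    have hA := A_sq
    rw [show 1 * dirichletSum chiThree 2 * (1 - (2 : ℝ) ^ (-(1 : ℝ))) / (Real.pi / 4) =
      (2 * A / √Real.pi) ^ 2 by
        rw [div_pow, mul_pow, hA, Real.sq_sqrt hpi.le, Real.rpow_neg_one]
        field_simp
        norm_num]
    exact Real.sqrt_sq (by have := A_pos; positivity)
  rw [hval] at hs
  refine hs.congr' ?_
  have h4 : ∀ᶠ σ : ℝ in 𝓝[>] 1, 0 < dirichletSum chiFour σ :=
    tendsto_dirichletSum_chiFour.eventually_const_lt (by positivity)
  filter_upwards [self_mem_nhdsWithin, h4] with σ (hσ : 1 < σ) h4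
  have h2 : 0 < 1 - (2 : ℝ) ^ (-σ) := by
    have := rpow_neg_prime_lt_one Nat.prime_two (by linarith : 0 < σ)
    push_cast at this
    linarith
  have hD := dirichletSum_chiThree_pos hσ
  simp only [Pi.div_apply]
  rw [show (σ - 1) * dirichletSum chiOne σ * dirichletSum chiThree (2 * σ) *
      (1 - (2 : ℝ) ^ (-σ)) / dirichletSum chiFour σ =
      (σ - 1) * dirichletSum chiThree σ ^ 2 by
    rw [mul_assoc (σ - 1), dirichletSum_identity hσ]
    field_simp]
  rw [Real.sqrt_mul (by linarith), Real.sqrt_sq (by linarith)]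

/-! ### Laplace transforms of the sieve weights -/

/-- The weight `1/(p-1)` on the primes `p ≡ 3 (mod 4)` exceeding `D`. -/
def wt (D p : ℕ) : ℝ := if p.Prime ∧ p % 4 = 3 ∧ D < p then 1 / ((p : ℝ) - 1) else 0

/-- The product of `1 - 1/p` over the primes `p ≤ D` with `p ≡ 3 (mod 4)`. -/
def density (D : ℕ) : ℝ :=
  ∏ p ∈ (Finset.range (D + 1)).filter (fun p => p.Prime ∧ p % 4 = 3), (1 - 1 / (p : ℝ))

lemma wt_nonneg (D p : ℕ) : 0 ≤ wt D p := by
  rw [wt]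
  split_ifs with h
  · have : (1 : ℝ) ≤ p := by exact_mod_cast h.1.one_le
    exact div_nonneg zero_le_one (by linarith)
  · exact le_rfl

lemma wt_le (D p : ℕ) : wt D p ≤ 2 * (p : ℝ) ^ (-(1 : ℝ)) := by
  rw [wt, Real.rpow_neg_one]
  split_ifs with h
  · have : (2 : ℝ) ≤ p := by exact_mod_cast h.1.two_le
    rw [← div_eq_mul_inv, div_le_div_iff₀ (by linarith) (by linarith)]
    linarith
  · positivity

lemma density_pos (D : ℕ) : 0 < density D := by
  refine Finset.prod_pos fun p hp => ?_
  have : (2 : ℝ) ≤ p := by exact_mod_cast (Finset.mem_filter.1 hp).2.1.two_le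
  rw [sub_pos, div_lt_one (by linarith)]
  linarith

lemma totient_W3_div (N : ℕ) : (Nat.totient (W3 N) : ℝ) / W3 N = density ⌊D0 N⌋₊ := by
  have hp : ∀ p ∈ (Finset.range (⌊D0 N⌋₊ + 1)).filter (fun p => p.Prime ∧ p % 4 = 3), p.Prime :=
    fun p hp => (Finset.mem_filter.1 hp).2.1
  have h := Nat.totient_eq_mul_prod_factors (W3 N)
  have h0 : (W3 N : ℝ) ≠ 0 := by
    rw [W3, Nat.cast_ne_zero, Finset.prod_ne_zero_iff]
    exact fun p h => (hp p h).ne_zero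
  have h' : (Nat.totient (W3 N) : ℝ) =
      W3 N * ∏ p ∈ (W3 N).primeFactors, (1 - (p : ℝ)⁻¹) := by
    have h1 := congrArg (Rat.cast : ℚ → ℝ) h
    push_cast at h1
    exact h1
  rw [h', mul_div_cancel_left₀ _ h0, W3, Nat.primeFactors_prod hp, density]
  simp only [one_div]

/-- The Laplace transform of the sieve weights, as a sum over finite sets of primes. -/
def laplace (D : ℕ) (ε : ℝ) : ℝ := ∑' s : Finset ℕ, ∏ p ∈ s, wt D p * (p : ℝ) ^ (-ε)

lemma summable_wt_rpow (D : ℕ) {ε : ℝ} (hε : 0 < ε) :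
    Summable fun p : ℕ => wt D p * (p : ℝ) ^ (-ε) := by
  refine Summable.of_nonneg_of_le (fun p => mul_nonneg (wt_nonneg _ _) (by positivity))
    (fun p => ?_) ((Real.summable_nat_rpow.2 (by linarith : -1 - ε < -1)).mul_left 2)
  rcases Nat.eq_zero_or_pos p with rfl | hp
  · simp [wt]
    positivity
  · have hp : (0 : ℝ) < p := by exact_mod_cast hp
    rw [sub_eq_add_neg, Real.rpow_add hp, ← mul_assoc]
    exact mul_le_mul_of_nonneg_right (wt_le _ _) (by positivity)

lemma wt_rpow_nonneg (D p : ℕ) (ε : ℝ) : 0 ≤ wt D p * (p : ℝ) ^ (-ε) :=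
  mul_nonneg (wt_nonneg _ _) (by positivity)

lemma summable_laplace (D : ℕ) {ε : ℝ} (hε : 0 < ε) :
    Summable fun s : Finset ℕ => ∏ p ∈ s, wt D p * (p : ℝ) ^ (-ε) :=
  summable_finsetProd_of_summable_nonneg (fun p => wt_rpow_nonneg D p ε) (summable_wt_rpow D hε)

lemma hasProd_laplace (D : ℕ) {ε : ℝ} (hε : 0 < ε) :
    HasProd (fun p : ℕ => 1 + wt D p * (p : ℝ) ^ (-ε)) (laplace D ε) := by
  rw [laplace, ← tprod_one_add (summable_laplace D hε)]
  exact (multipliable_one_add_of_summable ((summable_wt_rpow D hε).congr fun p =>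
    (Real.norm_of_nonneg (wt_rpow_nonneg D p ε)).symm)).hasProd

/-- The source of every saving in D₀: relative errors O(p⁻²) at primes beyond D multiply to
exp(O(1/D)). -/
lemma sum_inv_sq_le {D : ℕ} (hD : D ≠ 0) (s : Finset ℕ) (hs : ∀ p ∈ s, D < p) :
    ∑ p ∈ s, 1 / (p : ℝ) ^ 2 ≤ 1 / (D : ℝ) := by
  have h1 : s ⊆ Finset.Ioc D (max D (s.sup id)) := fun p hp => Finset.mem_Ioc.2
    ⟨hs p hp, (Finset.le_sup (f := id) hp).trans (le_max_right _ _)⟩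
  refine (Finset.sum_le_sum_of_subset_of_nonneg h1 fun p _ _ => by positivity).trans ?_
  have h2 := sum_Ioc_inv_sq_le_sub (α := ℝ) hD (le_max_left D (s.sup id))
  simp only [one_div]
  refine h2.trans (sub_le_self _ (by positivity))

lemma prod_one_add_le_exp {ι : Type*} (s : Finset ι) (f : ι → ℝ) (hf : ∀ i ∈ s, 0 ≤ f i) :
    ∏ i ∈ s, (1 + f i) ≤ Real.exp (∑ i ∈ s, f i) := by
  rw [Real.exp_sum]
  refine Finset.prod_le_prod (fun i hi => by linarith [hf i hi]) fun i _ => ?_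
  linarith [Real.add_one_le_exp (f i)]

/-- The Euler factors of the primes `p > D`, `p ≡ 3 (mod 4)`. -/
def tailFactor (D : ℕ) (ε : ℝ) (p : ℕ) : ℝ :=
  if p.Prime ∧ p % 4 = 3 ∧ D < p then (1 - (p : ℝ) ^ (-(1 + ε)))⁻¹ else 1

/-- The finite part `∏_{p ≤ D} (1 - p^{-1-ε})`. -/
def headProd (D : ℕ) (ε : ℝ) : ℝ :=
  ∏ p ∈ (Finset.range (D + 1)).filter (fun p => p.Prime ∧ p % 4 = 3), (1 - (p : ℝ) ^ (-(1 + ε)))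

lemma hasProd_tailFactor (D : ℕ) {ε : ℝ} (hε : 0 < ε) :
    HasProd (tailFactor D ε) (dirichletSum chiThree (1 + ε) * headProd D ε) := by
  have h1 := hasProd_chiThree (by linarith : 1 < 1 + ε)
  have h2 : HasProd (fun p : ℕ => if p ∈ (Finset.range (D + 1)).filter
      (fun p => p.Prime ∧ p % 4 = 3) then 1 - (p : ℝ) ^ (-(1 + ε)) else 1) (headProd D ε) := by
    have := hasProd_prod_of_ne_finset_one (s := (Finset.range (D + 1)).filter
      (fun p => p.Prime ∧ p % 4 = 3)) (f := fun p : ℕ => if p ∈ (Finset.range (D + 1)).filter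
      (fun p => p.Prime ∧ p % 4 = 3) then 1 - (p : ℝ) ^ (-(1 + ε)) else 1)
      (fun p hp => if_neg hp) (L := .unconditional ℕ)
    rw [headProd]
    convert! this using 1
    exact Finset.prod_congr rfl fun p hp => (if_pos hp).symm
  convert h1.mul h2 using 2 with p
  rw [tailFactor]
  by_cases hT : p.Prime ∧ p % 4 = 3
  · have hlt := rpow_neg_prime_lt_one hT.1 (by linarith : 0 < 1 + ε)
    have hne : 1 - (p : ℝ) ^ (-(1 + ε)) ≠ 0 := by linarith
    by_cases hD : D < p
    · have : ¬ p < D + 1 := by omega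
      simp [hT, hD, this]
    · have : p < D + 1 := by omega
      rw [if_neg (fun h => hD h.2.2), if_pos hT, if_pos (by simp [hT, this]),
        inv_mul_cancel₀ hne]
  · have : ¬ (p.Prime ∧ p % 4 = 3 ∧ D < p) := fun h => hT ⟨h.1, h.2.1⟩
    simp only [if_neg this, Finset.mem_filter, hT, and_false, if_false, mul_one]

/-- For a prime in the tail and x = p^(-ε), the ratio of the two Euler factors is exactly 1 + x(1 -
x)/(p(p - 1)), and 0 < x < 1. -/
lemma tailFactor_le (D p : ℕ) {ε : ℝ} (hε : 0 < ε) :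
    1 ≤ tailFactor D ε p ∧ tailFactor D ε p ≤ 1 + wt D p * (p : ℝ) ^ (-ε) ∧
      1 + wt D p * (p : ℝ) ^ (-ε) ≤
        tailFactor D ε p * (1 + if D < p then 2 * (1 / (p : ℝ) ^ 2) else 0) := by
  rw [tailFactor, wt]
  by_cases h : p.Prime ∧ p % 4 = 3 ∧ D < p
  · rw [if_pos h, if_pos h, if_pos h.2.2]
    have hp : (2 : ℝ) ≤ p := by exact_mod_cast h.1.two_le
    have hx1 := rpow_neg_prime_lt_one h.1 hε
    have hx0 : 0 < (p : ℝ) ^ (-ε) := Real.rpow_pos_of_pos (by linarith) _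
    have hx : (p : ℝ) ^ (-(1 + ε)) = (p : ℝ) ^ (-ε) / p := by
      rw [neg_add, add_comm, Real.rpow_add (by linarith), Real.rpow_neg_one, div_eq_mul_inv]
    rw [hx]
    set x := (p : ℝ) ^ (-ε)
    have h1 : 0 < (p : ℝ) - x := by linarith
    have h2 : 0 < (p : ℝ) - 1 := by linarith
    have h0 : (0 : ℝ) < p := by linarith
    have e1 : (1 - x / p)⁻¹ = p / (p - x) := by field_simp
    have e2 : 1 + 1 / ((p : ℝ) - 1) * x = (p - 1 + x) / (p - 1) := by field_simp
    rw [e1, e2]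
    refine ⟨?_, ?_, ?_⟩
    · rw [le_div_iff₀ h1]; linarith
    · rw [div_le_div_iff₀ h1 h2]; nlinarith
    · have e3 : (p : ℝ) / (p - x) * (1 + 2 * (1 / (p : ℝ) ^ 2)) = (p ^ 2 + 2) / (p * (p - x)) := by
        field_simp
      rw [e3, div_le_div_iff₀ h2 (by positivity)]
      have e4 : ((p : ℝ) - 1 + x) * (p * (p - x)) = (p - 1) * p ^ 2 + p * (x * (1 - x)) := by ring
      rw [e4]
      have h3 : x * (1 - x) ≤ 1 / 4 := by nlinarith [sq_nonneg (x - 1 / 2)]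
      nlinarith
  · rw [if_neg h, if_neg h]
    refine ⟨le_rfl, by simp, ?_⟩
    split_ifs <;> simp

/-- Removing the factors at p ≤ D from the full Dirichlet series leaves the tail product, which
differs from the Laplace transform only by O(p⁻²) per factor. The comparison is made on finite
products and passes to the limit. -/
lemma laplace_bounds {D : ℕ} (hD : D ≠ 0) {ε : ℝ} (hε : 0 < ε) :
    dirichletSum chiThree (1 + ε) * headProd D ε ≤ laplace D ε ∧
      laplace D ε ≤ dirichletSum chiThree (1 + ε) * headProd D ε * Real.exp (2 / D) := by
  have h1 := hasProd_tailFactor D hε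
  have h2 := hasProd_laplace D hε
  have h0 : ∀ p, 0 ≤ tailFactor D ε p := fun p => zero_le_one.trans (tailFactor_le D p hε).1
  constructor
  · exact le_of_tendsto_of_tendsto' h1 h2 fun s =>
      Finset.prod_le_prod (fun p _ => h0 p) fun p _ => (tailFactor_le D p hε).2.1
  · refine le_of_tendsto_of_tendsto' h2 (h1.mul_const (Real.exp (2 / D))) fun s => ?_
    refine (Finset.prod_le_prod (fun p _ => ?_)
      fun p _ => (tailFactor_le D p hε).2.2).trans ?_
    · linarith [wt_rpow_nonneg D p ε]
    rw [Finset.prod_mul_distrib]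
    refine mul_le_mul_of_nonneg_left ?_ (Finset.prod_nonneg fun p _ => h0 p)
    refine (prod_one_add_le_exp _ _ fun p _ => by split_ifs <;> positivity).trans ?_
    rw [Real.exp_le_exp, ← Finset.sum_filter, ← Finset.mul_sum]
    have := sum_inv_sq_le hD (s.filter fun p => D < p) fun p hp => (Finset.mem_filter.1 hp).2
    calc _ ≤ 2 * (1 / (D : ℝ)) := by gcongr
      _ = 2 / D := by ring

/-- Since 1 - p^(-ε) ≤ ε log p ≤ ε(p - 1), passing from ε = 0 to ε costs at most a factor 1 + ε at
each of at most D + 1 primes. With ε of order 1/log R this is negligible. -/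
lemma headProd_bounds (D : ℕ) {ε : ℝ} (hε : 0 < ε) :
    density D ≤ headProd D ε ∧ headProd D ε ≤ density D * Real.exp (ε * (D + 1)) := by
  have key : ∀ p ∈ (Finset.range (D + 1)).filter (fun p => p.Prime ∧ p % 4 = 3),
      0 ≤ 1 - 1 / (p : ℝ) ∧ 1 - 1 / (p : ℝ) ≤ 1 - (p : ℝ) ^ (-(1 + ε)) ∧
        1 - (p : ℝ) ^ (-(1 + ε)) ≤ (1 - 1 / (p : ℝ)) * (1 + ε) := by
    intro p hp
    have hp := (Finset.mem_filter.1 hp).2.1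
    have h2 : (2 : ℝ) ≤ p := by exact_mod_cast hp.two_le
    have h0 : (0 : ℝ) < p := by linarith
    have hx1 := rpow_neg_prime_lt_one hp hε
    have hx : (p : ℝ) ^ (-(1 + ε)) = (p : ℝ) ^ (-ε) / p := by
      rw [neg_add, add_comm, Real.rpow_add h0, Real.rpow_neg_one, div_eq_mul_inv]
    have hlog : 1 - (p : ℝ) ^ (-ε) ≤ ε * (p - 1) := by
      have h3 := Real.add_one_le_exp (-(Real.log p * ε))
      have h4 : (p : ℝ) ^ (-ε) = Real.exp (-(Real.log p * ε)) := by
        rw [Real.rpow_def_of_pos h0, mul_neg]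
      have h5 := Real.log_le_sub_one_of_pos h0
      rw [h4]
      nlinarith
    rw [hx]
    refine ⟨?_, ?_, ?_⟩
    · rw [sub_nonneg, div_le_one h0]; linarith
    · gcongr
    · have e : (1 - 1 / (p : ℝ)) * (1 + ε) - (1 - (p : ℝ) ^ (-ε) / p) =
          (ε * (p - 1) - (1 - (p : ℝ) ^ (-ε))) / p := by
        field_simp
        ring
      have : 0 ≤ (ε * (p - 1) - (1 - (p : ℝ) ^ (-ε))) / p := div_nonneg (by linarith) h0.le
      linarith
  constructor
  · exact Finset.prod_le_prod (fun p hp => (key p hp).1) fun p hp => (key p hp).2.1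
  · refine (Finset.prod_le_prod (fun p hp => (key p hp).1.trans (key p hp).2.1)
      fun p hp => (key p hp).2.2).trans ?_
    rw [Finset.prod_mul_distrib]
    refine mul_le_mul_of_nonneg_left ?_ (density_pos D).le
    refine (prod_one_add_le_exp _ _ fun p _ => hε.le).trans ?_
    rw [Real.exp_le_exp, Finset.sum_const, nsmul_eq_mul, mul_comm]
    refine mul_le_mul_of_nonneg_left ?_ hε.le
    have := Finset.card_filter_le (Finset.range (D + 1)) fun p => p.Prime ∧ p % 4 = 3
    rw [Finset.card_range] at this
    exact_mod_cast this

lemma log_R {θ : ℝ} {N : ℕ} (hN : N ≠ 0) : Real.log (R θ N) = θ / 2 * Real.log N := by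
  rw [R, Real.log_rpow (by positivity)]

lemma tendsto_log_R {θ : ℝ} (hθ : 0 < θ) :
    Tendsto (fun N : ℕ => Real.log (R θ N)) atTop atTop := by
  have h : Tendsto (fun N : ℕ => θ / 2 * Real.log N) atTop atTop :=
    (Real.tendsto_log_atTop.comp tendsto_natCast_atTop_atTop).const_mul_atTop (by positivity)
  refine h.congr' ?_
  filter_upwards [eventually_ne_atTop 0] with N hN
  exact (log_R hN).symm

lemma tendsto_floor_D0 : Tendsto (fun N : ℕ => ⌊D0 N⌋₊) atTop atTop := by
  refine tendsto_nat_floor_atTop.comp ?_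
  exact (tendsto_pow_atTop three_ne_zero).comp
    (Real.tendsto_log_atTop.comp (Real.tendsto_log_atTop.comp tendsto_natCast_atTop_atTop))

/-- D₀ is a power of log log N while log R is proportional to log N; this lets `headProd` be
replaced by `density`. -/
lemma tendsto_floor_D0_div_log_R {θ : ℝ} (hθ : 0 < θ) :
    Tendsto (fun N : ℕ => ((⌊D0 N⌋₊ : ℝ) + 1) / Real.log (R θ N)) atTop (𝓝 0) := by
  have h1 : Tendsto (fun x : ℝ => Real.log x ^ 3 / x) atTop (𝓝 0) :=
    (Real.isLittleO_pow_log_id_atTop (n := 3)).tendsto_div_nhds_zero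
  have hlog : Tendsto (fun N : ℕ => Real.log N) atTop atTop :=
    Real.tendsto_log_atTop.comp tendsto_natCast_atTop_atTop
  have h2 := ((h1.comp hlog).add (tendsto_inv_atTop_zero.comp hlog)).const_mul (2 / θ)
  rw [add_zero, mul_zero] at h2
  refine squeeze_zero' ?_ ?_ h2
  · filter_upwards [(tendsto_log_R hθ).eventually_gt_atTop 0] with N hN
    positivity
  · filter_upwards [hlog.eventually_ge_atTop 1, eventually_ne_atTop 0] with N hN hN0
    simp only [Function.comp]
    have h0 : 0 ≤ D0 N := pow_nonneg (Real.log_nonneg hN) 3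
    have h3 : (⌊D0 N⌋₊ : ℝ) ≤ Real.log (Real.log N) ^ 3 := Nat.floor_le h0
    rw [log_R hN0]
    calc ((⌊D0 N⌋₊ : ℝ) + 1) / (θ / 2 * Real.log N)
        ≤ (Real.log (Real.log N) ^ 3 + 1) / (θ / 2 * Real.log N) := by gcongr
      _ = _ := by field_simp

lemma B_eq (θ : ℝ) (N : ℕ) :
    B θ N = 2 * A / Real.pi * (density ⌊D0 N⌋₊ * √(Real.log (R θ N))) := by
  rw [B, ← totient_W3_div]
  ring

lemma eventually_B_pos {θ : ℝ} (hθ : 0 < θ) : ∀ᶠ N : ℕ in atTop, 0 < B θ N := by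
  filter_upwards [(tendsto_log_R hθ).eventually_gt_atTop 0] with N hN
  rw [B_eq]
  have := A_pos
  have := Real.pi_pos
  have := density_pos ⌊D0 N⌋₊
  positivity

/-- The normalised Laplace transforms of the sieve weights converge to that of `x^{-1/2} dx`. -/
lemma tendsto_laplace {θ : ℝ} (hθ : 0 < θ) {c : ℝ} (hc : 0 < c) :
    Tendsto (fun N : ℕ => laplace ⌊D0 N⌋₊ (c / Real.log (R θ N)) / B θ N) atTop
      (𝓝 (√Real.pi / √c)) := by
  have hlog := tendsto_log_R hθ
  have hε : Tendsto (fun N : ℕ => 1 + c / Real.log (R θ N)) atTop (𝓝[>] 1) := by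
    refine tendsto_nhdsWithin_iff.2 ⟨?_, ?_⟩
    · simpa using (hlog.const_div_atTop c).const_add 1
    · filter_upwards [hlog.eventually_gt_atTop 0] with N hN
      exact lt_add_of_pos_right _ (div_pos hc hN)
  have hA := A_pos
  have hpi := Real.pi_pos
  -- The constant is √(log R) · density / (B √c); together with √ε = √c / √(log R) it turns the
  -- normalisation of the Dirichlet series into division by B.
  have hmain := (tendsto_dirichletSum_chiThree.comp hε).const_mul (Real.pi / (2 * A * √c))
  have hval : Real.pi / (2 * A * √c) * (2 * A / √Real.pi) = √Real.pi / √c := by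
    have h1 : Real.pi = √Real.pi * √Real.pi := (Real.mul_self_sqrt hpi.le).symm
    have : √Real.pi ≠ 0 := by positivity
    field_simp
    rw [sq]
    exact h1
  rw [hval] at hmain
  have hexp1 : Tendsto (fun N : ℕ => Real.exp (2 / (⌊D0 N⌋₊ : ℝ) +
      c / Real.log (R θ N) * (⌊D0 N⌋₊ + 1))) atTop (𝓝 1) := by
    have h1 : Tendsto (fun N : ℕ => 2 / (⌊D0 N⌋₊ : ℝ)) atTop (𝓝 0) :=
      (tendsto_natCast_atTop_atTop.comp tendsto_floor_D0).const_div_atTop 2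
    have h2 := (tendsto_floor_D0_div_log_R hθ).const_mul c
    have h3 := h1.add h2
    rw [mul_zero, add_zero] at h3
    have h4 := (Real.continuous_exp.tendsto 0).comp h3
    rw [Real.exp_zero] at h4
    refine h4.congr fun N => ?_
    simp only [Function.comp]
    congr 2
    ring
  have hupper := hmain.mul hexp1
  rw [mul_one] at hupper
  refine tendsto_of_tendsto_of_tendsto_of_le_of_le' hmain hupper ?_ ?_
  all_goals
    filter_upwards [hlog.eventually_gt_atTop 0, tendsto_floor_D0.eventually_gt_atTop 0] with N hN hD
    set ε := c / Real.log (R θ N) with hεdef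
    set D := ⌊D0 N⌋₊
    have hε0 : 0 < ε := div_pos hc hN
    have hV := density_pos D
    have hP : 0 < dirichletSum chiThree (1 + ε) :=
      zero_lt_one.trans_le (dirichletSum_chiThree_pos (by linarith))
    have hl := laplace_bounds hD.ne' hε0
    have hh := headProd_bounds D hε0
    have hB : 0 < B θ N := by rw [B_eq]; positivity
    have hsq : √(Real.log (R θ N)) * √ε = √c := by
      rw [← Real.sqrt_mul hN.le, hεdef, mul_div_cancel₀ _ hN.ne']
    have e : Real.pi / (2 * A * √c) * (√ε * dirichletSum chiThree (1 + ε)) =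
        dirichletSum chiThree (1 + ε) * density D / B θ N := by
      have hBe : B θ N = 2 * A / Real.pi * (density D * √(Real.log (R θ N))) := B_eq θ N
      rw [hBe, ← hsq]
      have : 0 < √ε := Real.sqrt_pos.2 hε0
      have : 0 < √(Real.log (R θ N)) := Real.sqrt_pos.2 hN
      field_simp
    simp only [Function.comp, add_sub_cancel_left]
    rw [e]
  · gcongr
    exact (mul_le_mul_of_nonneg_left hh.1 hP.le).trans hl.1
  · rw [div_mul_eq_mul_div]
    gcongr
    refine hl.2.trans ?_
    rw [Real.exp_add]
    calc _ ≤ dirichletSum chiThree (1 + ε) * (density D * Real.exp (ε * (D + 1))) *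
          Real.exp (2 / D) := by gcongr; exact hh.2
      _ = _ := by ring

section

open MeasureTheory

/-! ### A Tauberian theorem of Karamata type -/

lemma integrableOn_exp_inv_sqrt (m : ℕ) (hm : 0 < m) :
    IntegrableOn (fun t : ℝ => Real.exp (-(m * t)) * (√t)⁻¹) (Set.Ioi 0) := by
  have h := Real.GammaIntegral_convergent (show (0 : ℝ) < 1 / 2 by norm_num)
  have hm1 : (1 : ℝ) ≤ m := by exact_mod_cast hm
  refine h.mono' (by fun_prop) ?_
  filter_upwards [ae_restrict_mem measurableSet_Ioi] with t (ht : 0 < t)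
  have e : t ^ ((1 / 2 : ℝ) - 1) = (√t)⁻¹ := by
    rw [Real.sqrt_eq_rpow, ← Real.rpow_neg ht.le]
    norm_num
  rw [e, Real.norm_of_nonneg (by positivity)]
  gcongr
  nlinarith

lemma integral_exp_inv_sqrt (m : ℕ) (hm : 0 < m) :
    ∫ t in Set.Ioi (0 : ℝ), Real.exp (-(m * t)) * (√t)⁻¹ = √Real.pi / √m := by
  have hm0 : (0 : ℝ) < m := by exact_mod_cast hm
  have h := Real.integral_rpow_mul_exp_neg_mul_Ioi (show (0 : ℝ) < 1 / 2 by norm_num) hm0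
  rw [Real.Gamma_one_half_eq, ← Real.sqrt_eq_rpow, Real.sqrt_div zero_le_one, Real.sqrt_one] at h
  rw [show √Real.pi / √(m : ℝ) = 1 / √(m : ℝ) * √Real.pi by ring, ← h]
  refine setIntegral_congr_fun measurableSet_Ioi fun t (ht : 0 < t) => ?_
  have e : t ^ ((1 / 2 : ℝ) - 1) = (√t)⁻¹ := by
    rw [Real.sqrt_eq_rpow, ← Real.rpow_neg ht.le]
    norm_num
  simp only [e]
  ring

/-- A family of non-negative discrete measures `∑ i, a N i δ_{x N i}` on `[0, ∞)` whose Laplace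
transforms at the positive integers converge to those of `t^{-1/2} dt`. -/
structure LaplaceConverges {ι : Type*} (a x : ℕ → ι → ℝ) : Prop where
  nonneg : ∀ N i, 0 ≤ a N i
  pos : ∀ᶠ N in atTop, ∀ i, 0 ≤ x N i
  summable : ∀ᶠ N in atTop, Summable fun i => a N i * Real.exp (-x N i)
  tendsto : ∀ m : ℕ, 0 < m → Tendsto (fun N => ∑' i, a N i * Real.exp (-(m * x N i))) atTop
    (𝓝 (√Real.pi / √m))

namespace LaplaceConverges

variable {ι : Type*} {a x : ℕ → ι → ℝ}

/-- All test functions below are O(e^(-t)) on [0, ∞), so this one criterion covers every summability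
question. -/
lemma summable_of_bounded (H : LaplaceConverges a x) :
    ∀ᶠ N in atTop, ∀ (ψ : ι → ℝ) (M : ℝ), (∀ i, |ψ i| ≤ M * Real.exp (-x N i)) →
      Summable fun i => a N i * ψ i := by
  filter_upwards [H.summable] with N hs ψ M hψ
  refine Summable.of_norm_bounded (hs.mul_left M) fun i => ?_
  rw [Real.norm_eq_abs, abs_mul, abs_of_nonneg (H.nonneg N i)]
  calc a N i * |ψ i| ≤ a N i * (M * Real.exp (-x N i)) :=
        mul_le_mul_of_nonneg_left (hψ i) (H.nonneg N i)
    _ = M * (a N i * Real.exp (-x N i)) := by ring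

lemma exists_bound {φ : ℝ → ℝ} (hφ : Continuous φ) :
    ∃ M, ∀ u ∈ Set.Icc (0 : ℝ) 1, |φ u| ≤ M :=
  isCompact_Icc.exists_bound_of_continuousOn hφ.continuousOn

lemma exp_neg_mem {t : ℝ} (ht : 0 ≤ t) : Real.exp (-t) ∈ Set.Icc (0 : ℝ) 1 :=
  ⟨(Real.exp_pos _).le, Real.exp_le_one_iff.2 (neg_nonpos.2 ht)⟩

lemma integrableOn_of_bounded {ψ : ℝ → ℝ} (hψ : Measurable ψ) {M : ℝ}
    (hM : ∀ t, 0 < t → |ψ t| ≤ M * Real.exp (-t)) :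
    IntegrableOn (fun t => ψ t * (√t)⁻¹) (Set.Ioi 0) := by
  refine ((integrableOn_exp_inv_sqrt 1 one_pos).const_mul M).mono' (by fun_prop) ?_
  filter_upwards [ae_restrict_mem measurableSet_Ioi] with t (ht : 0 < t)
  rw [Real.norm_eq_abs, abs_mul, abs_of_nonneg (by positivity : 0 ≤ (√t)⁻¹), ← mul_assoc]
  have := hM t ht
  simp only [Nat.cast_one, one_mul]
  gcongr

/-- The factor e^(-t) in front turns the monomial uⁿ, u = e^(-t), into e^(-(n+1)t), so only Laplace
transforms at positive integers occur. At 0 the limit measure has infinite mass. -/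
lemma tendsto_polynomial (H : LaplaceConverges a x) (p : Polynomial ℝ) :
    Tendsto (fun N => ∑' i, a N i * (Real.exp (-x N i) * p.eval (Real.exp (-x N i)))) atTop
      (𝓝 (∫ t in Set.Ioi (0 : ℝ), Real.exp (-t) * p.eval (Real.exp (-t)) * (√t)⁻¹)) := by
  induction p using Polynomial.induction_on' with
  | add p q hp hq =>
    obtain ⟨Mp, hMp⟩ := exists_bound p.continuous
    obtain ⟨Mq, hMq⟩ := exists_bound q.continuous
    have key : ∀ (p : Polynomial ℝ) (M : ℝ), (∀ u ∈ Set.Icc (0 : ℝ) 1, |p.eval u| ≤ M) →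
        ∀ t, 0 ≤ t → |Real.exp (-t) * p.eval (Real.exp (-t))| ≤ M * Real.exp (-t) :=
      fun p M hM t ht => by
        rw [abs_mul, Real.abs_exp, mul_comm]
        exact mul_le_mul_of_nonneg_right (hM _ (exp_neg_mem ht)) (Real.exp_pos _).le
    have hint : ∫ t in Set.Ioi (0 : ℝ), Real.exp (-t) * (p + q).eval (Real.exp (-t)) * (√t)⁻¹ =
        (∫ t in Set.Ioi (0 : ℝ), Real.exp (-t) * p.eval (Real.exp (-t)) * (√t)⁻¹) +
        ∫ t in Set.Ioi (0 : ℝ), Real.exp (-t) * q.eval (Real.exp (-t)) * (√t)⁻¹ := by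
      rw [← integral_add]
      · refine integral_congr_ae (Eventually.of_forall fun t => ?_)
        simp only [Polynomial.eval_add]
        ring
      · exact integrableOn_of_bounded (by fun_prop) fun t ht => key p Mp hMp t ht.le
      · exact integrableOn_of_bounded (by fun_prop) fun t ht => key q Mq hMq t ht.le
    rw [hint]
    refine (hp.add hq).congr' ?_
    filter_upwards [H.summable_of_bounded, H.pos] with N hs hx
    rw [← (hs _ Mp fun i => key p Mp hMp _ (hx i)).tsum_add
      (hs _ Mq fun i => key q Mq hMq _ (hx i))]
    refine tsum_congr fun i => ?_
    rw [Polynomial.eval_add]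
    ring
  | monomial n c =>
    have h := (H.tendsto (n + 1) n.succ_pos).const_mul c
    rw [← integral_exp_inv_sqrt (n + 1) n.succ_pos, ← integral_const_mul] at h
    have e : ∀ t : ℝ, Real.exp (-(((n + 1 : ℕ) : ℝ) * t)) =
        Real.exp (-t) * Real.exp (-t) ^ n := fun t => by
      rw [← Real.exp_nat_mul, ← Real.exp_add]
      congr 1
      push_cast
      ring
    convert h using 2 with N
    · rw [← tsum_mul_left]
      refine tsum_congr fun i => ?_
      rw [Polynomial.eval_monomial, e]
      ring
    · refine integral_congr_ae (Eventually.of_forall fun t => ?_)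
      simp only [Polynomial.eval_monomial, e]
      ring

/-- Weierstrass approximation in u = e^(-t) ∈ [0, 1]: a uniform error η in φ costs η times the mass
of e^(-t), which stays bounded along the sequence. -/
lemma tendsto_exp_comp (H : LaplaceConverges a x) {φ : ℝ → ℝ} (hφ : Continuous φ) :
    Tendsto (fun N => ∑' i, a N i * (Real.exp (-x N i) * φ (Real.exp (-x N i)))) atTop
      (𝓝 (∫ t in Set.Ioi (0 : ℝ), Real.exp (-t) * φ (Real.exp (-t)) * (√t)⁻¹)) := by
  have h1 := H.tendsto 1 one_pos
  have hI := integral_exp_inv_sqrt 1 one_pos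
  simp only [Nat.cast_one, one_mul, Real.sqrt_one, div_one] at h1 hI
  have hpi : 0 < √Real.pi := Real.sqrt_pos.2 Real.pi_pos
  rw [Metric.tendsto_atTop]
  intro ε hε
  -- The three terms pay for replacing φ by a polynomial in the sum, for the convergence of the
  -- polynomial sums, and for going back to φ in the integral.
  obtain ⟨η, hη, hηε⟩ : ∃ η > 0, η * (√Real.pi + 1) + η + η * √Real.pi < ε := by
    refine ⟨ε / (2 * (2 * √Real.pi + 2)), by positivity, ?_⟩
    field_simp
    linarith
  obtain ⟨p, hp⟩ := exists_polynomial_near_of_continuousOn 0 1 φ hφ.continuousOn η hη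
  have h2 := H.tendsto_polynomial p
  obtain ⟨Mφ, hMφ⟩ := exists_bound hφ
  obtain ⟨Mp, hMp⟩ := exists_bound p.continuous
  have key : ∀ (φ : ℝ → ℝ) (M : ℝ), (∀ u ∈ Set.Icc (0 : ℝ) 1, |φ u| ≤ M) →
      ∀ t, 0 ≤ t → |Real.exp (-t) * φ (Real.exp (-t))| ≤ M * Real.exp (-t) :=
    fun p M hM t ht => by
      rw [abs_mul, Real.abs_exp, mul_comm]
      exact mul_le_mul_of_nonneg_right (hM _ (exp_neg_mem ht)) (Real.exp_pos _).le
  have hint : |(∫ t in Set.Ioi (0 : ℝ), Real.exp (-t) * φ (Real.exp (-t)) * (√t)⁻¹) -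
      ∫ t in Set.Ioi (0 : ℝ), Real.exp (-t) * p.eval (Real.exp (-t)) * (√t)⁻¹| ≤
      η * √Real.pi := by
    rw [← integral_sub (integrableOn_of_bounded (by fun_prop) fun t ht => key φ Mφ hMφ t ht.le)
      (integrableOn_of_bounded (by fun_prop) fun t ht => key _ Mp hMp t ht.le), ← hI,
      ← integral_const_mul, ← Real.norm_eq_abs]
    have hi := (integrableOn_exp_inv_sqrt 1 one_pos).const_mul η
    simp only [Nat.cast_one, one_mul] at hi
    refine norm_integral_le_of_norm_le hi ?_
    filter_upwards [ae_restrict_mem measurableSet_Ioi] with t (ht : 0 < t)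
    rw [← sub_mul, ← mul_sub, norm_mul, norm_mul, Real.norm_of_nonneg (Real.exp_pos _).le,
      Real.norm_of_nonneg (by positivity : 0 ≤ (√t)⁻¹), Real.norm_eq_abs, abs_sub_comm]
    have := (hp _ (exp_neg_mem ht.le)).le
    calc _ ≤ Real.exp (-t) * η * (√t)⁻¹ := by gcongr
      _ = _ := by ring
  have hev := (H.summable_of_bounded.and H.pos).and
    ((h1.eventually_lt_const (by linarith : √Real.pi < √Real.pi + 1)).and
      (Metric.tendsto_nhds.1 h2 η hη))
  obtain ⟨N₀, hN₀⟩ := eventually_atTop.1 hev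
  refine ⟨N₀, fun N hN => ?_⟩
  obtain ⟨⟨hs, hx⟩, hb, hd⟩ := hN₀ N hN
  have hsum : |(∑' i, a N i * (Real.exp (-x N i) * φ (Real.exp (-x N i)))) -
      ∑' i, a N i * (Real.exp (-x N i) * p.eval (Real.exp (-x N i)))| ≤ η * (√Real.pi + 1) := by
    rw [← (hs _ Mφ fun i => key φ Mφ hMφ _ (hx i)).tsum_sub
      (hs _ Mp fun i => key _ Mp hMp _ (hx i)), ← Real.norm_eq_abs]
    have hs1 := (hs (fun i => Real.exp (-x N i)) 1 fun i => by
      rw [Real.abs_exp, one_mul]).mul_left η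
    refine (tsum_of_norm_bounded hs1.hasSum fun i => ?_).trans ?_
    · rw [← mul_sub, ← mul_sub, norm_mul, norm_mul, Real.norm_of_nonneg (H.nonneg N i),
        Real.norm_of_nonneg (Real.exp_pos _).le, Real.norm_eq_abs, abs_sub_comm]
      have := (hp _ (exp_neg_mem (hx i))).le
      have h0 := H.nonneg N i
      calc _ ≤ a N i * (Real.exp (-x N i) * η) := by gcongr
        _ = _ := by ring
    · rw [tsum_mul_left]
      gcongr
  rw [Real.dist_eq] at hd ⊢
  rw [abs_lt] at hd ⊢
  rw [abs_le] at hsum hint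
  constructor <;> linarith

lemma tendsto_of_support (H : LaplaceConverges a x) {ψ : ℝ → ℝ} (hψ : Continuous ψ)
    (h0 : ∀ t, 2 ≤ t → ψ t = 0) :
    Tendsto (fun N => ∑' i, a N i * ψ (x N i)) atTop
      (𝓝 (∫ t in Set.Ioi (0 : ℝ), ψ t * (√t)⁻¹)) := by
  -- This is ψ(-log u)/u, with u kept above e⁻² for continuity at 0. For t ≥ 2 the numerator becomes
  -- ψ(2) = 0, in agreement with ψ(t) = 0.
  set φ : ℝ → ℝ := fun u => ψ (-Real.log (max u (Real.exp (-2)))) / max u (Real.exp (-2))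
  have hpos : ∀ u : ℝ, 0 < max u (Real.exp (-2)) := fun u =>
    (Real.exp_pos _).trans_le (le_max_right _ _)
  have hφ : Continuous φ := by
    have hm : Continuous fun u : ℝ => max u (Real.exp (-2)) := by fun_prop
    exact (hψ.comp (hm.log fun u => (hpos u).ne').neg).div hm fun u => (hpos u).ne'
  have e : ∀ t, Real.exp (-t) * φ (Real.exp (-t)) = ψ t := fun t => by
    simp only [φ]
    rcases le_total t 2 with ht | ht
    · rw [max_eq_left (Real.exp_le_exp.2 (neg_le_neg ht)), Real.log_exp, neg_neg,
        mul_div_cancel₀ _ (Real.exp_pos _).ne']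
    · rw [max_eq_right (Real.exp_le_exp.2 (neg_le_neg ht)), Real.log_exp, neg_neg, h0 2 le_rfl,
        h0 t ht, zero_div, mul_zero]
  simpa only [e] using H.tendsto_exp_comp hφ

lemma abs_le_exp_of_support {ψ : ℝ → ℝ} {M : ℝ} (hM : ∀ t ∈ Set.Icc (0 : ℝ) 2, |ψ t| ≤ M)
    (h0 : ∀ t, 2 < t → ψ t = 0) (t : ℝ) (ht : 0 ≤ t) :
    |ψ t| ≤ M * Real.exp 2 * Real.exp (-t) := by
  rcases le_or_gt t 2 with h | h
  · have hm := hM t ⟨ht, h⟩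
    have hM0 : 0 ≤ M := (abs_nonneg _).trans hm
    rw [mul_assoc, ← Real.exp_add]
    exact hm.trans (le_mul_of_one_le_right hM0 (Real.one_le_exp (by linarith)))
  · rw [h0 t h, abs_zero]
    have hM0 : 0 ≤ M := (abs_nonneg _).trans (hM 0 (by norm_num))
    positivity

/-- The continuous cut-off equal to `1` for `t ≤ b` and to `0` for `t ≥ b + δ`. -/
def cutoff (b δ t : ℝ) : ℝ := min 1 (max 0 ((b + δ - t) / δ))

lemma continuous_cutoff (b δ : ℝ) : Continuous (cutoff b δ) := by
  unfold cutoff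
  fun_prop

lemma cutoff_eq_one {b δ t : ℝ} (hδ : 0 < δ) (h : t ≤ b) : cutoff b δ t = 1 := by
  have : 1 ≤ (b + δ - t) / δ := by rw [le_div_iff₀ hδ]; linarith
  rw [cutoff, max_eq_right (by linarith), min_eq_left this]

lemma cutoff_eq_zero {b δ t : ℝ} (hδ : 0 < δ) (h : b + δ ≤ t) : cutoff b δ t = 0 := by
  have : (b + δ - t) / δ ≤ 0 := div_nonpos_of_nonpos_of_nonneg (by linarith) hδ.le
  rw [cutoff, max_eq_left this, min_eq_right zero_le_one]

lemma cutoff_mem (b δ t : ℝ) : 0 ≤ cutoff b δ t ∧ cutoff b δ t ≤ 1 :=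
  ⟨le_min zero_le_one (le_max_left _ _), min_le_left _ _⟩

/-- The integrands differ only for |t - 1| ≤ δ, an interval of length 2δ. There the difference of
the functions is at most 2M, and t ≥ 1/2 gives t^(-1/2) ≤ 2. -/
lemma integral_near {ψ h : ℝ → ℝ} (hψ : Measurable ψ) (hh : Measurable h) {M δ : ℝ}
    (hδ : 0 < δ) (hδ1 : δ ≤ 1 / 2) (hM : ∀ t ∈ Set.Icc (0 : ℝ) 2, |h t| ≤ M)
    (hψM : ∀ t ∈ Set.Icc (0 : ℝ) 2, |ψ t| ≤ M)
    (hψ0 : ∀ t, 2 < t → ψ t = 0)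
    (heq : ∀ t, 0 < t → t ∉ Set.Icc (1 - δ) (1 + δ) → ψ t = if t ≤ 1 then h t else 0) :
    |(∫ t in Set.Ioi (0 : ℝ), ψ t * (√t)⁻¹) -
      ∫ t in Set.Ioi (0 : ℝ), (if t ≤ 1 then h t else 0) * (√t)⁻¹| ≤ 2 * δ * (4 * M) := by
  have hM0 : 0 ≤ M := (abs_nonneg _).trans (hM 0 (by norm_num))
  have hH : Measurable fun t => if t ≤ 1 then h t else 0 :=
    Measurable.ite measurableSet_Iic hh measurable_const
  have hHM : ∀ t ∈ Set.Icc (0 : ℝ) 2, |if t ≤ 1 then h t else 0| ≤ M := fun t ht => by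
    split_ifs
    · exact hM t ht
    · simpa using hM0
  rw [← integral_sub
    (integrableOn_of_bounded hψ fun t ht => abs_le_exp_of_support hψM hψ0 t ht.le)
    (integrableOn_of_bounded hH fun t ht => abs_le_exp_of_support hHM
      (fun t ht => if_neg (by linarith)) t ht.le), ← Real.norm_eq_abs]
  have hval : ∫ t in Set.Ioi (0 : ℝ), (Set.Icc (1 - δ) (1 + δ)).indicator (fun _ => 4 * M) t =
      2 * δ * (4 * M) := by
    have hsub : Set.Icc (1 - δ) (1 + δ) ⊆ Set.Ioi (0 : ℝ) := fun t ht =>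
      (by linarith [ht.1] : (0 : ℝ) < t)
    rw [setIntegral_indicator measurableSet_Icc, setIntegral_const, Set.inter_eq_right.2 hsub,
      smul_eq_mul]
    simp only [Measure.real, Real.volume_Icc]
    rw [ENNReal.toReal_ofReal (by linarith)]
    ring
  rw [← hval]
  refine norm_integral_le_of_norm_le ?_ ?_
  · exact (integrableOn_const (by simp)).integrable_indicator measurableSet_Icc |>.integrableOn
  · filter_upwards [ae_restrict_mem measurableSet_Ioi] with t (ht : 0 < t)
    by_cases hI : t ∈ Set.Icc (1 - δ) (1 + δ)
    · rw [Set.indicator_of_mem hI, ← sub_mul, norm_mul, Real.norm_eq_abs,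
        Real.norm_of_nonneg (by positivity : 0 ≤ (√t)⁻¹)]
      have h2 : t ∈ Set.Icc (0 : ℝ) 2 := ⟨ht.le, by linarith [hI.2]⟩
      have h3 : |ψ t - if t ≤ 1 then h t else 0| ≤ 2 * M := by
        have h4 := hψM t h2
        have h5 := hHM t h2
        rw [abs_le] at h4 h5 ⊢
        constructor <;> linarith
      have h6 : (√t)⁻¹ ≤ 2 := by
        rw [inv_le_comm₀ (Real.sqrt_pos.2 ht) two_pos]
        refine Real.le_sqrt_of_sq_le ?_
        have := hI.1
        norm_num
        linarith
      calc _ ≤ 2 * M * 2 := mul_le_mul h3 h6 (by positivity) (by positivity)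
        _ = 4 * M := by ring
    · rw [Set.indicator_of_notMem hI, heq t ht hI, sub_self, norm_zero]

/-- For h ≥ 0 the sharp cut at 1 lies between the continuous cut-offs starting at 1 - δ and at 1.
The limits of these two differ by O(δ), the limit measure having no atom at 1. -/
lemma tendsto_cut_of_nonneg (H : LaplaceConverges a x) {h : ℝ → ℝ} (hh : Continuous h)
    (h0 : ∀ t, 0 ≤ h t) :
    Tendsto (fun N => ∑' i, a N i * (if x N i ≤ 1 then h (x N i) else 0)) atTop
      (𝓝 (∫ t in Set.Ioi (0 : ℝ), (if t ≤ 1 then h t else 0) * (√t)⁻¹)) := by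
  obtain ⟨M, hM⟩ := isCompact_Icc.exists_bound_of_continuousOn
    (hh.continuousOn (s := Set.Icc (0 : ℝ) 2))
  have hM0 : 0 ≤ M := (norm_nonneg _).trans (hM 0 (by norm_num))
  rw [Metric.tendsto_atTop]
  intro ε hε
  obtain ⟨δ, hδ, hδ1, hδε⟩ : ∃ δ > 0, δ ≤ 1 / 2 ∧ 2 * δ * (4 * M) < ε / 2 := by
    refine ⟨min (1 / 2) (ε / (16 * M + 16)), by positivity, min_le_left _ _, ?_⟩
    calc 2 * min (1 / 2) (ε / (16 * M + 16)) * (4 * M)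
        ≤ 2 * (ε / (16 * M + 16)) * (4 * M) := by gcongr; exact min_le_right _ _
      _ < ε / 2 := by
        rw [show 2 * (ε / (16 * M + 16)) * (4 * M) = ε / 2 * (M / (M + 1)) by field_simp; ring]
        refine mul_lt_of_lt_one_right (by positivity) ?_
        rw [div_lt_one (by positivity)]
        linarith
  have main : ∀ b, (b = 1 ∨ b = 1 - δ) →
      Continuous (fun t => h t * cutoff b δ t) ∧ (∀ t, 2 ≤ t → h t * cutoff b δ t = 0) ∧
      (∀ t ∈ Set.Icc (0 : ℝ) 2, |h t * cutoff b δ t| ≤ M) ∧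
      |(∫ t in Set.Ioi (0 : ℝ), h t * cutoff b δ t * (√t)⁻¹) -
        ∫ t in Set.Ioi (0 : ℝ), (if t ≤ 1 then h t else 0) * (√t)⁻¹| ≤ 2 * δ * (4 * M) := by
    intro b hb
    have hb1 : b ≤ 1 ∧ 1 - δ ≤ b := by rcases hb with rfl | rfl <;> constructor <;> linarith
    have c1 : Continuous (fun t => h t * cutoff b δ t) := hh.mul (continuous_cutoff b δ)
    have c2 : ∀ t, 2 ≤ t → h t * cutoff b δ t = 0 := fun t ht => by
      rw [cutoff_eq_zero hδ (by linarith), mul_zero]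
    have c3 : ∀ t ∈ Set.Icc (0 : ℝ) 2, |h t * cutoff b δ t| ≤ M := fun t ht => by
      rw [abs_mul, abs_of_nonneg (cutoff_mem b δ t).1]
      exact (mul_le_of_le_one_right (abs_nonneg _) (cutoff_mem b δ t).2).trans (hM t ht)
    refine ⟨c1, c2, c3, integral_near c1.measurable hh.measurable hδ hδ1 hM c3
      (fun t ht => c2 t ht.le) fun t ht hI => ?_⟩
    rw [Set.mem_Icc, not_and_or, not_le, not_le] at hI
    rcases hI with hI | hI
    · rw [cutoff_eq_one hδ (by linarith), mul_one, if_pos (by linarith)]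
    · rw [cutoff_eq_zero hδ (by linarith), mul_zero, if_neg (by linarith)]
  obtain ⟨u1, u2, u3, u4⟩ := main 1 (Or.inl rfl)
  obtain ⟨l1, l2, l3, l4⟩ := main (1 - δ) (Or.inr rfl)
  have hu := Metric.tendsto_nhds.1 (H.tendsto_of_support u1 u2) (ε / 2) (half_pos hε)
  have hl := Metric.tendsto_nhds.1 (H.tendsto_of_support l1 l2) (ε / 2) (half_pos hε)
  obtain ⟨N₀, hN₀⟩ := eventually_atTop.1 ((H.summable_of_bounded.and H.pos).and (hu.and hl))
  refine ⟨N₀, fun N hN => ?_⟩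
  obtain ⟨⟨hs, hx⟩, hu, hl⟩ := hN₀ N hN
  have su := hs _ _ fun i => abs_le_exp_of_support u3 (fun t ht => u2 t ht.le) _ (hx i)
  have sl := hs _ _ fun i => abs_le_exp_of_support l3 (fun t ht => l2 t ht.le) _ (hx i)
  have hHM : ∀ t ∈ Set.Icc (0 : ℝ) 2, |if t ≤ 1 then h t else 0| ≤ M := fun t ht => by
    split_ifs
    · exact hM t ht
    · simpa using hM0
  have sH := hs _ _ fun i => abs_le_exp_of_support hHM
    (fun t ht => if_neg (by linarith)) _ (hx i)
  have le1 : ∑' i, a N i * (if x N i ≤ 1 then h (x N i) else 0) ≤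
      ∑' i, a N i * (h (x N i) * cutoff 1 δ (x N i)) := by
    refine sH.tsum_le_tsum (fun i => mul_le_mul_of_nonneg_left ?_ (H.nonneg N i)) su
    split_ifs with hi
    · rw [cutoff_eq_one hδ hi, mul_one]
    · exact mul_nonneg (h0 _) (cutoff_mem _ _ _).1
  have le2 : ∑' i, a N i * (h (x N i) * cutoff (1 - δ) δ (x N i)) ≤
      ∑' i, a N i * (if x N i ≤ 1 then h (x N i) else 0) := by
    refine sl.tsum_le_tsum (fun i => mul_le_mul_of_nonneg_left ?_ (H.nonneg N i)) sH
    split_ifs with hi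
    · exact mul_le_of_le_one_right (h0 _) (cutoff_mem _ _ _).2
    · rw [cutoff_eq_zero hδ (by linarith), mul_zero]
  rw [Real.dist_eq, abs_lt] at hu hl ⊢
  rw [abs_le] at u4 l4
  constructor <;> linarith

/-- Karamata's theorem: the restrictions to `[0, 1]` converge weakly to `t^{-1/2} dt`. -/
theorem tendsto_cut (H : LaplaceConverges a x) {h : ℝ → ℝ} (hh : Continuous h) :
    Tendsto (fun N => ∑' i, a N i * (if x N i ≤ 1 then h (x N i) else 0)) atTop
      (𝓝 (∫ t in Set.Icc (0 : ℝ) 1, h t * (√t)⁻¹)) := by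
  -- The sandwich needs a sign, so h is split into positive and negative parts.
  have hp : Continuous fun t => max (h t) 0 := by fun_prop
  have hn : Continuous fun t => max (-h t) 0 := by fun_prop
  have hsub := (H.tendsto_cut_of_nonneg hp fun t => le_max_right _ _).sub
    (H.tendsto_cut_of_nonneg hn fun t => le_max_right _ _)
  have bd : ∀ {h : ℝ → ℝ}, Continuous h → ∃ M, ∀ t, 0 ≤ t →
      |if t ≤ 1 then h t else 0| ≤ M * Real.exp (-t) := fun {h} hh => by
    obtain ⟨M, hM⟩ := isCompact_Icc.exists_bound_of_continuousOn
      (hh.continuousOn (s := Set.Icc (0 : ℝ) 2))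
    have hM0 : 0 ≤ M := (norm_nonneg _).trans (hM 0 (by norm_num))
    have hHM : ∀ t ∈ Set.Icc (0 : ℝ) 2, |if t ≤ 1 then h t else 0| ≤ M := fun t ht => by
      split_ifs
      · exact hM t ht
      · simpa using hM0
    exact ⟨_, abs_le_exp_of_support hHM fun t ht => if_neg (by linarith)⟩
  obtain ⟨Mp, hMp⟩ := bd hp
  obtain ⟨Mn, hMn⟩ := bd hn
  have meas : ∀ {h : ℝ → ℝ}, Continuous h → Measurable fun t => if t ≤ 1 then h t else 0 :=
    fun hh => Measurable.ite measurableSet_Iic hh.measurable measurable_const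
  have e : ∀ y : ℝ, max y 0 - max (-y) 0 = y := fun y => by
    rcases le_total y 0 with hy | hy
    · rw [max_eq_right hy, max_eq_left (by linarith)]; ring
    · rw [max_eq_left hy, max_eq_right (by linarith)]; ring
  have hval : ∫ t in Set.Icc (0 : ℝ) 1, h t * (√t)⁻¹ =
      (∫ t in Set.Ioi (0 : ℝ), (if t ≤ 1 then max (h t) 0 else 0) * (√t)⁻¹) -
      ∫ t in Set.Ioi (0 : ℝ), (if t ≤ 1 then max (-h t) 0 else 0) * (√t)⁻¹ := by
    rw [← integral_sub (integrableOn_of_bounded (meas hp) fun t ht => hMp t ht.le)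
      (integrableOn_of_bounded (meas hn) fun t ht => hMn t ht.le), integral_Icc_eq_integral_Ioc,
      ← Set.Ioi_inter_Iic, ← setIntegral_indicator measurableSet_Iic]
    refine integral_congr_ae (Eventually.of_forall fun t => ?_)
    simp only [Set.indicator, Set.mem_Iic]
    split_ifs
    · rw [← sub_mul, e]
    · simp
  rw [hval]
  refine hsub.congr' ?_
  filter_upwards [H.summable_of_bounded, H.pos] with N hs hx
  rw [← (hs _ Mp fun i => hMp _ (hx i)).tsum_sub (hs _ Mn fun i => hMn _ (hx i))]
  refine tsum_congr fun i => ?_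
  rw [← mul_sub]
  congr 1
  split_ifs
  · exact e _
  · simp

end LaplaceConverges

end

section

open MeasureTheory BoundedContinuousFunction

/-! ### Products of discrete measures -/

/-- Continuity of products is used for probability measures, so the point masses are normalised and
pushed forward to ℝ; an integral against the power measure is then a normalised multiple sum. -/
lemma exists_discrete_probabilityMeasure {σ : Type*} [Fintype σ] (c pos : σ → ℝ)
    (hc : ∀ s, 0 ≤ c s) (hg : 0 < ∑ s, c s) :
    ∃ ν : ProbabilityMeasure ℝ,
      (∀ h : ℝ →ᵇ ℝ, ∫ t, h t ∂(ν : Measure ℝ) = (∑ s, c s)⁻¹ * ∑ s, c s * h (pos s)) ∧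
      ∀ (ι : Type) [Fintype ι] [DecidableEq ι] (G : (ι → ℝ) →ᵇ ℝ),
        ∫ t, G t ∂(Measure.pi fun _ : ι => (ν : Measure ℝ)) =
          (∑ s, c s)⁻¹ ^ Fintype.card ι * ∑ z : ι → σ, (∏ i, c (z i)) * G fun i => pos (z i) := by
  set g := ∑ s, c s with hgdef
  let : MeasurableSpace σ := ⊤
  have hsum : ∑ s, ENNReal.ofReal (c s / g) = 1 := by
    rw [← ENNReal.ofReal_sum_of_nonneg fun s _ => div_nonneg (hc s) hg.le, ← Finset.sum_div,
      ← hgdef, div_self hg.ne', ENNReal.ofReal_one]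
  set p : PMF σ := PMF.ofFintype _ hsum
  have hp : ∀ s, p.toMeasure {s} = ENNReal.ofReal (c s / g) := fun s => by
    rw [p.toMeasure_apply_singleton s (measurableSet_singleton s), PMF.ofFintype_apply]
  have hpos : Measurable pos := measurable_from_top
  have : IsProbabilityMeasure (p.toMeasure.map pos) :=
    Measure.isProbabilityMeasure_map hpos.aemeasurable
  refine ⟨⟨p.toMeasure.map pos, inferInstance⟩, fun h => ?_, fun ι _ _ G => ?_⟩
  · change ∫ t, h t ∂(p.toMeasure.map pos) = _
    rw [integral_map hpos.aemeasurable h.continuous.aestronglyMeasurable,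
      integral_fintype Integrable.of_finite, Finset.mul_sum]
    refine Finset.sum_congr rfl fun s _ => ?_
    rw [Measure.real, hp, ENNReal.toReal_ofReal (div_nonneg (hc s) hg.le), smul_eq_mul]
    ring
  · change ∫ t, G t ∂(Measure.pi fun _ : ι => p.toMeasure.map pos) = _
    have hm : Measurable fun (z : ι → σ) i => pos (z i) :=
      measurable_pi_lambda _ fun i => hpos.comp (measurable_pi_apply i)
    rw [← Measure.pi_map_pi (μ := fun _ : ι => p.toMeasure) (f := fun _ => pos)
      fun _ => hpos.aemeasurable,
      integral_map hm.aemeasurable G.continuous.aestronglyMeasurable,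
      integral_fintype Integrable.of_finite, Finset.mul_sum]
    refine Finset.sum_congr rfl fun z _ => ?_
    rw [Measure.real, Measure.pi_singleton, ENNReal.toReal_prod, smul_eq_mul]
    simp only [hp, fun s => ENNReal.toReal_ofReal (div_nonneg (hc s) hg.le)]
    rw [Finset.prod_div_distrib, Finset.prod_const, Finset.card_univ, inv_pow]
    ring

lemma pi_const_smul {ι : Type*} [Fintype ι] (ν : Measure ℝ) [IsFiniteMeasure ν] (κ : NNReal) :
    Measure.pi (fun _ : ι => κ • ν) = κ ^ Fintype.card ι • Measure.pi fun _ : ι => ν := by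
  refine Measure.pi_eq fun s _ => ?_
  simp only [Measure.smul_apply, Measure.pi_pi, ENNReal.smul_def, smul_eq_mul,
    Finset.prod_mul_distrib, Finset.prod_const, Finset.card_univ, ENNReal.coe_pow]

/-- If discrete measures converge weakly on `ℝ`, their powers converge weakly on `ℝ^ι`. -/
theorem tendsto_sum_pi {ι : Type} [Fintype ι] [DecidableEq ι] {σ : ℕ → Type*}
    [∀ N, Fintype (σ N)] (c pos : ∀ N, σ N → ℝ) (hc : ∀ᶠ N in atTop, ∀ s, 0 ≤ c N s)
    (ν : Measure ℝ) [IsFiniteMeasure ν] (hν : ν ≠ 0)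
    (h1 : ∀ h : ℝ →ᵇ ℝ, Tendsto (fun N => ∑ s, c N s * h (pos N s)) atTop (𝓝 (∫ t, h t ∂ν)))
    (G : (ι → ℝ) →ᵇ ℝ) :
    Tendsto (fun N => ∑ z : ι → σ N, (∏ i, c N (z i)) * G fun i => pos N (z i)) atTop
      (𝓝 (∫ t, G t ∂(Measure.pi fun _ : ι => ν))) := by
  set κ : NNReal := (ν Set.univ).toNNReal with hκ
  have hκ0 : κ ≠ 0 := by
    rw [hκ, Ne, ENNReal.toNNReal_eq_zero_iff, not_or]
    exact ⟨fun h => hν (Measure.measure_univ_eq_zero.1 h), measure_ne_top _ _⟩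
  have hκr : (κ : ℝ) ≠ 0 := by exact_mod_cast hκ0
  have hprob : IsProbabilityMeasure (κ⁻¹ • ν) := ⟨by
    rw [Measure.smul_apply, ENNReal.smul_def, smul_eq_mul, ENNReal.coe_inv hκ0, hκ,
      ENNReal.coe_toNNReal (measure_ne_top _ _)]
    exact ENNReal.inv_mul_cancel (fun h => hν (Measure.measure_univ_eq_zero.1 h))
      (measure_ne_top _ _)⟩
  set ν' : ProbabilityMeasure ℝ := ⟨κ⁻¹ • ν, hprob⟩
  have hg : Tendsto (fun N => ∑ s, c N s) atTop (𝓝 (κ : ℝ)) := by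
    have := h1 (BoundedContinuousFunction.const ℝ 1)
    simp only [BoundedContinuousFunction.const_apply, mul_one, integral_const, smul_eq_mul] at this
    exact this
  have hpos : ∀ᶠ N in atTop, 0 < ∑ s, c N s := hg.eventually_const_lt (by positivity)
  have hex : ∀ N, ∃ μ : ProbabilityMeasure ℝ, (∀ s, 0 ≤ c N s) → 0 < ∑ s, c N s →
      (∀ h : ℝ →ᵇ ℝ, ∫ t, h t ∂(μ : Measure ℝ) = (∑ s, c N s)⁻¹ * ∑ s, c N s * h (pos N s)) ∧
      ∀ (ι : Type) [Fintype ι] [DecidableEq ι] (G : (ι → ℝ) →ᵇ ℝ),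
        ∫ t, G t ∂(Measure.pi fun _ : ι => (μ : Measure ℝ)) = (∑ s, c N s)⁻¹ ^ Fintype.card ι *
          ∑ z : ι → σ N, (∏ i, c N (z i)) * G fun i => pos N (z i) := fun N => by
    by_cases h : (∀ s, 0 ≤ c N s) ∧ 0 < ∑ s, c N s
    · obtain ⟨μ, hμ⟩ := exists_discrete_probabilityMeasure (c N) (pos N) h.1 h.2
      exact ⟨μ, fun _ _ => hμ⟩
    -- Dummy value for the finitely many N at which the masses cannot be normalised.
    · exact ⟨ν', fun h1 h2 => absurd ⟨h1, h2⟩ h⟩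
  choose μ hμ using hex
  have hw : Tendsto μ atTop (𝓝 ν') := by
    rw [ProbabilityMeasure.tendsto_iff_forall_integral_tendsto]
    intro h
    have h2 := (hg.inv₀ hκr).mul (h1 h)
    have e : ∫ t, h t ∂(ν' : Measure ℝ) = (κ : ℝ)⁻¹ * ∫ t, h t ∂ν := by
      change ∫ t, h t ∂(κ⁻¹ • ν) = _
      rw [integral_smul_nnreal_measure, NNReal.smul_def, smul_eq_mul, NNReal.coe_inv]
    rw [e]
    refine h2.congr' ?_
    filter_upwards [hc, hpos] with N h3 h4
    exact ((hμ N h3 h4).1 h).symm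
  -- Forming product measures is weakly continuous.
  have hpi := ((ProbabilityMeasure.continuous_pi (ι := ι) (α := fun _ => ℝ)).tendsto
    (fun _ => ν')).comp (tendsto_pi_nhds.2 fun _ : ι => hw)
  have hlim := (ProbabilityMeasure.tendsto_iff_forall_integral_tendsto.1 hpi) G
  have e : ∫ t, G t ∂(Measure.pi fun _ : ι => ν) =
      (κ : ℝ) ^ Fintype.card ι * ∫ t, G t ∂(Measure.pi fun _ : ι => (ν' : Measure ℝ)) := by
    have h5 : ν = κ • (ν' : Measure ℝ) := by
      change ν = κ • (κ⁻¹ • ν)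
      rw [smul_smul, mul_inv_cancel₀ hκ0, one_smul]
    conv_lhs => rw [h5]
    rw [pi_const_smul, integral_smul_nnreal_measure, NNReal.smul_def, smul_eq_mul, NNReal.coe_pow]
  rw [e]
  refine ((hg.pow (Fintype.card ι)).mul hlim).congr' ?_
  filter_upwards [hc, hpos] with N h3 h4
  simp only [Function.comp, ProbabilityMeasure.toMeasure_pi]
  rw [(hμ N h3 h4).2 ι G, ← mul_assoc, ← mul_pow, mul_inv_cancel₀ h4.ne', one_pow, one_mul]

/-! ### The measure `t^{-1/2} dt` on the unit interval and its powers -/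

/-- The measure `t^{-1/2} dt` on `[0, 1]`. -/
def sqrtMeasure : Measure ℝ :=
  (volume.restrict (Set.Icc 0 1)).withDensity fun t => ENNReal.ofReal (√t)⁻¹

lemma integrableOn_inv_sqrt : IntegrableOn (fun t : ℝ => (√t)⁻¹) (Set.Icc 0 1) := by
  rw [integrableOn_Icc_iff_integrableOn_Ioc]
  have h := ((integrableOn_exp_inv_sqrt 1 one_pos).mono_set
    (show Set.Ioc (0 : ℝ) 1 ⊆ Set.Ioi 0 from Set.Ioc_subset_Ioi_self)).const_mul (Real.exp 1)
  refine h.mono' (by fun_prop) ?_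
  filter_upwards [ae_restrict_mem measurableSet_Ioc] with t ht
  rw [Real.norm_of_nonneg (by positivity), ← mul_assoc, ← Real.exp_add]
  refine le_mul_of_one_le_left (by positivity) (Real.one_le_exp ?_)
  have := ht.2
  simp only [Nat.cast_one, one_mul]
  linarith

instance : IsFiniteMeasure sqrtMeasure :=
  isFiniteMeasure_withDensity_ofReal integrableOn_inv_sqrt.2

lemma sqrtMeasure_apply {s : Set ℝ} (hs : MeasurableSet s) :
    sqrtMeasure s = ENNReal.ofReal (∫ t in s, (√t)⁻¹ ∂(volume.restrict (Set.Icc 0 1))) := by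
  rw [sqrtMeasure, withDensity_apply _ hs, ofReal_integral_eq_lintegral_ofReal
    (Integrable.integrableOn integrableOn_inv_sqrt)]
  exact Eventually.of_forall fun t => by positivity

lemma Icc_zero_one_pi (ι : Type*) : (Set.Icc 0 1 : Set (ι → ℝ)) =
    Set.univ.pi fun _ => Set.Icc 0 1 := by
  rw [Set.pi_univ_Icc]
  rfl

lemma pi_sqrtMeasure (ι : Type*) [Fintype ι] : Measure.pi (fun _ : ι => sqrtMeasure) =
    (volume.restrict (Set.Icc 0 1)).withDensity
      fun x : ι → ℝ => ENNReal.ofReal (∏ i, (√(x i))⁻¹) := by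
  refine Measure.pi_eq fun s hs => ?_
  rw [withDensity_apply _ (MeasurableSet.univ_pi hs), Icc_zero_one_pi, volume_pi,
    Measure.restrict_pi_pi, Measure.restrict_pi_pi, ← ofReal_integral_eq_lintegral_ofReal,
    integral_fintype_prod_eq_prod (f := fun _ t => (√t)⁻¹), ENNReal.ofReal_prod_of_nonneg]
  · exact Finset.prod_congr rfl fun i _ => (sqrtMeasure_apply (hs i)).symm
  · exact fun i _ => integral_nonneg fun t => by positivity
  · exact Integrable.fintype_prod (f := fun _ t => (√t)⁻¹) fun i =>
      Integrable.integrableOn integrableOn_inv_sqrt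
  · exact Eventually.of_forall fun x => Finset.prod_nonneg fun i _ => by positivity

lemma integral_pi_sqrtMeasure {ι : Type*} [Fintype ι] (h : (ι → ℝ) → ℝ) :
    ∫ x, h x ∂(Measure.pi fun _ : ι => sqrtMeasure) =
      ∫ x in Set.Icc (0 : ι → ℝ) 1, h x * ∏ i, (√(x i))⁻¹ := by
  rw [pi_sqrtMeasure, integral_withDensity_eq_integral_toReal_smul (by fun_prop)
    (Eventually.of_forall fun _ => ENNReal.ofReal_lt_top)]
  refine integral_congr_ae (Eventually.of_forall fun x => ?_)
  simp only
  rw [ENNReal.toReal_ofReal (Finset.prod_nonneg fun i _ => by positivity), smul_eq_mul, mul_comm]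

lemma integral_sqrtMeasure (h : ℝ → ℝ) :
    ∫ t, h t ∂sqrtMeasure = ∫ t in Set.Icc (0 : ℝ) 1, h t * (√t)⁻¹ := by
  rw [sqrtMeasure, integral_withDensity_eq_integral_toReal_smul (by fun_prop)
    (Eventually.of_forall fun _ => ENNReal.ofReal_lt_top)]
  refine integral_congr_ae (Eventually.of_forall fun x => ?_)
  simp only
  rw [ENNReal.toReal_ofReal (by positivity), smul_eq_mul, mul_comm]

lemma sqrtMeasure_ne_zero : sqrtMeasure ≠ 0 := by
  intro h
  have h1 := sqrtMeasure_apply (MeasurableSet.univ)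
  rw [h, Measure.coe_zero, Pi.zero_apply, eq_comm, ENNReal.ofReal_eq_zero, Measure.restrict_univ]
    at h1
  have h2 : (1 : ℝ) ≤ ∫ t in Set.Icc (0 : ℝ) 1, (√t)⁻¹ := by
    have h3 : ∫ t in Set.Ioc (0 : ℝ) 1, (1 : ℝ) ≤ ∫ t in Set.Ioc (0 : ℝ) 1, (√t)⁻¹ := by
      refine setIntegral_mono_on (integrableOn_const (by simp))
        (integrableOn_inv_sqrt.mono_set Set.Ioc_subset_Icc_self) measurableSet_Ioc
        fun t ht => ?_
      rw [one_le_inv₀ (Real.sqrt_pos.2 ht.1)]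
      exact Real.sqrt_le_one.2 ht.2
    rw [integral_Icc_eq_integral_Ioc]
    simpa using h3
  linarith

/-! ### L_J as an integral over independent variables -/

/-- The coordinate projection of the cube: `x` with coordinates clamped to `[0, 1]`. -/
def clamp {ι : Type*} (x : ι → ℝ) : ι → ℝ := fun i => max 0 (min 1 (x i))

lemma clamp_mem {ι : Type*} (x : ι → ℝ) : clamp x ∈ Set.Icc (0 : ι → ℝ) 1 :=
  ⟨fun _ => le_max_left _ _, fun _ => max_le zero_le_one (min_le_left _ _)⟩

lemma clamp_eq {ι : Type*} {x : ι → ℝ} (hx : x ∈ Set.Icc (0 : ι → ℝ) 1) : clamp x = x :=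
  funext fun i => by rw [clamp, min_eq_right (show x i ≤ 1 from hx.2 i), max_eq_right (show 0 ≤ x i from hx.1 i)]

lemma continuous_clamp {ι : Type*} : Continuous (clamp : (ι → ℝ) → ι → ℝ) := by
  unfold clamp
  fun_prop

/-- The indices of the variables of the quadratic form `L_J`: those outside `J` occur once,
those in `J` twice. -/
abbrev Idx {k : ℕ} (J : Finset (Fin k)) : Type := {i // i ∉ J} ⊕ ({j // j ∈ J} ⊕ {j // j ∈ J})

/-- The coordinates of the first copy of `F` in `L_J`. -/
def idxFst {k : ℕ} (J : Finset (Fin k)) (i : Fin k) : Idx J :=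
  if h : i ∈ J then .inr (.inl ⟨i, h⟩) else .inl ⟨i, h⟩

/-- The coordinates of the second copy of `F` in `L_J`. -/
def idxSnd {k : ℕ} (J : Finset (Fin k)) (i : Fin k) : Idx J :=
  if h : i ∈ J then .inr (.inr ⟨i, h⟩) else .inl ⟨i, h⟩

lemma glue_fst {k : ℕ} (J : Finset (Fin k)) (z : Idx J → ℝ) :
    glue J (fun i => z (.inl i)) (fun j => z (.inr (.inl j))) = fun i => z (idxFst J i) := by
  funext i
  by_cases h : i ∈ J <;> simp [glue, idxFst, h]

lemma glue_snd {k : ℕ} (J : Finset (Fin k)) (z : Idx J → ℝ) :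
    glue J (fun i => z (.inl i)) (fun j => z (.inr (.inr j))) = fun i => z (idxSnd J i) := by
  funext i
  by_cases h : i ∈ J <;> simp [glue, idxSnd, h]

lemma continuous_glue {k : ℕ} (J : Finset (Fin k)) :
    Continuous fun p : ({i // i ∉ J} → ℝ) × ({j // j ∈ J} → ℝ) => glue J p.1 p.2 := by
  refine continuous_pi fun i => ?_
  by_cases h : i ∈ J <;> simp only [glue, h, dif_pos, dif_neg, not_false_iff] <;> fun_prop

/-- Fubini: the square of the inner integral is an integral over two independent copies of the
variables in `J`, while the outer variables are shared. -/
lemma integral_quadratic {k : ℕ} (J : Finset (Fin k)) {F : (Fin k → ℝ) → ℝ} (hF : Continuous F)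
    {M : ℝ} (hM : ∀ x, |F x| ≤ M) :
    ∫ z : Idx J → ℝ, F (fun i => z (idxFst J i)) * F (fun i => z (idxSnd J i))
        ∂(Measure.pi fun _ => sqrtMeasure) =
      ∫ x : {i // i ∉ J} → ℝ, (∫ y : {j // j ∈ J} → ℝ, F (glue J x y)
        ∂(Measure.pi fun _ => sqrtMeasure)) ^ 2 ∂(Measure.pi fun _ => sqrtMeasure) := by
  have h1 := measurePreserving_sumPiEquivProdPi (X := fun _ : Idx J => ℝ) fun _ => sqrtMeasure
  have h2 := measurePreserving_sumPiEquivProdPi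
    (X := fun _ : {j // j ∈ J} ⊕ {j // j ∈ J} => ℝ) fun _ => sqrtMeasure
  have e1 : ∫ z : Idx J → ℝ, F (fun i => z (idxFst J i)) * F (fun i => z (idxSnd J i))
        ∂(Measure.pi fun _ => sqrtMeasure) =
      ∫ q : ({i // i ∉ J} → ℝ) × ({j // j ∈ J} ⊕ {j // j ∈ J} → ℝ),
        F (glue J q.1 fun j => q.2 (.inl j)) * F (glue J q.1 fun j => q.2 (.inr j))
        ∂((Measure.pi fun _ => sqrtMeasure).prod (Measure.pi fun _ => sqrtMeasure)) := by
    rw [← h1.integral_comp']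
    refine integral_congr_ae (Eventually.of_forall fun z => ?_)
    simp only
    rw [← glue_fst, ← glue_snd]
    rfl
  have hb : ∀ {X : Type _} [MeasurableSpace X] [TopologicalSpace X] [OpensMeasurableSpace X]
      (μ : Measure X) [IsFiniteMeasure μ] (u : X → ℝ), Continuous u → (∀ x, |u x| ≤ M * M) →
      Integrable u μ := fun {X} _ _ _ μ _ u hu hle =>
    Integrable.of_bound hu.aestronglyMeasurable (M * M) (Eventually.of_forall hle)
  have hM0 : 0 ≤ M := (abs_nonneg _).trans (hM 0)
  rw [e1, integral_prod]
  · refine integral_congr_ae (Eventually.of_forall fun x => ?_)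
    simp only
    rw [sq, ← integral_prod_mul]
    rw [← h2.integral_comp']
    rfl
  · refine hb _ _ ?_ fun q => ?_
    · have c1 : Continuous fun q : ({i // i ∉ J} → ℝ) × ({j // j ∈ J} ⊕ {j // j ∈ J} → ℝ) =>
          glue J q.1 fun j => q.2 (.inl j) :=
        (continuous_glue J).comp (by fun_prop : Continuous fun q :
          ({i // i ∉ J} → ℝ) × ({j // j ∈ J} ⊕ {j // j ∈ J} → ℝ) => (q.1, fun j => q.2 (.inl j)))
      have c2 : Continuous fun q : ({i // i ∉ J} → ℝ) × ({j // j ∈ J} ⊕ {j // j ∈ J} → ℝ) =>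
          glue J q.1 fun j => q.2 (.inr j) :=
        (continuous_glue J).comp (by fun_prop : Continuous fun q :
          ({i // i ∉ J} → ℝ) × ({j // j ∈ J} ⊕ {j // j ∈ J} → ℝ) => (q.1, fun j => q.2 (.inr j)))
      exact (hF.comp c1).mul (hF.comp c2)
    · rw [abs_mul]
      exact mul_le_mul (hM _) (hM _) (abs_nonneg _) hM0

/-- Clamping does not change `F` on the cube and makes it continuous and bounded on the whole space,
as weak convergence requires. -/
lemma L_eq {k : ℕ} (J : Finset (Fin k)) (F : (Fin k → ℝ) → ℝ) :
    L J F = ∫ x : {i // i ∉ J} → ℝ, (∫ y : {j // j ∈ J} → ℝ, F (glue J (clamp x) (clamp y))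
        ∂(Measure.pi fun _ => sqrtMeasure)) ^ 2 ∂(Measure.pi fun _ => sqrtMeasure) := by
  rw [integral_pi_sqrtMeasure, L]
  refine setIntegral_congr_fun measurableSet_Icc fun x hx => ?_
  rw [integral_pi_sqrtMeasure, clamp_eq hx]
  congr 2
  refine setIntegral_congr_fun measurableSet_Icc fun y hy => ?_
  rw [clamp_eq hy]

lemma clamp_glue {k : ℕ} (J : Finset (Fin k)) (x : {i // i ∉ J} → ℝ) (y : {j // j ∈ J} → ℝ) :
    clamp (glue J x y) = glue J (clamp x) (clamp y) := by
  funext i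
  by_cases h : i ∈ J <;> simp [glue, clamp, h]

/-- Discrete measures converging to `t^{-1/2} dt`: convergence of the quadratic form `L_J`. -/
theorem tendsto_quadratic {k : ℕ} (J : Finset (Fin k)) {F : (Fin k → ℝ) → ℝ}
    (hF : ContinuousOn F (Set.Icc 0 1)) {σ : ℕ → Type*} [∀ N, Fintype (σ N)]
    (c pos : ∀ N, σ N → ℝ) (hc : ∀ᶠ N in atTop, ∀ s, 0 ≤ c N s)
    (h1 : ∀ h : ℝ →ᵇ ℝ, Tendsto (fun N => ∑ s, c N s * h (pos N s)) atTop
      (𝓝 (∫ t in Set.Icc (0 : ℝ) 1, h t * (√t)⁻¹))) :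
    Tendsto (fun N => ∑ z : Idx J → σ N, (∏ l, c N (z l)) *
      (F (clamp fun i => pos N (z (idxFst J i))) * F (clamp fun i => pos N (z (idxSnd J i)))))
      atTop (𝓝 (L J F)) := by
  obtain ⟨M, hM⟩ := isCompact_Icc.exists_bound_of_continuousOn hF
  have hFc : Continuous fun x => F (clamp x) := hF.comp_continuous continuous_clamp clamp_mem
  have hM' : ∀ x, |F (clamp x)| ≤ M := fun x => hM _ (clamp_mem x)
  have hM0 : 0 ≤ M := (abs_nonneg _).trans (hM' 0)
  have hG : Continuous fun z : Idx J → ℝ =>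
      F (clamp fun i => z (idxFst J i)) * F (clamp fun i => z (idxSnd J i)) :=
    (hFc.comp (by fun_prop : Continuous fun (z : Idx J → ℝ) i => z (idxFst J i))).mul
      (hFc.comp (by fun_prop : Continuous fun (z : Idx J → ℝ) i => z (idxSnd J i)))
  let G : (Idx J → ℝ) →ᵇ ℝ := BoundedContinuousFunction.ofNormedAddCommGroup _ hG (M * M)
    fun z => by
      rw [norm_mul]
      exact mul_le_mul (hM' _) (hM' _) (norm_nonneg _) hM0
  have h := tendsto_sum_pi c pos hc sqrtMeasure sqrtMeasure_ne_zero
    (fun h => by rw [integral_sqrtMeasure]; exact h1 h) G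
  have e : ∫ z, G z ∂(Measure.pi fun _ : Idx J => sqrtMeasure) = L J F := by
    rw [L_eq]
    refine (integral_quadratic J hFc hM').trans ?_
    simp only [clamp_glue]
  rw [e] at h
  exact h

end

/-! ### Squarefree numbers as finite sets of primes -/

/-- The product of a finite set of elements of `P`. -/
def num {P : Finset ℕ} (s : Finset P) : ℕ := ∏ p ∈ s, (p : ℕ)

section num

variable {P : Finset ℕ} (hP : ∀ p ∈ P, p.Prime)

include hP

lemma num_ne_zero (s : Finset P) : num s ≠ 0 :=
  Finset.prod_ne_zero_iff.2 fun p _ => (hP p p.2).ne_zero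

lemma prime_dvd_num {q : ℕ} (hq : q.Prime) (s : Finset P) :
    q ∣ num s ↔ ∃ h : q ∈ P, (⟨q, h⟩ : P) ∈ s := by
  rw [num, hq.prime.dvd_finsetProd_iff]
  constructor
  · rintro ⟨p, hp, hd⟩
    have := (Nat.prime_dvd_prime_iff_eq hq (hP p p.2)).1 hd
    subst this
    exact ⟨p.2, hp⟩
  · rintro ⟨h, hs⟩
    exact ⟨⟨q, h⟩, hs, dvd_rfl⟩

lemma coe_dvd_num (p : P) (s : Finset P) : (p : ℕ) ∣ num s ↔ p ∈ s := by
  rw [prime_dvd_num hP (hP p p.2)]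
  exact ⟨fun ⟨_, h⟩ => h, fun h => ⟨p.2, h⟩⟩

lemma coprime_num {s t : Finset P} : Nat.Coprime (num s) (num t) ↔ Disjoint s t := by
  rw [Finset.disjoint_left]
  constructor
  · intro h p hs ht
    exact (hP p p.2).one_lt.ne' (Nat.eq_one_of_dvd_coprimes h ((coe_dvd_num hP p s).2 hs)
      ((coe_dvd_num hP p t).2 ht))
  · intro h
    refine Nat.coprime_of_dvd fun q hq hs ht => ?_
    obtain ⟨h1, h2⟩ := (prime_dvd_num hP hq s).1 hs
    obtain ⟨_, h3⟩ := (prime_dvd_num hP hq t).1 ht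
    exact h h2 h3

lemma num_dvd_num {s t : Finset P} : num s ∣ num t ↔ s ⊆ t :=
  ⟨fun h p hp => (coe_dvd_num hP p t).1 (((coe_dvd_num hP p s).2 hp).trans h),
    fun h => Finset.prod_dvd_prod_of_subset _ _ _ h⟩

lemma num_injective : Function.Injective (num : Finset P → ℕ) := fun _ _ h =>
  Finset.Subset.antisymm ((num_dvd_num hP).1 h.dvd) ((num_dvd_num hP).1 h.symm.dvd)

lemma squarefree_num (s : Finset P) : Squarefree (num s) := by
  rw [num]
  refine Finset.squarefree_prod_of_pairwise_isCoprime ?_ fun p _ => (hP p p.2).prime.squarefree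
  intro p _ q _ h
  exact Nat.coprime_iff_isRelPrime.1 ((Nat.coprime_primes (hP p p.2) (hP q q.2)).2 fun e =>
    h (Subtype.ext e))

lemma squarefree_prod_num {k : ℕ} (a : Fin k → Finset P) :
    Squarefree (∏ i, num (a i)) ↔ ∀ i j, i ≠ j → Disjoint (a i) (a j) := by
  constructor
  · intro h i j hij
    rw [← coprime_num hP]
    have hd : num (a i) * num (a j) ∣ ∏ i, num (a i) := by
      rw [← Finset.prod_pair (f := fun i => num (a i)) hij]
      exact Finset.prod_dvd_prod_of_subset _ _ _ (Finset.subset_univ _)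
    exact Nat.coprime_of_squarefree_mul (h.squarefree_of_dvd hd)
  · intro h
    refine Finset.squarefree_prod_of_pairwise_isCoprime ?_ fun i _ => squarefree_num hP _
    intro i _ j _ hij
    exact Nat.coprime_iff_isRelPrime.1 ((coprime_num hP).2 (h i j hij))

lemma map_num {f : ArithmeticFunction ℝ} (hf : f.IsMultiplicative) (s : Finset P) :
    f (num s) = ∏ p ∈ s, f (p : ℕ) := by
  have h := hf.map_prod_of_prime (s.map (Function.Embedding.subtype _)) fun p hp => by
    obtain ⟨q, _, rfl⟩ := Finset.mem_map.1 hp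
    exact hP _ q.2
  simpa [num] using h

lemma totient_num (s : Finset P) : (Nat.totient (num s) : ℝ) = ∏ p ∈ s, (((p : ℕ) : ℝ) - 1) := by
  classical
  induction s using Finset.induction_on with
  | empty => simp [num]
  | insert p s hp ih =>
    have hc : Nat.Coprime (p : ℕ) (num s) :=
      ((hP p p.2).coprime_iff_not_dvd).2 fun h => hp ((coe_dvd_num hP p s).1 h)
    rw [show num (insert p s) = p * num s from Finset.prod_insert hp, Nat.totient_mul hc,
      Finset.prod_insert hp, Nat.cast_mul, ih, Nat.totient_prime (hP p p.2),
      Nat.cast_sub (hP p p.2).one_le, Nat.cast_one]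

lemma moebius_mul_num (s : Finset P) :
    (ArithmeticFunction.moebius (num s) : ℝ) * (num s : ℝ) = ∏ p ∈ s, (-((p : ℕ) : ℝ)) := by
  have h : (ArithmeticFunction.moebius (num s) : ℝ) = ∏ p ∈ s, (-1 : ℝ) := by
    have := ArithmeticFunction.isMultiplicative_moebius.map_prod_of_prime
      (s.map (Function.Embedding.subtype _)) fun p hp => by
        obtain ⟨q, _, rfl⟩ := Finset.mem_map.1 hp
        exact hP _ q.2
    rw [Finset.prod_map, Finset.prod_map] at this
    rw [num]
    have h2 : ∀ p ∈ s, ArithmeticFunction.moebius (p : ℕ) = -1 := fun p _ =>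
      ArithmeticFunction.moebius_apply_prime (hP p p.2)
    rw [show (∏ p ∈ s, (p : ℕ)) = ∏ x ∈ s, (Function.Embedding.subtype (· ∈ P)) x from rfl, this]
    push_cast
    refine Finset.prod_congr rfl fun p hp => ?_
    exact_mod_cast h2 p hp
  rw [h, num, Nat.cast_prod, ← Finset.prod_mul_distrib]
  exact Finset.prod_congr rfl fun p _ => by ring

lemma lcm_num [DecidableEq P] (s t : Finset P) : Nat.lcm (num s) (num t) = num (s ∪ t) := by
  refine Nat.dvd_antisymm (Nat.lcm_dvd ((num_dvd_num hP).2 Finset.subset_union_left)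
    ((num_dvd_num hP).2 Finset.subset_union_right)) ?_
  refine Finset.prod_dvd_of_isRelPrime ?_ fun p hp => ?_
  · intro p _ q _ h
    exact Nat.coprime_iff_isRelPrime.1 ((Nat.coprime_primes (hP p p.2) (hP q q.2)).2 fun e =>
      h (Subtype.ext e))
  · rcases Finset.mem_union.1 hp with h | h
    · exact ((coe_dvd_num hP p s).2 h).trans (Nat.dvd_lcm_left _ _)
    · exact ((coe_dvd_num hP p t).2 h).trans (Nat.dvd_lcm_right _ _)

end num

lemma exists_num {P : Finset ℕ} {n : ℕ} (hn : Squarefree n)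
    (h : ∀ q : ℕ, q.Prime → q ∣ n → q ∈ P) : ∃ s : Finset P, num s = n := by
  have hsub : ∀ q ∈ n.primeFactors, q ∈ P := fun q hq =>
    h q (Nat.prime_of_mem_primeFactors hq) (Nat.dvd_of_mem_primeFactors hq)
  refine ⟨n.primeFactors.subtype (· ∈ P), ?_⟩
  rw [num, Finset.prod_subtype_of_mem (f := fun p : ℕ => p) hsub,
    Nat.prod_primeFactors_of_squarefree hn]

/-! ### Sieve weights in terms of sets of primes -/

/-- The primes `D₀ < p ≤ R` with `p ≡ 3 (mod 4)`. -/
def sievePrimes (θ : ℝ) (N : ℕ) : Finset ℕ :=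
  (Finset.Icc 1 ⌊R θ N⌋₊).filter fun p => p.Prime ∧ p % 4 = 3 ∧ ⌊D0 N⌋₊ < p

lemma sievePrimes_prime {θ : ℝ} {N : ℕ} : ∀ p ∈ sievePrimes θ N, p.Prime :=
  fun _ hp => (Finset.mem_filter.1 hp).2.1

/-- `W` omits 2 and contains the other primes up to D₀. As 2 is not ≡ 3 mod 4, the omission is
harmless. -/
lemma coprime_W_iff {N n : ℕ} (hn : OnlyPrimes3Mod4 n) :
    Nat.Coprime n (W N) ↔ ∀ q : ℕ, q.Prime → q ∣ n → ⌊D0 N⌋₊ < q := by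
  constructor
  · intro h q hq hd
    by_contra hlt
    have h3 := hn q hq hd
    have h2 : 2 < q := by
      have := hq.two_le
      omega
    have : q ∣ W N := Finset.dvd_prod_of_mem (fun p => p) (Finset.mem_filter.2
      ⟨Finset.mem_range.2 (by omega), hq, h2⟩)
    exact hq.one_lt.ne' (Nat.eq_one_of_dvd_coprimes h hd this)
  · intro h
    refine Nat.coprime_of_dvd fun q hq hd hw => ?_
    obtain ⟨p, hp, hqp⟩ := (hq.prime.dvd_finsetProd_iff _).1 hw
    have hp := Finset.mem_filter.1 hp
    have e := (Nat.prime_dvd_prime_iff_eq hq hp.2.1).1 hqp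
    have h1 := h q hq hd
    have h2 := Finset.mem_range.1 hp.1
    omega

lemma onlyPrimes_num {θ : ℝ} {N : ℕ} (s : Finset (sievePrimes θ N)) : OnlyPrimes3Mod4 (num s) :=
  fun _ hq hd => by
    obtain ⟨h, _⟩ := (prime_dvd_num sievePrimes_prime hq s).1 hd
    exact (Finset.mem_filter.1 h).2.2.1

lemma coprime_W_num {θ : ℝ} {N : ℕ} (s : Finset (sievePrimes θ N)) :
    Nat.Coprime (num s) (W N) :=
  (coprime_W_iff (onlyPrimes_num s)).2 fun _ hq hd => by
    obtain ⟨h, _⟩ := (prime_dvd_num sievePrimes_prime hq s).1 hd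
    exact (Finset.mem_filter.1 h).2.2.2

/-- The position `log n / log R` of a squarefree number `n`. -/
def pos (θ : ℝ) (N : ℕ) (s : Finset (sievePrimes θ N)) : ℝ :=
  Real.log (num s) / Real.log (R θ N)

/-- `n ≤ R` is squarefree with all prime factors in `sievePrimes`. -/
def Admissible (θ : ℝ) (N n : ℕ) : Prop :=
  Squarefree n ∧ (n : ℝ) ≤ R θ N ∧ OnlyPrimes3Mod4 n ∧ Nat.Coprime n (W N)

lemma mem_sievePrimes_of_admissible {θ : ℝ} {N n q : ℕ} (hn : Admissible θ N n) (hq : q.Prime)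
    (hd : q ∣ n) : q ∈ sievePrimes θ N := by
  refine Finset.mem_filter.2 ⟨Finset.mem_Icc.2 ⟨hq.one_le, Nat.le_floor ?_⟩, hq,
    hn.2.2.1 q hq hd, (coprime_W_iff hn.2.2.1).1 hn.2.2.2 q hq hd⟩
  have : q ≤ n := Nat.le_of_dvd (Nat.pos_of_ne_zero hn.1.ne_zero) hd
  exact le_trans (by exact_mod_cast this) hn.2.1

lemma sum_box_eq {k : ℕ} {θ : ℝ} {N : ℕ} (φ : (Fin k → ℕ) → ℝ)
    (hφ : ∀ d, φ d ≠ 0 → ∀ i, Admissible θ N (d i)) :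
    ∑ d ∈ box k θ N, φ d = ∑ c : Fin k → Finset (sievePrimes θ N), φ fun i => num (c i) := by
  classical
  rw [← Finset.sum_filter_ne_zero (s := Finset.univ)]
  symm
  refine Finset.sum_of_injOn (fun c i => num (c i)) ?_ ?_ ?_ fun _ _ => rfl
  · intro c _ c' _ h
    funext i
    exact num_injective sievePrimes_prime (congrFun h i)
  · intro c hc
    have hc := hφ _ (Finset.mem_filter.1 hc).2
    simp only [box, Finset.mem_coe, Fintype.mem_piFinset, Finset.mem_Icc]
    exact fun i => ⟨Nat.pos_of_ne_zero (hc i).1.ne_zero, Nat.le_floor (hc i).2.1⟩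
  · intro d _ hd
    by_contra h0
    have h := hφ d h0
    choose c hc using fun i => exists_num (P := sievePrimes θ N) (h i).1
      fun q hq hd => mem_sievePrimes_of_admissible (h i) hq hd
    have e : (fun i => num (c i)) = d := funext hc
    exact hd ⟨c, by simp [e, h0], e⟩

lemma admissible_of_dvd {θ : ℝ} {N n m : ℕ} (hn : Admissible θ N n) (h : m ∣ n) :
    Admissible θ N m :=
  ⟨hn.1.squarefree_of_dvd h, le_trans (Nat.cast_le.2 (Nat.le_of_dvd
    (Nat.pos_of_ne_zero hn.1.ne_zero) h)) hn.2.1, fun q hq hd => hn.2.2.1 q hq (hd.trans h),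
    hn.2.2.2.coprime_dvd_left h⟩

open Classical in
lemma admissible_of_lam_ne_zero {k : ℕ} {θ : ℝ} {N : ℕ} {F : (Fin k → ℝ) → ℝ} {d : Fin k → ℕ}
    (h : lam θ N F d ≠ 0) (i : Fin k) : Admissible θ N (d i) := by
  rw [lam] at h
  have h1 := (ite_ne_right_iff.1 h).1
  exact admissible_of_dvd ⟨h1.2.1, h1.1, h1.2.2.2, h1.2.2.1⟩
    (Finset.dvd_prod_of_mem d (Finset.mem_univ i))

lemma prod_num_le_R {k : ℕ} {θ : ℝ} {N : ℕ} (hR : 0 < Real.log (R θ N))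
    {a : Fin k → Finset (sievePrimes θ N)} (h : ∑ i, pos θ N (a i) ≤ 1) :
    ((∏ i, num (a i) : ℕ) : ℝ) ≤ R θ N := by
  have hR1 : 0 < R θ N := Real.rpow_nonneg (Nat.cast_nonneg _) _ |>.lt_of_ne fun h => by
    rw [R, ← h, Real.log_zero] at hR
    exact lt_irrefl _ hR
  have hne : ∀ i, (num (a i) : ℝ) ≠ 0 := fun i =>
    Nat.cast_ne_zero.2 (num_ne_zero sievePrimes_prime _)
  simp only [pos] at h
  rw [← Finset.sum_div, div_le_one hR, ← Real.log_prod fun i _ => hne i] at h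
  rw [Nat.cast_prod]
  exact (Real.log_le_log_iff (Finset.prod_pos fun i _ => (Nat.cast_nonneg _).lt_of_ne (hne i).symm)
    hR1).1 h

/-- The condition under which the tuples `d = num ∘ c`, `r = num ∘ a` contribute to `lam`. -/
def Nested {k : ℕ} {P : Finset ℕ} (a c : Fin k → Finset P) : Prop :=
  (∀ i j, i ≠ j → Disjoint (a i) (a j)) ∧ ∀ i, c i ⊆ a i

-- The conditions on d in the definition of `lam` follow from those on r: d_i divides r_i, and the
-- support of `F` already gives ∏ r_i ≤ R. Only disjointness and inclusion of sets of primes remain.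
open Classical in
lemma lam_num {k : ℕ} {θ : ℝ} {N : ℕ} (hR : 0 < Real.log (R θ N)) {F : (Fin k → ℝ) → ℝ}
    (hF : ∀ x, x ∉ simplex k → F x = 0) (c : Fin k → Finset (sievePrimes θ N)) :
    lam θ N F (fun i => num (c i)) = ∑ a : Fin k → Finset (sievePrimes θ N),
      if Nested a c then
        (∏ i, ∏ p ∈ c i, (-((p : ℕ) : ℝ))) * (∏ i, ∏ p ∈ a i, 1 / (((p : ℕ) : ℝ) - 1)) *
          F (fun i => pos θ N (a i))
      else 0 := by
  have hsimplex : ∀ a : Fin k → Finset (sievePrimes θ N), F (fun i => pos θ N (a i)) ≠ 0 →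
      ((∏ i, num (a i) : ℕ) : ℝ) ≤ R θ N := fun a ha => by
    by_contra h
    exact ha (hF _ fun hs => h (prod_num_le_R hR hs.2))
  by_cases hcond : ((∏ i, num (c i) : ℕ) : ℝ) ≤ R θ N ∧ Squarefree (∏ i, num (c i)) ∧
      Nat.Coprime (∏ i, num (c i)) (W N) ∧ OnlyPrimes3Mod4 (∏ i, num (c i))
  · rw [lam, if_pos hcond, Finset.sum_filter, sum_box_eq]
    · rw [Finset.mul_sum]
      refine Finset.sum_congr rfl fun a _ => ?_
      have hiff : (∀ i, num (c i) ∣ num (a i) ∧ Nat.Coprime (num (a i)) (W N) ∧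
          OnlyPrimes3Mod4 (num (a i))) ↔ ∀ i, c i ⊆ a i :=
        forall_congr' fun i => ⟨fun h => (num_dvd_num sievePrimes_prime).1 h.1, fun h =>
          ⟨(num_dvd_num sievePrimes_prime).2 h, coprime_W_num _, onlyPrimes_num _⟩⟩
      have hmu : (ArithmeticFunction.moebius (∏ i, num (a i)) : ℝ) ^ 2 =
          if ∀ i j, i ≠ j → Disjoint (a i) (a j) then 1 else 0 := by
        rw [← Int.cast_pow, ← Int.cast_one, ← Int.cast_zero, ← apply_ite Int.cast,
          ArithmeticFunction.moebius_sq]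
        congr 1
        simp only [squarefree_prod_num sievePrimes_prime]
      rw [if_congr hiff rfl rfl, hmu]
      by_cases h1 : ∀ i j, i ≠ j → Disjoint (a i) (a j)
      · by_cases h2 : ∀ i, c i ⊆ a i
        · rw [if_pos h2, if_pos h1, if_pos (show Nested a c from ⟨h1, h2⟩)]
          simp only [moebius_mul_num sievePrimes_prime, totient_num sievePrimes_prime, pos,
            one_div, Finset.prod_inv_distrib]
          ring
        · rw [if_neg h2, if_neg fun h : Nested a c => h2 h.2, mul_zero]
      · rw [if_neg h1, if_neg fun h : Nested a c => h1 h.1]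
        simp
    · intro r hr i
      have h1 := ite_ne_right_iff.1 hr
      have hmu : Squarefree (∏ i, r i) := by
        by_contra hs
        apply h1.2
        rw [ArithmeticFunction.moebius_eq_zero_of_not_squarefree hs]
        simp
      have hi : Squarefree (r i) :=
        hmu.squarefree_of_dvd (Finset.dvd_prod_of_mem r (Finset.mem_univ i))
      refine ⟨hi, ?_, (h1.1 i).2.2, (h1.1 i).2.1⟩
      by_contra hgt
      apply h1.2
      rw [hF _ ?_, mul_zero]
      intro hs
      have h3 := hs.1.2 i
      simp only [Pi.one_apply] at h3
      rw [div_le_one hR] at h3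
      have hR1 : 0 < R θ N := Real.rpow_nonneg (Nat.cast_nonneg _) _ |>.lt_of_ne fun h => by
        rw [R, ← h, Real.log_zero] at hR
        exact lt_irrefl _ hR
      exact hgt ((Real.log_le_log_iff (by exact_mod_cast Nat.pos_of_ne_zero hi.ne_zero) hR1).1 h3)
  -- If d violates a condition then no term survives: a nonzero one would make ∏ d_i a divisor of an
  -- admissible number.
  · rw [lam, if_neg hcond]
    symm
    refine Finset.sum_eq_zero fun a _ => ?_
    split_ifs with h
    · by_contra h0
      have h1 := hsimplex a (right_ne_zero_of_mul h0)
      have hd : ∏ i, num (c i) ∣ ∏ i, num (a i) :=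
        Finset.prod_dvd_prod_of_dvd _ _ fun i _ => (num_dvd_num sievePrimes_prime).2 (h.2 i)
      have hadm : Admissible θ N (∏ i, num (a i)) := by
        refine ⟨(squarefree_prod_num sievePrimes_prime a).2 h.1, h1, fun q hq hd => ?_,
          Nat.Coprime.prod_left fun i _ => coprime_W_num _⟩
        obtain ⟨i, _, hi⟩ := (hq.prime.dvd_finsetProd_iff _).1 hd
        exact onlyPrimes_num _ q hq hi
      have := admissible_of_dvd hadm hd
      exact hcond ⟨this.2.1, this.1, this.2.2.2, this.2.2.1⟩
    · rfl

/-! ### Factorisation of the sieve sum over primes -/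

section slice

variable {k : ℕ} {P : Finset ℕ}

/-- The coordinates of a tuple that contain `p`. -/
def slice (a : Fin k → Finset P) (p : P) : Finset (Fin k) := Finset.univ.filter fun i => p ∈ a i

lemma mem_slice {a : Fin k → Finset P} {p : P} {i : Fin k} : i ∈ slice a p ↔ p ∈ a i := by
  simp [slice]

/-- Tuples of sets of primes correspond to families of sets of coordinates. -/
def sliceEquiv : (Fin k → Finset P) ≃ (P → Finset (Fin k)) where
  toFun := slice
  invFun b i := Finset.univ.filter fun p => i ∈ b p
  left_inv a := by
    ext i p
    simp [mem_slice]
  right_inv b := by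
    ext p i
    simp [mem_slice]

lemma prod_slice {M : Type*} [CommMonoid M] (c : Fin k → Finset P) (u : Fin k → P → M) :
    ∏ i, ∏ p ∈ c i, u i p = ∏ p, ∏ i ∈ slice c p, u i p :=
  Finset.prod_comm' fun i p => by simp [mem_slice]

lemma slice_union (c e : Fin k → Finset P) (p : P) :
    slice c p ∪ slice e p = slice (fun i => c i ∪ e i) p := by
  ext i
  simp [mem_slice]

lemma slice_subset_iff (c a : Fin k → Finset P) :
    (∀ p, slice c p ⊆ slice a p) ↔ ∀ i, c i ⊆ a i :=
  ⟨fun h _ p hp => mem_slice.1 (h p (mem_slice.2 hp)),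
    fun h _ i hi => mem_slice.2 (h i (mem_slice.1 hi))⟩

lemma card_slice_le_one_iff (a : Fin k → Finset P) :
    (∀ p, (slice a p).card ≤ 1) ↔ ∀ i j, i ≠ j → Disjoint (a i) (a j) := by
  simp only [Finset.card_le_one, mem_slice, Finset.disjoint_left]
  exact ⟨fun h i j hij p hi hj => hij (h p i hi j hj),
    fun h p i hi j hj => by_contra fun hij => h i j hij hi hj⟩

/-- The Euler product step: choosing two sets of coordinates at every prime is the same as choosing
two tuples of sets of primes. -/
lemma prod_sum_sum_slice (u : P → Finset (Fin k) → Finset (Fin k) → ℝ) :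
    ∏ p, ∑ C, ∑ E, u p C E = ∑ c : Fin k → Finset P, ∑ e : Fin k → Finset P,
      ∏ p, u p (slice c p) (slice e p) := by
  rw [Fintype.prod_sum, ← Equiv.sum_comp (sliceEquiv (k := k) (P := P))]
  refine Finset.sum_congr rfl fun c _ => ?_
  rw [Fintype.prod_sum, ← Equiv.sum_comp (sliceEquiv (k := k) (P := P))]
  rfl

end slice

/-- The weight `f` or `g` of the coordinate `i`. -/
def coordWeight {k : ℕ} (J : Finset (Fin k)) (f g : ArithmeticFunction ℝ) (i : Fin k) :
    ArithmeticFunction ℝ := if i ∈ J then g else f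

lemma coordWeight_mult {k : ℕ} {J : Finset (Fin k)} {K : ℝ} {f g : ArithmeticFunction ℝ}
    (h : IsWeightPair K J f g) (i : Fin k) : (coordWeight J f g i).IsMultiplicative := by
  rw [coordWeight]
  split_ifs with hi
  · exact h.mult_g ⟨i, hi⟩
  · exact h.mult_f

open Classical in
/-- The local factor of the sieve sum at a prime `q` dividing the entries of `r`, `s`, `d`, `e` in
the sets of coordinates `A`, `B`, `C`, `E`. -/
def localTerm {k : ℕ} (h : Fin k → ℝ) (q : ℝ) (V : Finset (Fin k) → Finset (Fin k) → Prop)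
    (A B C E : Finset (Fin k)) : ℝ :=
  if A.card ≤ 1 ∧ B.card ≤ 1 ∧ C ⊆ A ∧ E ⊆ B ∧ (C ∪ E).card ≤ 1 ∧ V C E then
    (-q) ^ C.card * (-q) ^ E.card * (∏ i ∈ C ∪ E, h i) *
      ((1 / (q - 1)) ^ A.card * (1 / (q - 1)) ^ B.card)
  else 0

/-- The local factor at `q` of the quadratic form in the values of `F`. -/
def localWeight {k : ℕ} (h : Fin k → ℝ) (q : ℝ) (V : Finset (Fin k) → Finset (Fin k) → Prop)
    (A B : Finset (Fin k)) : ℝ :=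
  ∑ C, ∑ E, localTerm h q V A B C E

/-- The divisibility conditions `p₁ ∣ d_m`, `p₂ ∣ e_m` at the prime `q`. -/
def DivCond {k : ℕ} (p₁ p₂ : ℕ) (m : Fin k) (q : ℕ) (C E : Finset (Fin k)) : Prop :=
  (q = p₁ → m ∈ C) ∧ (q = p₂ → m ∈ E)

/-- Pairwise coprimality says that no prime meets two coordinates; coprimality to `W` is automatic
for products of sieve primes. -/
lemma coprimeLcms_num_iff {k : ℕ} {θ : ℝ} {N : ℕ} (c e : Fin k → Finset (sievePrimes θ N)) :
    CoprimeLcms N (fun i => num (c i)) (fun i => num (e i)) ↔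
      ∀ p, (slice c p ∪ slice e p).card ≤ 1 := by
  simp only [slice_union, card_slice_le_one_iff, CoprimeLcms, lcm_num sievePrimes_prime,
    coprime_num sievePrimes_prime]
  exact and_iff_right fun i => (coprime_W_num _).symm

lemma dvd_num_iff {k : ℕ} {θ : ℝ} {N p₁ : ℕ} (h1 : p₁ = 1 ∨ p₁ ∈ sievePrimes θ N) (m : Fin k)
    (c : Fin k → Finset (sievePrimes θ N)) :
    p₁ ∣ num (c m) ↔ ∀ p : sievePrimes θ N, (p : ℕ) = p₁ → m ∈ slice c p := by
  rcases h1 with rfl | h1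
  · refine iff_of_true (one_dvd _) fun p hp => ?_
    exact absurd hp (sievePrimes_prime p p.2).one_lt.ne'
  · simp only [mem_slice]
    constructor
    · rintro h p rfl
      exact (coe_dvd_num sievePrimes_prime p _).1 h
    · intro h
      exact (coe_dvd_num sievePrimes_prime ⟨p₁, h1⟩ _).2 (h ⟨p₁, h1⟩ rfl)

/-- Nestedness, coprimality of the lcms and divisibility by p₁, p₂ all hold if and only if they hold
at each prime, and all weights are multiplicative over disjoint sets of primes. -/
lemma prod_localTerm {k : ℕ} {θ : ℝ} {N : ℕ} {J : Finset (Fin k)} {K : ℝ}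
    {f g : ArithmeticFunction ℝ} (hfg : IsWeightPair K J f g) {p₁ p₂ : ℕ}
    (h1 : p₁ = 1 ∨ p₁ ∈ sievePrimes θ N) (h2 : p₂ = 1 ∨ p₂ ∈ sievePrimes θ N) (m : Fin k)
    (a b c e : Fin k → Finset (sievePrimes θ N)) [Decidable (Nested a c)] [Decidable (Nested b e)]
    [Decidable (CoprimeLcms N (fun i => num (c i)) (fun i => num (e i)) ∧ p₁ ∣ num (c m) ∧
      p₂ ∣ num (e m))] (Fa Fb : ℝ) :
    (if CoprimeLcms N (fun i => num (c i)) (fun i => num (e i)) ∧ p₁ ∣ num (c m) ∧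
      p₂ ∣ num (e m) then
      (if Nested a c then (∏ i, ∏ p ∈ c i, (-((p : ℕ) : ℝ))) *
        (∏ i, ∏ p ∈ a i, 1 / (((p : ℕ) : ℝ) - 1)) * Fa else 0) *
      (if Nested b e then (∏ i, ∏ p ∈ e i, (-((p : ℕ) : ℝ))) *
        (∏ i, ∏ p ∈ b i, 1 / (((p : ℕ) : ℝ) - 1)) * Fb else 0) *
      ((∏ i ∈ Jᶜ, f (Nat.lcm (num (c i)) (num (e i)))) *
        ∏ j ∈ J, g (Nat.lcm (num (c j)) (num (e j))))
    else 0) = Fa * Fb * ∏ p : sievePrimes θ N, localTerm (fun i => coordWeight J f g i p) p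
      (DivCond p₁ p₂ m p) (slice a p) (slice b p) (slice c p) (slice e p) := by
  classical
  have hiff : (∀ p ∈ (Finset.univ : Finset (sievePrimes θ N)), (slice a p).card ≤ 1 ∧
      (slice b p).card ≤ 1 ∧ slice c p ⊆ slice a p ∧ slice e p ⊆ slice b p ∧
      (slice c p ∪ slice e p).card ≤ 1 ∧ DivCond p₁ p₂ m p (slice c p) (slice e p)) ↔
      (CoprimeLcms N (fun i => num (c i)) (fun i => num (e i)) ∧ p₁ ∣ num (c m) ∧
        p₂ ∣ num (e m)) ∧ Nested a c ∧ Nested b e := by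
    simp only [Finset.mem_univ, true_implies, forall_and, DivCond, card_slice_le_one_iff,
      slice_subset_iff, ← coprimeLcms_num_iff, ← dvd_num_iff h1 m c, ← dvd_num_iff h2 m e, Nested]
    tauto
  have hprod : (∏ i ∈ Jᶜ, f (Nat.lcm (num (c i)) (num (e i)))) *
      (∏ j ∈ J, g (Nat.lcm (num (c j)) (num (e j)))) =
      ∏ p : sievePrimes θ N, ∏ i ∈ slice c p ∪ slice e p, coordWeight J f g i p := by
    have e1 : ∏ i ∈ Jᶜ, f (Nat.lcm (num (c i)) (num (e i))) =
        ∏ i ∈ Jᶜ, coordWeight J f g i (Nat.lcm (num (c i)) (num (e i))) :=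
      Finset.prod_congr rfl fun i hi => by rw [coordWeight, if_neg (Finset.mem_compl.1 hi)]
    have e2 : ∏ j ∈ J, g (Nat.lcm (num (c j)) (num (e j))) =
        ∏ j ∈ J, coordWeight J f g j (Nat.lcm (num (c j)) (num (e j))) :=
      Finset.prod_congr rfl fun i hi => by rw [coordWeight, if_pos hi]
    rw [e1, e2, mul_comm, Finset.prod_mul_prod_compl]
    simp only [slice_union]
    rw [← prod_slice]
    exact Finset.prod_congr rfl fun i _ => by
      rw [lcm_num sievePrimes_prime, map_num sievePrimes_prime (coordWeight_mult hfg i)]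
  have hpow : ∀ (c : Fin k → Finset (sievePrimes θ N)) (u : ℕ → ℝ),
      ∏ i, ∏ p ∈ c i, u p = ∏ p : sievePrimes θ N, u p ^ (slice c p).card := fun c u => by
    rw [prod_slice (u := fun _ p => u p)]
    simp only [Finset.prod_const]
  simp only [localTerm]
  rw [Finset.prod_ite_zero]
  by_cases hc : (CoprimeLcms N (fun i => num (c i)) (fun i => num (e i)) ∧ p₁ ∣ num (c m) ∧
        p₂ ∣ num (e m)) ∧ Nested a c ∧ Nested b e
  · rw [if_pos (hiff.2 hc), if_pos hc.1, if_pos hc.2.1, if_pos hc.2.2, hprod,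
      hpow c fun p => -(p : ℝ), hpow e fun p => -(p : ℝ), hpow a fun p => 1 / ((p : ℝ) - 1),
      hpow b fun p => 1 / ((p : ℝ) - 1)]
    simp only [Finset.prod_mul_distrib]
    ring
  · rw [if_neg (mt hiff.1 hc), mul_zero]
    split_ifs with h3 h4 h5
    · exact absurd ⟨h3, h4, h5⟩ hc
    all_goals simp

/-- The sieve sum is a quadratic form in the values of `F` whose coefficients factor over the
primes. -/
theorem S_eq_sum_prod {k : ℕ} {θ : ℝ} {N : ℕ} (hR : 0 < Real.log (R θ N))
    {J : Finset (Fin k)} {K : ℝ} {f g : ArithmeticFunction ℝ} (hfg : IsWeightPair K J f g)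
    {F : (Fin k → ℝ) → ℝ} (hF : ∀ x, x ∉ simplex k → F x = 0) {p₁ p₂ : ℕ}
    (h1 : p₁ = 1 ∨ p₁ ∈ sievePrimes θ N) (h2 : p₂ = 1 ∨ p₂ ∈ sievePrimes θ N) (m : Fin k) :
    S θ N F f g J p₁ p₂ m = ∑ a : Fin k → Finset (sievePrimes θ N),
      ∑ b : Fin k → Finset (sievePrimes θ N),
        F (fun i => pos θ N (a i)) * F (fun i => pos θ N (b i)) *
        ∏ p : sievePrimes θ N, localWeight (fun i => coordWeight J f g i p) p
          (DivCond p₁ p₂ m p) (slice a p) (slice b p) := by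
  classical
  rw [S, sum_box_eq]
  · have step : ∀ c : Fin k → Finset (sievePrimes θ N),
        (∑ e ∈ box k θ N, if CoprimeLcms N (fun i => num (c i)) e ∧ p₁ ∣ num (c m) ∧ p₂ ∣ e m then
          lam θ N F (fun i => num (c i)) * lam θ N F e *
            ((∏ i ∈ Jᶜ, f (Nat.lcm (num (c i)) (e i))) * ∏ j ∈ J, g (Nat.lcm (num (c j)) (e j)))
          else 0) =
        ∑ e : Fin k → Finset (sievePrimes θ N), ∑ a : Fin k → Finset (sievePrimes θ N),
          ∑ b : Fin k → Finset (sievePrimes θ N),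
          F (fun i => pos θ N (a i)) * F (fun i => pos θ N (b i)) *
          ∏ p : sievePrimes θ N, localTerm (fun i => coordWeight J f g i p) p
            (DivCond p₁ p₂ m p) (slice a p) (slice b p) (slice c p) (slice e p) := by
      intro c
      rw [sum_box_eq]
      · refine Finset.sum_congr rfl fun e _ => ?_
        rw [lam_num hR hF, lam_num hR hF]
        simp only [← prod_localTerm hfg h1 h2 m]
        by_cases hc : CoprimeLcms N (fun i => num (c i)) (fun i => num (e i)) ∧
            p₁ ∣ num (c m) ∧ p₂ ∣ num (e m)
        · simp only [if_pos hc]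
          rw [Finset.sum_mul_sum, Finset.sum_mul]
          exact Finset.sum_congr rfl fun a _ => Finset.sum_mul _ _ _
        · simp only [if_neg hc, Finset.sum_const_zero]
      · intro e he i
        have h := (ite_ne_right_iff.1 he).2
        exact admissible_of_lam_ne_zero (right_ne_zero_of_mul (left_ne_zero_of_mul h)) i
    rw [Finset.sum_congr rfl fun c _ => step c]
    -- With r and s fixed, the sums over d and e factor into the local sums defining `localWeight`.
    simp only [localWeight, prod_sum_sum_slice, Finset.mul_sum]
    rw [Finset.sum_congr rfl fun c _ => Finset.sum_comm, Finset.sum_comm]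
    refine Finset.sum_congr rfl fun a _ => ?_
    rw [Finset.sum_congr rfl fun c _ => Finset.sum_comm, Finset.sum_comm]
  · intro d hd i
    obtain ⟨e, _, he⟩ := Finset.exists_ne_zero_of_sum_ne_zero hd
    have h := (ite_ne_right_iff.1 he).2
    exact admissible_of_lam_ne_zero (left_ne_zero_of_mul (left_ne_zero_of_mul h)) i

/-- Every prime factor of an entry in the support of `lam` is a sieve prime. -/
lemma S_eq_zero {k : ℕ} {θ : ℝ} {N : ℕ} {J : Finset (Fin k)} {f g : ArithmeticFunction ℝ}
    {F : (Fin k → ℝ) → ℝ} {p₁ p₂ : ℕ} (m : Fin k)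
    (h : (p₁.Prime ∧ p₁ ∉ sievePrimes θ N) ∨ (p₂.Prime ∧ p₂ ∉ sievePrimes θ N)) :
    S θ N F f g J p₁ p₂ m = 0 := by
  classical
  rw [S]
  refine Finset.sum_eq_zero fun d _ => Finset.sum_eq_zero fun e _ => ?_
  by_contra h0
  obtain ⟨⟨_, hd, he⟩, h1⟩ := ite_ne_right_iff.1 h0
  have h2 := left_ne_zero_of_mul h1
  rcases h with h | h
  · exact h.2 (mem_sievePrimes_of_admissible
      (admissible_of_lam_ne_zero (left_ne_zero_of_mul h2) m) h.1 hd)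
  · exact h.2 (mem_sievePrimes_of_admissible
      (admissible_of_lam_ne_zero (right_ne_zero_of_mul h2) m) h.1 he)

/-! ### Estimates for the local factors -/

section localWeight

variable {k : ℕ} {h : Fin k → ℝ} {q : ℝ} {V : Finset (Fin k) → Finset (Fin k) → Prop}

lemma localTerm_eq_zero_of_not_subset {A B C E : Finset (Fin k)} (hCE : ¬ (C ⊆ A ∧ E ⊆ B)) :
    localTerm h q V A B C E = 0 :=
  if_neg fun H => hCE ⟨H.2.2.1, H.2.2.2.1⟩

lemma localWeight_eq_sum_powerset (A B : Finset (Fin k)) : localWeight h q V A B =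
    ∑ C ∈ A.powerset, ∑ E ∈ B.powerset, localTerm h q V A B C E := by
  rw [localWeight]
  symm
  rw [Finset.sum_subset (Finset.subset_univ _)]
  · refine Finset.sum_congr rfl fun C _ => Finset.sum_subset (Finset.subset_univ _) fun E _ hE => ?_
    exact localTerm_eq_zero_of_not_subset fun H => hE (Finset.mem_powerset.2 H.2)
  · intro C _ hC
    exact Finset.sum_eq_zero fun E _ =>
      localTerm_eq_zero_of_not_subset fun H => hC (Finset.mem_powerset.2 H.1)

lemma localWeight_of_card {A B : Finset (Fin k)} (hAB : ¬ (A.card ≤ 1 ∧ B.card ≤ 1)) :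
    localWeight h q V A B = 0 :=
  Finset.sum_eq_zero fun _ _ => Finset.sum_eq_zero fun _ _ => if_neg fun H => hAB ⟨H.1, H.2.1⟩

lemma sum_powerset_single (i : Fin k) (u : Finset (Fin k) → ℝ) :
    ∑ C ∈ ({i} : Finset (Fin k)).powerset, u C = u ∅ + u {i} := by
  rw [show ({i} : Finset (Fin k)) = insert i ∅ from rfl,
    Finset.sum_powerset_insert (Finset.notMem_empty i)]
  simp

variable (hV : ∀ C E, V C E)

include hV

lemma localWeight_empty_empty : localWeight h q V ∅ ∅ = 1 := by
  rw [localWeight_eq_sum_powerset]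
  simp [localTerm, hV]

/-- The dichotomy between coordinates: 1 - q h_i nearly vanishes when h_i ≈ 1/q and is nearly 1 when
h_i ≈ 1/q². -/
lemma localWeight_single_empty (i : Fin k) :
    localWeight h q V {i} ∅ = (1 - q * h i) * (1 / (q - 1)) := by
  rw [localWeight_eq_sum_powerset, sum_powerset_single]
  simp [localTerm, hV]
  ring

lemma localWeight_empty_single (i : Fin k) :
    localWeight h q V ∅ {i} = (1 - q * h i) * (1 / (q - 1)) := by
  rw [localWeight_eq_sum_powerset]
  simp only [Finset.powerset_empty, Finset.sum_singleton]
  rw [sum_powerset_single]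
  simp [localTerm, hV]
  ring

lemma localWeight_single_self (i : Fin k) :
    localWeight h q V {i} {i} = (1 - 2 * (q * h i) + q ^ 2 * h i) * (1 / (q - 1)) ^ 2 := by
  rw [localWeight_eq_sum_powerset, sum_powerset_single]
  simp only [sum_powerset_single, localTerm]
  generalize 1 / (q - 1) = t
  simp [hV]
  ring

/-- The choice C = {i}, E = {j} is excluded, as q would divide two of the lcms; hence there is no
product term. -/
lemma localWeight_single_single {i j : Fin k} (hij : i ≠ j) :
    localWeight h q V {i} {j} = (1 - q * h i - q * h j) * (1 / (q - 1)) ^ 2 := by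
  rw [localWeight_eq_sum_powerset, sum_powerset_single]
  simp only [sum_powerset_single]
  have h2 : ¬ (({i} : Finset (Fin k)) ∪ {j}).card ≤ 1 := by
    rw [show ({i} : Finset (Fin k)) ∪ {j} = {i, j} from rfl, Finset.card_pair hij]
    norm_num
  simp only [localTerm, hV, h2]
  generalize 1 / (q - 1) = t
  simp
  ring

end localWeight

/-! ### Comparison of the local factors with their main part -/

/-- The main part of the local factors: coordinates outside `J` are diagonal, those in `J` are
independent. -/
def modelWeight {k : ℕ} (J : Finset (Fin k)) (q : ℝ) (A B : Finset (Fin k)) : ℝ :=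
  if ∀ i, i ∉ J → (i ∈ A ↔ i ∈ B) then (1 / (q - 1)) ^ A.card * (1 / (q - 1)) ^ (B ∩ J).card
  else 0

/-- Pointwise bounds for the values at a prime of the weights. -/
structure LocalBounds {k : ℕ} (J : Finset (Fin k)) (K q : ℝ) (h : Fin k → ℝ) : Prop where
  K_nonneg : 0 ≤ K
  three_le : 3 ≤ q
  outside : ∀ i, i ∉ J → |h i - 1 / q| ≤ K / q ^ 2
  inside : ∀ i, i ∈ J → |h i - 1 / q ^ 2| ≤ K / q ^ 3

namespace LocalBounds

variable {k : ℕ} {J : Finset (Fin k)} {K q : ℝ} {h : Fin k → ℝ}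

lemma inside_le (H : LocalBounds J K q h) {i : Fin k} (hi : i ∈ J) :
    |h i| ≤ (1 + K) / q ^ 2 := by
  have h1 := H.inside i hi
  have hq := H.three_le
  have hq0 : 0 < q := by linarith
  have h2 : K / q ^ 3 ≤ K / q ^ 2 :=
    div_le_div_of_nonneg_left H.K_nonneg (by positivity) (pow_le_pow_right₀ (by linarith)
      (by norm_num))
  have h3 : |h i| ≤ |h i - 1 / q ^ 2| + |1 / q ^ 2| := by
    have := abs_add_le (h i - 1 / q ^ 2) (1 / q ^ 2)
    rwa [sub_add_cancel] at this
  rw [abs_of_pos (by positivity : 0 < 1 / q ^ 2)] at h3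
  rw [add_div]
  linarith

lemma abs_le (H : LocalBounds J K q h) (i : Fin k) : |h i| ≤ (1 + K) / q := by
  have hq := H.three_le
  have hq0 : 0 < q := by linarith
  have hK := H.K_nonneg
  have key : ∀ n : ℕ, (1 + K) / q ^ (n + 1) ≤ (1 + K) / q := fun n =>
    div_le_div_of_nonneg_left (by linarith) hq0 (le_self_pow₀ (by linarith) n.succ_ne_zero)
  by_cases hi : i ∈ J
  · exact (H.inside_le hi).trans (key 1)
  · have h1 := H.outside i hi
    have h2 : K / q ^ 2 ≤ K / q :=
      div_le_div_of_nonneg_left hK hq0 (le_self_pow₀ (by linarith) two_ne_zero)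
    have h3 : |h i| ≤ |h i - 1 / q| + |1 / q| := by
      have := abs_add_le (h i - 1 / q) (1 / q)
      rwa [sub_add_cancel] at this
    rw [abs_of_pos (by positivity : 0 < 1 / q)] at h3
    rw [add_div]
    linarith

lemma mul_abs_le (H : LocalBounds J K q h) (i : Fin k) : |q * h i| ≤ 1 + K := by
  have hq := H.three_le
  have hq0 : 0 < q := by linarith
  have := H.abs_le i
  rw [abs_mul, abs_of_pos hq0]
  rwa [le_div_iff₀ hq0, mul_comm] at this

lemma inv_bounds (H : LocalBounds J K q h) :
    0 < 1 / (q - 1) ∧ 1 / (q - 1) ≤ 2 / q ∧ 1 / (q - 1) ≤ 1 ∧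
      (1 / (q - 1)) ^ 2 ≤ 3 / q ^ 2 := by
  have hq := H.three_le
  have h0 : 0 < q - 1 := by linarith
  refine ⟨by positivity, ?_, ?_, ?_⟩
  · rw [div_le_div_iff₀ h0 (by linarith)]; linarith
  · rw [div_le_one h0]; linarith
  · rw [div_pow, one_pow, div_le_div_iff₀ (by positivity) (by positivity)]; nlinarith

lemma modelWeight_nonneg (H : LocalBounds J K q h) (A B : Finset (Fin k)) :
    0 ≤ modelWeight J q A B := by
  have := H.inv_bounds.1
  rw [modelWeight]
  split_ifs <;> positivity

/-- Where the model is supported, B ⊆ A ∪ (B ∩ J). So the exponent |A| + |B ∩ J| is at least 2,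
except on the excluded diagonal pairs, where it is 1. -/
lemma modelWeight_le_sq (H : LocalBounds J K q h) {A B : Finset (Fin k)}
    (hAB : 2 ≤ A.card + B.card)
    (hne : ∀ i, i ∉ J → ¬ (A = {i} ∧ B = {i}) ) :
    modelWeight J q A B ≤ (1 / (q - 1)) ^ 2 := by
  have ht := H.inv_bounds
  rw [modelWeight]
  split_ifs with hc
  · rw [← pow_add]
    refine pow_le_pow_of_le_one ht.1.le ht.2.2.1 ?_
    have h1 : B ⊆ A ∪ (B ∩ J) := fun i hi => by
      by_cases hJ : i ∈ J
      · exact Finset.mem_union_right _ (Finset.mem_inter.2 ⟨hi, hJ⟩)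
      · exact Finset.mem_union_left _ ((hc i hJ).2 hi)
    have h2 := (Finset.card_le_card h1).trans (Finset.card_union_le _ _)
    by_contra hlt
    rcases Nat.eq_zero_or_pos A.card with hA | hA
    · rw [Finset.card_eq_zero] at hA
      subst hA
      simp at *
      omega
    · have hA1 : A.card = 1 := by omega
      have hB0 : (B ∩ J).card = 0 := by omega
      obtain ⟨i, rfl⟩ := Finset.card_eq_one.1 hA1
      rw [Finset.card_eq_zero] at hB0
      rw [hB0, Finset.union_empty] at h1
      have hB : B = {i} := by
        rcases Finset.subset_singleton_iff.1 h1 with h3 | h3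
        · rw [h3] at hAB; simp at hAB
        · exact h3
      refine hne i (fun hJ => ?_) ⟨rfl, hB⟩
      have : i ∈ B ∩ J := Finset.mem_inter.2 ⟨by simp [hB], hJ⟩
      simp [hB0] at this
  · positivity

lemma close (H : LocalBounds J K q h) {V : Finset (Fin k) → Finset (Fin k) → Prop}
    (hV : ∀ C E, V C E) (A B : Finset (Fin k)) :
    |localWeight h q V A B - modelWeight J q A B| ≤ 15 * (1 + K) / q ^ 2 := by
  have hq := H.three_le
  have hq0 : 0 < q := by linarith
  have hK := H.K_nonneg
  obtain ⟨t0, t1, t2, t3⟩ := H.inv_bounds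
  have hq2 : 0 < q ^ 2 := by positivity
  -- The constant 15 is 5 · 3: every coefficient below is at most 5 + 5K, and (q - 1)⁻² ≤ 3/q² for q
  -- ≥ 3.
  have sq_case : ∀ y M : ℝ, |y| ≤ M → M ≤ 5 + 5 * K → |y| * (1 / (q - 1)) ^ 2 ≤
      15 * (1 + K) / q ^ 2 := fun y M hy hM => by
    calc |y| * (1 / (q - 1)) ^ 2 ≤ (5 + 5 * K) * (3 / q ^ 2) :=
          mul_le_mul (hy.trans hM) t3 (by positivity) (by linarith)
      _ = _ := by ring
  have single : ∀ i, |(1 - q * h i) * (1 / (q - 1)) - if i ∈ J then 1 / (q - 1) else 0| ≤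
      15 * (1 + K) / q ^ 2 := fun i => by
    split_ifs with hi
    · rw [show (1 - q * h i) * (1 / (q - 1)) - 1 / (q - 1) = -(q * h i * (1 / (q - 1))) by ring,
        abs_neg, abs_mul, abs_mul, abs_of_pos t0, abs_of_pos hq0]
      have h1 := H.inside_le hi
      calc q * |h i| * (1 / (q - 1)) ≤ q * ((1 + K) / q ^ 2) * (2 / q) := by gcongr
        _ = 2 * (1 + K) / q ^ 2 := by field_simp
        _ ≤ _ := by gcongr; norm_num
    · have h1 := H.outside i hi
      rw [sub_zero, abs_mul, abs_of_pos t0]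
      have h2 : 1 - q * h i = -(q * (h i - 1 / q)) := by field_simp; ring
      rw [h2, abs_neg, abs_mul, abs_of_pos hq0]
      calc q * |h i - 1 / q| * (1 / (q - 1)) ≤ q * (K / q ^ 2) * (2 / q) := by gcongr
        _ = 2 * K / q ^ 2 := by field_simp
        _ ≤ _ := div_le_div_of_nonneg_right (by linarith) hq2.le
  by_cases hcard : A.card ≤ 1 ∧ B.card ≤ 1
  · rcases Finset.eq_empty_or_nonempty A with rfl | hAn
    · rcases Finset.eq_empty_or_nonempty B with rfl | hBn
      · rw [localWeight_empty_empty hV]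
        simp only [modelWeight]
        simp
        positivity
      · obtain ⟨j, rfl⟩ := Finset.card_eq_one.1 (le_antisymm hcard.2 hBn.card_pos)
        rw [localWeight_empty_single hV]
        convert single j using 3
        by_cases hj : j ∈ J
        · rw [modelWeight, if_pos, if_pos hj, Finset.singleton_inter_of_mem hj]
          · simp
          · intro i hi
            simp only [Finset.notMem_empty, Finset.mem_singleton, false_iff]
            rintro rfl
            exact hi hj
        · rw [modelWeight, if_neg, if_neg hj]
          intro hc
          simpa using hc j hj
    · obtain ⟨i, rfl⟩ := Finset.card_eq_one.1 (le_antisymm hcard.1 hAn.card_pos)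
      rcases Finset.eq_empty_or_nonempty B with rfl | hBn
      · rw [localWeight_single_empty hV]
        convert single i using 3
        by_cases hi : i ∈ J
        · rw [modelWeight, if_pos, if_pos hi]
          · simp
          · intro j hj
            simp only [Finset.notMem_empty, Finset.mem_singleton, iff_false]
            rintro rfl
            exact hj hi
        · rw [modelWeight, if_neg, if_neg hi]
          intro hc
          simpa using hc i hi
      · obtain ⟨j, rfl⟩ := Finset.card_eq_one.1 (le_antisymm hcard.2 hBn.card_pos)
        by_cases hij : i = j
        · subst hij
          rw [localWeight_single_self hV]
          by_cases hi : i ∈ J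
          · have hm : modelWeight J q {i} {i} = (1 / (q - 1)) ^ 2 := by
              rw [modelWeight, if_pos fun _ _ => Iff.rfl, Finset.singleton_inter_of_mem hi]
              simp [sq]
            rw [hm, ← sub_one_mul, abs_mul, abs_of_nonneg (by positivity : 0 ≤ (1 / (q - 1)) ^ 2)]
            refine sq_case _ (3 * (1 + K)) ?_ (by linarith)
            have h1 := H.mul_abs_le i
            have h2 : |q ^ 2 * h i| ≤ 1 + K := by
              have := H.inside_le hi
              rw [abs_mul, abs_of_pos hq2]
              rwa [le_div_iff₀ hq2, mul_comm] at this
            rw [_root_.abs_le] at h1 h2 ⊢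
            constructor <;> linarith
          · have hm : modelWeight J q {i} {i} = 1 / (q - 1) := by
              rw [modelWeight, if_pos fun _ _ => Iff.rfl, Finset.singleton_inter_of_notMem hi]
              simp
            have h1 := H.outside i hi
            -- The diagonal factor equals 1/(q - 1) exactly when h_i = 1/q, so the error is
            -- proportional to h_i - 1/q.
            have e : (1 - 2 * (q * h i) + q ^ 2 * h i) * (1 / (q - 1)) ^ 2 - 1 / (q - 1) =
                ((q ^ 2 - 2 * q) * (h i - 1 / q)) * (1 / (q - 1)) ^ 2 := by
              have : q - 1 ≠ 0 := by linarith
              field_simp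
              ring
            rw [hm, e, abs_mul, abs_of_nonneg (by positivity : 0 ≤ (1 / (q - 1)) ^ 2)]
            refine sq_case _ K ?_ (by linarith)
            rw [abs_mul, abs_of_nonneg (by nlinarith)]
            calc (q ^ 2 - 2 * q) * |h i - 1 / q| ≤ q ^ 2 * (K / q ^ 2) := by
                  gcongr
                  linarith
              _ = K := by field_simp
        · rw [localWeight_single_single hV hij]
          have hm := H.modelWeight_le_sq (A := {i}) (B := {j}) (by simp) fun l _ hl => hij (by
            rw [Finset.singleton_inj.1 hl.1, Finset.singleton_inj.1 hl.2])
          have hm0 := H.modelWeight_nonneg {i} {j}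
          have h1 := H.mul_abs_le i
          have h2 := H.mul_abs_le j
          have h3 : |1 - q * h i - q * h j| ≤ 3 + 2 * K := by
            rw [_root_.abs_le] at h1 h2 ⊢
            constructor <;> linarith
          have h4 := sq_case (4 + 2 * K) (4 + 2 * K) (abs_of_nonneg (by linarith)).le (by linarith)
          rw [abs_of_nonneg (by linarith : 0 ≤ 4 + 2 * K)] at h4
          refine (abs_sub _ _).trans ?_
          rw [abs_mul, abs_of_nonneg hm0, abs_of_nonneg (by positivity : 0 ≤ (1 / (q - 1)) ^ 2)]
          have h5 : |1 - q * h i - q * h j| * (1 / (q - 1)) ^ 2 ≤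
            (3 + 2 * K) * (1 / (q - 1)) ^ 2 := by gcongr
          linarith
  · rw [localWeight_of_card hcard, zero_sub, abs_neg, abs_of_nonneg (H.modelWeight_nonneg A B)]
    refine (H.modelWeight_le_sq (by omega) fun i _ hi => hcard (by simp [hi.1, hi.2])).trans ?_
    refine t3.trans ?_
    gcongr
    linarith

/-- On the support, B is determined by A and B ∩ J. This amounts to k + |J| independent binary
choices, each costing x/(q - 1), since x ≤ 1 allows the exponent |B| to be lowered to |B ∩ J|. The
power of `B θ N` in the theorem originates here. -/
lemma sum_modelWeight_le (H : LocalBounds J K q h) {x : ℝ} (hx0 : 0 ≤ x) (hx1 : x ≤ 1) :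
    ∑ A, ∑ B, modelWeight J q A B * (x ^ A.card * x ^ B.card) ≤
      (1 + 1 / (q - 1) * x) ^ (k + J.card) := by
  have t0 := H.inv_bounds.1
  set t := 1 / (q - 1) with ht
  have hpow : ∀ S : Finset (Fin k), ∑ A ∈ S.powerset, (t * x) ^ A.card = (1 + t * x) ^ S.card :=
    fun S => by
      have := Finset.prod_one_add (f := fun _ => t * x) S
      simpa using this.symm
  have h1 : ∀ A, ∑ B, modelWeight J q A B * (x ^ A.card * x ^ B.card) ≤
      (t * x) ^ A.card * (1 + t * x) ^ J.card := fun A => by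
    rw [← hpow, Finset.mul_sum]
    rw [← Finset.sum_filter_of_ne (p := fun B : Finset (Fin k) => ∀ i, i ∉ J → (i ∈ A ↔ i ∈ B))
      fun B _ hB => (ite_ne_right_iff.1 (left_ne_zero_of_mul hB)).1]
    have hinj : Set.InjOn (fun B => B ∩ J)
        (Finset.univ.filter fun B : Finset (Fin k) => ∀ i, i ∉ J → (i ∈ A ↔ i ∈ B)) := by
      intro B hB B' hB' hBB
      have hB := (Finset.mem_filter.1 hB).2
      have hB' := (Finset.mem_filter.1 hB').2
      ext i
      by_cases hi : i ∈ J
      · have := Finset.ext_iff.1 hBB i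
        simpa [hi] using this
      · rw [← hB i hi, hB' i hi]
    calc _ ≤ ∑ B ∈ Finset.univ.filter (fun B : Finset (Fin k) => ∀ i, i ∉ J → (i ∈ A ↔ i ∈ B)),
          (t * x) ^ A.card * (t * x) ^ (B ∩ J).card := by
          refine Finset.sum_le_sum fun B hB => ?_
          rw [modelWeight, if_pos (Finset.mem_filter.1 hB).2, mul_pow, mul_pow]
          have : x ^ B.card ≤ x ^ (B ∩ J).card :=
            pow_le_pow_of_le_one hx0 hx1 (Finset.card_le_card Finset.inter_subset_left)
          calc _ = t ^ A.card * t ^ (B ∩ J).card * x ^ A.card * x ^ B.card := by ring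
            _ ≤ t ^ A.card * t ^ (B ∩ J).card * x ^ A.card * x ^ (B ∩ J).card := by gcongr
            _ = _ := by ring
      _ = ∑ D ∈ (Finset.univ.filter
            (fun B : Finset (Fin k) => ∀ i, i ∉ J → (i ∈ A ↔ i ∈ B))).image (fun B => B ∩ J),
          (t * x) ^ A.card * (t * x) ^ D.card := (Finset.sum_image
            (f := fun D => (t * x) ^ A.card * (t * x) ^ D.card) hinj).symm
      _ ≤ _ := by
          refine Finset.sum_le_sum_of_subset_of_nonneg ?_ fun _ _ _ => by positivity
          intro D hD
          obtain ⟨B, _, rfl⟩ := Finset.mem_image.1 hD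
          exact Finset.mem_powerset.2 Finset.inter_subset_right
  calc _ ≤ ∑ A : Finset (Fin k), (t * x) ^ A.card * (1 + t * x) ^ J.card :=
        Finset.sum_le_sum fun A _ => h1 A
    _ = _ := by
        have := hpow Finset.univ
        rw [Finset.powerset_univ, Finset.card_univ, Fintype.card_fin] at this
        rw [← Finset.sum_mul, this, pow_add]

/-- The condition forces C ∪ E = {m}, so exactly one value h_m appears. Each pair of powers of q and
1/(q - 1) is at most 3/2, with (3/2)² ≤ 3, and 4^k counts the pairs (C, E). -/
lemma flagged (H : LocalBounds J K q h) {V : Finset (Fin k) → Finset (Fin k) → Prop} {m : Fin k}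
    (hV : ∀ C E, V C E → m ∈ C ∪ E) (A B : Finset (Fin k)) :
    |localWeight h q V A B| ≤ 3 * 4 ^ k * |h m| := by
  have hq := H.three_le
  have hq0 : 0 < q := by linarith
  have t0 := H.inv_bounds.1
  have hqt : q * (1 / (q - 1)) ≤ 3 / 2 := by
    rw [mul_one_div, div_le_div_iff₀ (by linarith) two_pos]
    linarith
  have aux : ∀ A C : Finset (Fin k), A.card ≤ 1 → C ⊆ A →
      q ^ C.card * (1 / (q - 1)) ^ A.card ≤ 3 / 2 := fun A C hA hC => by
    have hCA := Finset.card_le_card hC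
    have t2 := H.inv_bounds.2.2.1
    have hA' : A.card = 0 ∨ A.card = 1 := by omega
    have hC' : C.card = 0 ∨ C.card = 1 := by omega
    rcases hA' with h1 | h1 <;> rcases hC' with h2 | h2
    · rw [h1, h2]
      norm_num
    · omega
    · rw [h1, h2, pow_zero, pow_one, one_mul]
      linarith
    · rwa [h1, h2, pow_one, pow_one]
  have hterm : ∀ C E, |localTerm h q V A B C E| ≤ 3 * |h m| := fun C E => by
    rw [localTerm]
    split_ifs with hc
    · obtain ⟨hA, hB, hC, hE, hCE, hv⟩ := hc
      have hmem := hV C E hv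
      have hs : C ∪ E = {m} := by
        refine Finset.eq_singleton_iff_unique_mem.2 ⟨hmem, fun i hi => ?_⟩
        exact Finset.card_le_one.1 hCE i hi m hmem
      rw [hs, Finset.prod_singleton, abs_mul, abs_mul, abs_mul, abs_mul, abs_pow, abs_pow, abs_neg,
        abs_of_pos hq0, abs_pow, abs_pow, abs_of_pos t0]
      calc _ = (q ^ C.card * (1 / (q - 1)) ^ A.card) * (q ^ E.card * (1 / (q - 1)) ^ B.card) *
            |h m| := by ring
        _ ≤ 3 / 2 * (3 / 2) * |h m| := by
            gcongr
            · exact aux A C hA hC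
            · exact aux B E hB hE
        _ ≤ 3 * |h m| := by gcongr; norm_num
    · rw [abs_zero]
      positivity
  rw [localWeight]
  refine (Finset.abs_sum_le_sum_abs _ _).trans ?_
  calc _ ≤ ∑ C : Finset (Fin k), ∑ E : Finset (Fin k), 3 * |h m| :=
        Finset.sum_le_sum fun C _ => (Finset.abs_sum_le_sum_abs _ _).trans
          (Finset.sum_le_sum fun E _ => hterm C E)
    _ = 3 * 4 ^ k * |h m| := by
        simp only [Finset.sum_const, Finset.card_univ, Fintype.card_finset, Fintype.card_fin,
          nsmul_eq_mul, Nat.cast_pow, Nat.cast_ofNat]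
        rw [show (4 : ℝ) = 2 * 2 by norm_num, mul_pow]
        ring

/-- The constant in the comparison of the local factors with their main part. -/
def _root_.HalfSieve.closeConst (k : ℕ) (K : ℝ) : ℝ := 4 ^ k * (15 * (1 + K))

lemma sum_close (H : LocalBounds J K q h) {V : Finset (Fin k) → Finset (Fin k) → Prop}
    (hV : ∀ C E, V C E) {x : ℝ} (hx0 : 0 ≤ x) (hx1 : x ≤ 1) :
    ∑ A, ∑ B, |localWeight h q V A B - modelWeight J q A B| * (x ^ A.card * x ^ B.card) ≤
      closeConst k K / q ^ 2 := by
  have hK := H.K_nonneg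
  calc _ ≤ ∑ A : Finset (Fin k), ∑ B : Finset (Fin k), 15 * (1 + K) / q ^ 2 := by
        refine Finset.sum_le_sum fun A _ => Finset.sum_le_sum fun B _ => ?_
        refine (mul_le_of_le_one_right (abs_nonneg _) ?_).trans (H.close hV A B)
        exact mul_le_one₀ (pow_le_one₀ hx0 hx1) (by positivity) (pow_le_one₀ hx0 hx1)
    _ = _ := by
        simp only [Finset.sum_const, Finset.card_univ, Fintype.card_finset, Fintype.card_fin,
          nsmul_eq_mul, Nat.cast_pow, Nat.cast_ofNat, closeConst]
        rw [show (4 : ℝ) = 2 * 2 by norm_num, mul_pow]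
        ring

lemma sum_localWeight_le (H : LocalBounds J K q h) {V : Finset (Fin k) → Finset (Fin k) → Prop}
    (hV : ∀ C E, V C E) {x : ℝ} (hx0 : 0 ≤ x) (hx1 : x ≤ 1) :
    ∑ A, ∑ B, |localWeight h q V A B| * (x ^ A.card * x ^ B.card) ≤
      (1 + 1 / (q - 1) * x) ^ (k + J.card) * (1 + closeConst k K * (1 / q ^ 2)) := by
  have hK := H.K_nonneg
  have t0 := H.inv_bounds.1
  have h1 := H.sum_modelWeight_le hx0 hx1
  have h2 := H.sum_close hV hx0 hx1
  have h3 : ∑ A, ∑ B, |localWeight h q V A B| * (x ^ A.card * x ^ B.card) ≤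
      (∑ A, ∑ B, modelWeight J q A B * (x ^ A.card * x ^ B.card)) +
      ∑ A, ∑ B, |localWeight h q V A B - modelWeight J q A B| * (x ^ A.card * x ^ B.card) := by
    simp only [← Finset.sum_add_distrib, ← add_mul]
    refine Finset.sum_le_sum fun A _ => Finset.sum_le_sum fun B _ => ?_
    refine mul_le_mul_of_nonneg_right ?_ (by positivity)
    have := abs_add_le (modelWeight J q A B) (localWeight h q V A B - modelWeight J q A B)
    rwa [add_sub_cancel, abs_of_nonneg (H.modelWeight_nonneg A B)] at this
  have h4 : 1 ≤ (1 + 1 / (q - 1) * x) ^ (k + J.card) :=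
    one_le_pow₀ (le_add_of_nonneg_right (by positivity))
  have h5 : 0 ≤ closeConst k K / q ^ 2 := by rw [closeConst]; positivity
  rw [mul_add, mul_one, mul_one_div]
  nlinarith [mul_le_mul_of_nonneg_right h4 h5]

lemma sum_flagged_le (H : LocalBounds J K q h) {V : Finset (Fin k) → Finset (Fin k) → Prop}
    {m : Fin k} (hV : ∀ C E, V C E → m ∈ C ∪ E) {x : ℝ} (hx0 : 0 ≤ x) (hx1 : x ≤ 1) :
    ∑ A, ∑ B, |localWeight h q V A B| * (x ^ A.card * x ^ B.card) ≤ 3 * 16 ^ k * |h m| := by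
  calc _ ≤ ∑ A : Finset (Fin k), ∑ B : Finset (Fin k), 3 * 4 ^ k * |h m| := by
        refine Finset.sum_le_sum fun A _ => Finset.sum_le_sum fun B _ => ?_
        refine (mul_le_of_le_one_right (abs_nonneg _) ?_).trans (H.flagged hV A B)
        exact mul_le_one₀ (pow_le_one₀ hx0 hx1) (by positivity) (pow_le_one₀ hx0 hx1)
    _ = _ := by
        simp only [Finset.sum_const, Finset.card_univ, Fintype.card_finset, Fintype.card_fin,
          nsmul_eq_mul, Nat.cast_pow, Nat.cast_ofNat]
        rw [show (16 : ℝ) = 2 * 2 * 4 by norm_num, mul_pow, mul_pow]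
        ring

end LocalBounds

/-! ### Upper bounds for the sieve sum -/

/-- Telescoping, in a form where the bound is again a difference of products: after summation over
tuples both products factor over the primes. -/
lemma abs_prod_sub_prod_le {ι : Type*} (s : Finset ι) (w v : ι → ℝ) :
    |∏ i ∈ s, w i - ∏ i ∈ s, v i| ≤ ∏ i ∈ s, (|v i| + |w i - v i|) - ∏ i ∈ s, |v i| := by
  classical
  induction s using Finset.induction_on with
  | empty => simp
  | insert j s hj ih =>
    rw [Finset.prod_insert hj, Finset.prod_insert hj, Finset.prod_insert hj, Finset.prod_insert hj]
    have h1 : |∏ i ∈ s, w i| ≤ ∏ i ∈ s, (|v i| + |w i - v i|) := by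
      rw [Finset.abs_prod]
      refine Finset.prod_le_prod (fun _ _ => abs_nonneg _) fun i _ => ?_
      have := abs_add_le (v i) (w i - v i)
      rwa [add_sub_cancel] at this
    rw [show w j * ∏ i ∈ s, w i - v j * ∏ i ∈ s, v i =
      (w j - v j) * ∏ i ∈ s, w i + v j * (∏ i ∈ s, w i - ∏ i ∈ s, v i) by ring]
    refine (abs_add_le _ _).trans ?_
    rw [abs_mul, abs_mul]
    have h2 := mul_le_mul_of_nonneg_left h1 (abs_nonneg (w j - v j))
    have h3 := mul_le_mul_of_nonneg_left ih (abs_nonneg (v j))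
    linarith

/-- A real `sSup` bounds its set only if that set is bounded above. This follows from compactness
and continuity of the derivative within the cube, where derivatives are unique. -/
lemma abs_le_Fmax {k : ℕ} {F : (Fin k → ℝ) → ℝ} (hF : IsSieveFunction F) {x : Fin k → ℝ}
    (hx : x ∈ Set.Icc (0 : Fin k → ℝ) 1) : |F x| ≤ Fmax F := by
  have hU : UniqueDiffOn ℝ (Set.Icc (0 : Fin k → ℝ) 1) := by
    rw [Icc_zero_one_pi]
    exact UniqueDiffOn.univ_pi fun _ => uniqueDiffOn_Icc zero_lt_one
  have hd : ContinuousOn (fun t => fderivWithin ℝ F (Set.Icc 0 1) t) (Set.Icc 0 1) :=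
    hF.smooth.continuousOn_fderivWithin hU (by simp)
  have hc : ContinuousOn (fun t => |F t| + ∑ i, |fderivWithin ℝ F (Set.Icc 0 1) t
      (Pi.single i 1)|) (Set.Icc (0 : Fin k → ℝ) 1) := by
    refine hF.smooth.continuousOn.abs.add (continuousOn_finsetSum _ fun i _ => ?_)
    exact (hd.clm_apply continuousOn_const).abs
  have hb := (isCompact_Icc.image_of_continuousOn hc).bddAbove
  refine le_trans ?_ (le_csSup hb ⟨x, hx, rfl⟩)
  exact le_add_of_nonneg_right (Finset.sum_nonneg fun _ _ => abs_nonneg _)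

/-! ### Rankin's trick -/

/-- The damping factor `p^{-1/log R}`. -/
def damp (θ : ℝ) (N p : ℕ) : ℝ := (p : ℝ) ^ (-(1 / Real.log (R θ N)))

section damp

variable {k : ℕ} {θ : ℝ} {N : ℕ}

lemma damp_nonneg (p : ℕ) : 0 ≤ damp θ N p := Real.rpow_nonneg (Nat.cast_nonneg _) _

lemma prod_damp (a : Fin k → Finset (sievePrimes θ N)) :
    ∏ p : sievePrimes θ N, damp θ N p ^ (slice a p).card =
      Real.exp (-∑ i, pos θ N (a i)) := by
  have h1 : ∀ s : Finset (sievePrimes θ N),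
      ∏ p ∈ s, damp θ N p = Real.exp (-pos θ N s) := fun s => by
    have h2 : ∀ p ∈ s, damp θ N p = Real.exp (-(Real.log (p : ℕ) / Real.log (R θ N))) :=
      fun p _ => by
        rw [damp, Real.rpow_def_of_pos (Nat.cast_pos.2 (sievePrimes_prime p p.2).pos)]
        congr 1
        ring
    rw [Finset.prod_congr rfl h2, ← Real.exp_sum, pos, num, Nat.cast_prod,
      Real.log_prod (s := s) (f := fun p : sievePrimes θ N => ((p : ℕ) : ℝ))
        fun p _ => Nat.cast_ne_zero.2 (sievePrimes_prime p p.2).ne_zero,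
      Finset.sum_neg_distrib, Finset.sum_div]
  rw [← Finset.sum_neg_distrib, Real.exp_sum, ← Finset.prod_congr rfl fun i _ => h1 (a i),
    prod_slice (u := fun _ p => damp θ N p)]
  simp only [Finset.prod_const]

/-- On the simplex the positions sum to at most 1, so exp(1 - ∑ pos) ≥ 1; off it `F` vanishes. The
cut-off thus becomes a factor multiplicative over primes. -/
lemma abs_F_le_damp {F : (Fin k → ℝ) → ℝ} (hF : IsSieveFunction F)
    (a : Fin k → Finset (sievePrimes θ N)) :
    |F fun i => pos θ N (a i)| ≤ Fmax F * Real.exp 1 *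
      ∏ p : sievePrimes θ N, damp θ N p ^ (slice a p).card := by
  rw [prod_damp, mul_assoc, ← Real.exp_add]
  have h0 : 0 ≤ Fmax F := (abs_nonneg _).trans (abs_le_Fmax hF (x := 0) (by simp))
  by_cases hs : (fun i => pos θ N (a i)) ∈ simplex k
  · refine (abs_le_Fmax hF hs.1).trans (le_mul_of_one_le_right h0 (Real.one_le_exp ?_))
    have := hs.2
    linarith
  · rw [hF.supported _ hs, abs_zero]
    positivity

/-- Rankin's trick for the quadratic form. -/
lemma abs_quadratic_le {F : (Fin k → ℝ) → ℝ} (hF : IsSieveFunction F)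
    (T G : (Fin k → Finset (sievePrimes θ N)) → (Fin k → Finset (sievePrimes θ N)) → ℝ)
    (hTG : ∀ a b, |T a b| ≤ G a b) :
    |∑ a, ∑ b, F (fun i => pos θ N (a i)) * F (fun i => pos θ N (b i)) * T a b| ≤
      Fmax F ^ 2 * Real.exp 1 ^ 2 * ∑ a, ∑ b, G a b *
        ∏ p : sievePrimes θ N, (damp θ N p ^ (slice a p).card * damp θ N p ^ (slice b p).card) := by
  rw [Finset.mul_sum]
  refine (Finset.abs_sum_le_sum_abs _ _).trans (Finset.sum_le_sum fun a _ => ?_)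
  rw [Finset.mul_sum]
  refine (Finset.abs_sum_le_sum_abs _ _).trans (Finset.sum_le_sum fun b _ => ?_)
  rw [abs_mul, abs_mul, Finset.prod_mul_distrib]
  have ha := abs_F_le_damp hF a
  have hb := abs_F_le_damp hF b
  calc _ ≤ (Fmax F * Real.exp 1 * ∏ p : sievePrimes θ N, damp θ N p ^ (slice a p).card) *
        (Fmax F * Real.exp 1 * ∏ p : sievePrimes θ N, damp θ N p ^ (slice b p).card) * G a b :=
        mul_le_mul (mul_le_mul ha hb (abs_nonneg _) ((abs_nonneg _).trans ha)) (hTG a b)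
          (abs_nonneg _) (mul_nonneg ((abs_nonneg _).trans ha) ((abs_nonneg _).trans hb))
    _ = _ := by ring

lemma damp_le_one (hR : 0 < Real.log (R θ N)) (p : sievePrimes θ N) : damp θ N p ≤ 1 :=
  (rpow_neg_prime_lt_one (sievePrimes_prime p p.2) (by positivity)).le

lemma abs_quadratic_prod_le {F : (Fin k → ℝ) → ℝ} (hF : IsSieveFunction F)
    (w : sievePrimes θ N → Finset (Fin k) → Finset (Fin k) → ℝ) :
    |∑ a : Fin k → Finset (sievePrimes θ N), ∑ b : Fin k → Finset (sievePrimes θ N),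
        F (fun i => pos θ N (a i)) * F (fun i => pos θ N (b i)) *
          ∏ p, w p (slice a p) (slice b p)| ≤
      Fmax F ^ 2 * Real.exp 1 ^ 2 *
        ∏ p, ∑ A, ∑ B, |w p A B| * (damp θ N p ^ A.card * damp θ N p ^ B.card) := by
  refine (abs_quadratic_le hF _ (fun a b => ∏ p, |w p (slice a p) (slice b p)|)
    fun a b => (Finset.abs_prod _ _).le).trans_eq ?_
  rw [prod_sum_sum_slice]
  simp only [Finset.prod_mul_distrib]

lemma abs_quadratic_sub_le {F : (Fin k → ℝ) → ℝ} (hF : IsSieveFunction F)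
    (w v : sievePrimes θ N → Finset (Fin k) → Finset (Fin k) → ℝ) :
    |(∑ a : Fin k → Finset (sievePrimes θ N), ∑ b : Fin k → Finset (sievePrimes θ N),
        F (fun i => pos θ N (a i)) * F (fun i => pos θ N (b i)) *
          ∏ p, w p (slice a p) (slice b p)) -
      ∑ a : Fin k → Finset (sievePrimes θ N), ∑ b : Fin k → Finset (sievePrimes θ N),
        F (fun i => pos θ N (a i)) * F (fun i => pos θ N (b i)) *
          ∏ p, v p (slice a p) (slice b p)| ≤
      Fmax F ^ 2 * Real.exp 1 ^ 2 *
        (∏ p, ((∑ A, ∑ B, |v p A B| * (damp θ N p ^ A.card * damp θ N p ^ B.card)) +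
          ∑ A, ∑ B, |w p A B - v p A B| * (damp θ N p ^ A.card * damp θ N p ^ B.card)) -
        ∏ p, ∑ A, ∑ B, |v p A B| * (damp θ N p ^ A.card * damp θ N p ^ B.card)) := by
  simp only [← Finset.sum_sub_distrib, ← mul_sub]
  refine (abs_quadratic_le hF _ (fun a b =>
    ∏ p, (|v p (slice a p) (slice b p)| +
      |w p (slice a p) (slice b p) - v p (slice a p) (slice b p)|) -
    ∏ p, |v p (slice a p) (slice b p)|) fun a b => abs_prod_sub_prod_le _ _ _).trans_eq ?_
  simp only [← Finset.sum_add_distrib, ← add_mul]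
  rw [prod_sum_sum_slice, prod_sum_sum_slice]
  simp only [← Finset.sum_sub_distrib, sub_mul, Finset.prod_mul_distrib]

/-- The local sums of the quadratic form are dominated by the Laplace transform of the weights. -/
lemma prod_damp_le_laplace (hR : 0 < Real.log (R θ N)) :
    ∏ p : sievePrimes θ N, (1 + 1 / (((p : ℕ) : ℝ) - 1) * damp θ N p) ≤
      laplace ⌊D0 N⌋₊ (1 / Real.log (R θ N)) := by
  have h1 : ∏ p : sievePrimes θ N, (1 + 1 / (((p : ℕ) : ℝ) - 1) * damp θ N p) =
      ∏ p ∈ sievePrimes θ N, (1 + wt ⌊D0 N⌋₊ p * (p : ℝ) ^ (-(1 / Real.log (R θ N)))) := by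
    rw [← Finset.prod_coe_sort (sievePrimes θ N) fun p : ℕ =>
      1 + wt ⌊D0 N⌋₊ p * (p : ℝ) ^ (-(1 / Real.log (R θ N)))]
    refine Finset.prod_congr rfl fun p _ => ?_
    rw [wt, if_pos (Finset.mem_filter.1 p.2).2, damp]
  rw [h1, Finset.prod_one_add]
  exact (summable_laplace _ (by positivity)).sum_le_tsum _ fun s _ =>
    Finset.prod_nonneg fun p _ => wt_rpow_nonneg _ _ _

end damp

lemma three_le_of_mem {θ : ℝ} {N : ℕ} (p : sievePrimes θ N) : (3 : ℝ) ≤ ((p : ℕ) : ℝ) := by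
  have := (Finset.mem_filter.1 p.2).2.2.1
  have h : 3 ≤ (p : ℕ) := by
    by_contra hlt
    have := Nat.mod_le (p : ℕ) 4
    omega
  exact_mod_cast h

lemma localBounds {k : ℕ} {θ : ℝ} {N : ℕ} {J : Finset (Fin k)} {K : ℝ}
    {f g : ArithmeticFunction ℝ} (hfg : IsWeightPair K J f g) (p : sievePrimes θ N) :
    LocalBounds J |K| (p : ℕ) (fun i => coordWeight J f g i p) := by
  have hp := sievePrimes_prime p p.2
  refine ⟨abs_nonneg K, three_le_of_mem p, fun i hi => ?_, fun i hi => ?_⟩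
  · rw [coordWeight, if_neg hi]
    rcases J.eq_empty_or_nonempty with hJ | hJ
    · rw [hfg.empty_case hJ p hp, sub_self, abs_zero]
      positivity
    · refine (hfg.f_approx hJ p hp).trans ?_
      gcongr
      exact le_abs_self K
  · rw [coordWeight, if_pos hi]
    refine (hfg.g_approx ⟨i, hi⟩ p hp).trans ?_
    gcongr
    exact le_abs_self K

lemma sum_inv_sq_sievePrimes_le {θ : ℝ} {N : ℕ} (hD : ⌊D0 N⌋₊ ≠ 0) :
    ∑ p : sievePrimes θ N, 1 / ((p : ℕ) : ℝ) ^ 2 ≤ 1 / (⌊D0 N⌋₊ : ℝ) := by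
  rw [Finset.sum_coe_sort (sievePrimes θ N) fun p : ℕ => 1 / (p : ℝ) ^ 2]
  exact sum_inv_sq_le hD _ fun p hp => (Finset.mem_filter.1 hp).2.2.2

/-- The constant in the bound for the local sums at the primes `p₁`, `p₂`. -/
def flagConst (k : ℕ) (K : ℝ) : ℝ := 3 * 16 ^ k * (1 + |K|)

lemma one_le_flagConst (k : ℕ) (K : ℝ) : 1 ≤ flagConst k K := by
  have h1 : (1 : ℝ) ≤ 16 ^ k := one_le_pow₀ (by norm_num)
  have := abs_nonneg K
  rw [flagConst]
  nlinarith

lemma num_filter_eq {θ : ℝ} {N p₁ : ℕ} (h1 : p₁ = 1 ∨ p₁ ∈ sievePrimes θ N) :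
    num (Finset.univ.filter fun p : sievePrimes θ N => (p : ℕ) = p₁) = p₁ ∧
      (Finset.univ.filter fun p : sievePrimes θ N => (p : ℕ) = p₁).card ≤ 1 := by
  have hcard : (Finset.univ.filter fun p : sievePrimes θ N => (p : ℕ) = p₁).card ≤ 1 :=
    Finset.card_le_one.2 fun p hp q hq => Subtype.ext (by
      rw [(Finset.mem_filter.1 hp).2, (Finset.mem_filter.1 hq).2])
  refine ⟨?_, hcard⟩
  rcases h1 with rfl | h1
  · rw [Finset.filter_false_of_mem fun (p : sievePrimes θ N) _ =>
      (sievePrimes_prime p p.2).one_lt.ne']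
    rfl
  · rw [show (Finset.univ.filter fun p : sievePrimes θ N => (p : ℕ) = p₁) = {⟨p₁, h1⟩} by
      ext p
      simp [Subtype.ext_iff]]
    simp [num]

/-- There are at most two flagged primes and their product is lcm(p₁, p₂); using the union of the
two sets covers p₁ = p₂ and p_i = 1. -/
lemma prod_flag_le {θ : ℝ} {N p₁ p₂ : ℕ} (h1 : p₁ = 1 ∨ p₁ ∈ sievePrimes θ N)
    (h2 : p₂ = 1 ∨ p₂ ∈ sievePrimes θ N) {C : ℝ} (hC : 1 ≤ C) (e : ℕ) :
    ∏ p : sievePrimes θ N, (if (p : ℕ) = p₁ ∨ (p : ℕ) = p₂ then C / ((p : ℕ) : ℝ) ^ e else 1) ≤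
      C ^ 2 / (Nat.lcm p₁ p₂ : ℝ) ^ e := by
  classical
  obtain ⟨n1, c1⟩ := num_filter_eq h1
  obtain ⟨n2, c2⟩ := num_filter_eq h2
  have hl : Nat.lcm p₁ p₂ = num ((Finset.univ.filter fun p : sievePrimes θ N => (p : ℕ) = p₁) ∪
      Finset.univ.filter fun p : sievePrimes θ N => (p : ℕ) = p₂) := by
    rw [← lcm_num sievePrimes_prime, n1, n2]
  rw [← Finset.prod_filter, Finset.filter_or, Finset.prod_div_distrib, Finset.prod_const,
    Finset.prod_pow, hl, num, Nat.cast_prod]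
  gcongr
  exact (Finset.card_union_le _ _).trans (by omega)

/-- The upper bound for `S`, in terms of the Laplace transform of the weights. -/
theorem abs_S_le {k : ℕ} {θ : ℝ} {N : ℕ} (hR : 0 < Real.log (R θ N)) (hD : ⌊D0 N⌋₊ ≠ 0)
    {J : Finset (Fin k)} {K : ℝ} {f g : ArithmeticFunction ℝ} (hfg : IsWeightPair K J f g)
    {F : (Fin k → ℝ) → ℝ} (hF : IsSieveFunction F) {p₁ p₂ : ℕ}
    (h1 : p₁ = 1 ∨ p₁ ∈ sievePrimes θ N) (h2 : p₂ = 1 ∨ p₂ ∈ sievePrimes θ N) (m : Fin k)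
    {e : ℕ} (he : ∀ p : sievePrimes θ N, |coordWeight J f g m p| ≤ (1 + |K|) / ((p : ℕ) : ℝ) ^ e) :
    |S θ N F f g J p₁ p₂ m| ≤ Fmax F ^ 2 * Real.exp 1 ^ 2 *
      (flagConst k K ^ 2 / (Nat.lcm p₁ p₂ : ℝ) ^ e *
        (laplace ⌊D0 N⌋₊ (1 / Real.log (R θ N)) ^ (k + J.card) *
          Real.exp (closeConst k |K|))) := by
  have hc0 : 0 ≤ closeConst k |K| := by
    have := abs_nonneg K
    rw [closeConst]
    positivity
  have hfac : ∀ p : sievePrimes θ N, 0 ≤ 1 / (((p : ℕ) : ℝ) - 1) * damp θ N p := fun p =>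
    mul_nonneg (localBounds hfg p).inv_bounds.1.le (damp_nonneg _)
  rw [S_eq_sum_prod hR hfg hF.supported h1 h2 m]
  refine (abs_quadratic_prod_le hF _).trans ?_
  refine mul_le_mul_of_nonneg_left ?_ (by positivity)
  have key : ∀ p : sievePrimes θ N, ∑ A, ∑ B, |localWeight (fun i => coordWeight J f g i p) p
      (DivCond p₁ p₂ m p) A B| * (damp θ N p ^ A.card * damp θ N p ^ B.card) ≤
      (if (p : ℕ) = p₁ ∨ (p : ℕ) = p₂ then flagConst k K / ((p : ℕ) : ℝ) ^ e else 1) *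
      ((1 + 1 / (((p : ℕ) : ℝ) - 1) * damp θ N p) ^ (k + J.card) *
        (1 + closeConst k |K| * (1 / ((p : ℕ) : ℝ) ^ 2))) := by
    intro p
    have H := localBounds hfg p
    split_ifs with hp
    · have hfl := H.sum_flagged_le (V := DivCond p₁ p₂ m p) (m := m) (fun C E hV => by
        rcases hp with hp | hp
        · exact Finset.mem_union_left _ (hV.1 hp)
        · exact Finset.mem_union_right _ (hV.2 hp)) (damp_nonneg (θ := θ) (N := N) p)
        (damp_le_one hR p)
      refine hfl.trans ?_
      -- The generic local bound is at least 1, so it may be kept at flagged primes too and the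
      -- product over all primes left intact.
      have hone : 1 ≤ (1 + 1 / (((p : ℕ) : ℝ) - 1) * damp θ N p) ^ (k + J.card) *
          (1 + closeConst k |K| * (1 / ((p : ℕ) : ℝ) ^ 2)) :=
        one_le_mul_of_one_le_of_one_le (one_le_pow₀ (le_add_of_nonneg_right (hfac p)))
          (le_add_of_nonneg_right (by positivity))
      refine le_trans ?_ (le_mul_of_one_le_right ?_ hone)
      · rw [flagConst, mul_div_assoc]
        exact mul_le_mul_of_nonneg_left (he p) (by positivity)
      · have := one_le_flagConst k K
        positivity
    · rw [one_mul]
      rw [not_or] at hp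
      exact H.sum_localWeight_le (fun C E => ⟨fun h => absurd h hp.1, fun h => absurd h hp.2⟩)
        (damp_nonneg _) (damp_le_one hR p)
  refine (Finset.prod_le_prod (fun p _ => Finset.sum_nonneg fun A _ => Finset.sum_nonneg
    fun B _ => ?_) fun p _ => key p).trans ?_
  · have := damp_nonneg (θ := θ) (N := N) p
    positivity
  rw [Finset.prod_mul_distrib, Finset.prod_mul_distrib, Finset.prod_pow]
  have hZ := prod_damp_le_laplace hR
  have hZ0 : 0 ≤ ∏ p : sievePrimes θ N, (1 + 1 / (((p : ℕ) : ℝ) - 1) * damp θ N p) :=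
    Finset.prod_nonneg fun p _ => by linarith [hfac p]
  have hflag := prod_flag_le h1 h2 (one_le_flagConst k K) e
  have hexp : ∏ p : sievePrimes θ N, (1 + closeConst k |K| * (1 / ((p : ℕ) : ℝ) ^ 2)) ≤
      Real.exp (closeConst k |K|) := by
    refine (prod_one_add_le_exp _ _ fun p _ => by positivity).trans ?_
    rw [Real.exp_le_exp, ← Finset.mul_sum]
    refine mul_le_of_le_one_right hc0 ((sum_inv_sq_sievePrimes_le hD).trans ?_)
    have : (1 : ℝ) ≤ ⌊D0 N⌋₊ := by exact_mod_cast Nat.pos_of_ne_zero hD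
    rw [div_le_one (by linarith)]
    exact this
  have hfC := one_le_flagConst k K
  refine mul_le_mul hflag (mul_le_mul (pow_le_pow_left₀ hZ0 hZ _) hexp ?_ ?_) ?_ (by positivity)
  · exact Finset.prod_nonneg fun p _ => by positivity
  · exact pow_nonneg (hZ0.trans hZ) _
  · exact mul_nonneg (pow_nonneg hZ0 _) (Finset.prod_nonneg fun p _ => by positivity)

section

open MeasureTheory BoundedContinuousFunction

/-! ### The main term -/

lemma B_nonneg (θ : ℝ) (N : ℕ) : 0 ≤ B θ N := by
  rw [B_eq]
  have := A_pos
  have := Real.pi_pos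
  have := density_pos ⌊D0 N⌋₊
  positivity

lemma prod_wt_mul_exp (D : ℕ) (ε : ℝ) (s : Finset ℕ) :
    (∏ p ∈ s, wt D p) * Real.exp (-(ε * ∑ p ∈ s, Real.log p)) =
      ∏ p ∈ s, wt D p * (p : ℝ) ^ (-ε) := by
  rw [Finset.mul_sum, ← Finset.sum_neg_distrib, Real.exp_sum, ← Finset.prod_mul_distrib]
  refine Finset.prod_congr rfl fun p _ => ?_
  rcases Nat.eq_zero_or_pos p with rfl | hp
  · simp [wt, Nat.not_prime_zero]
  · rw [Real.rpow_def_of_pos (Nat.cast_pos.2 hp)]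
    congr 2
    ring

/-- Karamata's hypotheses for point masses 1/(B φ(n)) at log n / log R. They are indexed by all
finite sets of naturals, sets with an unwanted element having mass zero. -/
lemma laplaceConverges {θ : ℝ} (hθ : 0 < θ) :
    LaplaceConverges (fun N (s : Finset ℕ) => (∏ p ∈ s, wt ⌊D0 N⌋₊ p) / B θ N)
      (fun N s => (∑ p ∈ s, Real.log p) / Real.log (R θ N)) := by
  have key : ∀ (m : ℝ) (N : ℕ) (s : Finset ℕ), (∏ p ∈ s, wt ⌊D0 N⌋₊ p) / B θ N *
      Real.exp (-(m * ((∑ p ∈ s, Real.log p) / Real.log (R θ N)))) =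
      (∏ p ∈ s, wt ⌊D0 N⌋₊ p * (p : ℝ) ^ (-(m / Real.log (R θ N)))) / B θ N := fun m N s => by
    rw [← prod_wt_mul_exp, div_mul_eq_mul_div]
    congr 4
    ring
  refine ⟨fun N s => div_nonneg (Finset.prod_nonneg fun p _ => wt_nonneg _ p) (B_nonneg θ N),
    ?_, ?_, fun m hm => ?_⟩
  · filter_upwards [(tendsto_log_R hθ).eventually_gt_atTop 0] with N hN s
    exact div_nonneg (Finset.sum_nonneg fun p _ => Real.log_natCast_nonneg p) hN.le
  · filter_upwards [(tendsto_log_R hθ).eventually_gt_atTop 0] with N hN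
    have h1 := (summable_laplace ⌊D0 N⌋₊ (one_div_pos.2 hN)).div_const (B θ N)
    refine h1.congr fun s => ?_
    rw [← key, one_mul]
  · refine (tendsto_laplace hθ (Nat.cast_pos.2 hm)).congr fun N => ?_
    rw [laplace, ← tsum_div_const]
    exact tsum_congr fun s => (key m N s).symm

/-- The mass `1 / φ(n)` of the squarefree number `n` with the given prime factors. -/
def mass {P : Finset ℕ} (s : Finset P) : ℝ := ∏ p ∈ s, 1 / (((p : ℕ) : ℝ) - 1)

lemma mass_nonneg {θ : ℝ} {N : ℕ} (s : Finset (sievePrimes θ N)) : 0 ≤ mass s :=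
  Finset.prod_nonneg fun p _ => one_div_nonneg.2 (by linarith [three_le_of_mem p])

lemma pos_eq {θ : ℝ} {N : ℕ} (s : Finset (sievePrimes θ N)) :
    pos θ N s = (∑ p ∈ s, Real.log ((p : ℕ) : ℝ)) / Real.log (R θ N) := by
  rw [pos, num, Nat.cast_prod, Real.log_prod (s := s) (f := fun p : sievePrimes θ N => ((p : ℕ) : ℝ))
    fun p _ => Nat.cast_ne_zero.2 (sievePrimes_prime p p.2).ne_zero]

lemma pos_nonneg {θ : ℝ} {N : ℕ} (hR : 0 < Real.log (R θ N)) (s : Finset (sievePrimes θ N)) :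
    0 ≤ pos θ N s :=
  div_nonneg (Real.log_natCast_nonneg _) hR.le

/-- The restriction to `[0, 1]` of the normalised measure `∑ n, δ_{log n / log R} / φ(n)`. -/
def cutMass (θ : ℝ) (N : ℕ) (s : Finset (sievePrimes θ N)) : ℝ :=
  if pos θ N s ≤ 1 then mass s / B θ N else 0

lemma cutMass_nonneg {θ : ℝ} {N : ℕ} (s : Finset (sievePrimes θ N)) : 0 ≤ cutMass θ N s := by
  rw [cutMass]
  split_ifs
  · exact div_nonneg (mass_nonneg s) (B_nonneg θ N)
  · exact le_rfl

/-- A set of nonzero mass consists of primes p ≡ 3 mod 4 beyond D₀, and position at most 1 forces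
each of them to be at most R. So the infinite sum is one over sets of sieve primes. -/
lemma tendsto_cutMass {θ : ℝ} (hθ : 0 < θ) {h : ℝ → ℝ} (hh : Continuous h) :
    Tendsto (fun N => ∑ s, cutMass θ N s * h (pos θ N s)) atTop
      (𝓝 (∫ t in Set.Icc (0 : ℝ) 1, h t * (√t)⁻¹)) := by
  refine ((laplaceConverges hθ).tendsto_cut hh).congr' ?_
  filter_upwards [(tendsto_log_R hθ).eventually_gt_atTop 0] with N hN
  have hinj : Function.Injective fun s : Finset (sievePrimes θ N) =>
      s.map (Function.Embedding.subtype _) := Finset.map_injective _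
  rw [← hinj.tsum_eq, tsum_fintype]
  · refine Finset.sum_congr rfl fun s _ => ?_
    simp only [Finset.prod_map, Finset.sum_map, Function.Embedding.subtype_apply]
    have h1 : ∏ p ∈ s, wt ⌊D0 N⌋₊ (p : ℕ) = mass s :=
      Finset.prod_congr rfl fun p _ => if_pos (Finset.mem_filter.1 p.2).2
    rw [← pos_eq, cutMass, h1]
    split_ifs <;> ring
  · intro s hs
    have h1 := left_ne_zero_of_mul hs
    have h2 := (ite_ne_right_iff.1 (right_ne_zero_of_mul hs)).1
    have h3 := Finset.prod_ne_zero_iff.1 (div_ne_zero_iff.1 h1).1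
    refine ⟨s.subtype (· ∈ sievePrimes θ N), Finset.subtype_map_of_mem fun p hp => ?_⟩
    have h4 := (ite_ne_right_iff.1 (h3 p hp)).1
    refine Finset.mem_filter.2 ⟨Finset.mem_Icc.2 ⟨h4.1.one_le, Nat.le_floor ?_⟩, h4⟩
    rw [div_le_one hN] at h2
    have h5 := (Finset.single_le_sum (f := fun p : ℕ => Real.log p)
      (fun q _ => Real.log_natCast_nonneg q) hp).trans h2
    have hRpos : 0 < R θ N := by
      refine (Real.rpow_nonneg (Nat.cast_nonneg N) _).lt_of_ne fun h0 => ?_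
      rw [R, ← h0, Real.log_zero] at hN
      exact lt_irrefl _ hN
    exact (Real.log_le_log_iff (Nat.cast_pos.2 h4.1.pos) hRpos).1 h5

/-- Agreement off `J` at every prime means a_i = b_i there; an entry b_i with i ∉ J then adds no
further mass. -/
lemma prod_modelWeight {k : ℕ} {P : Finset ℕ} (J : Finset (Fin k)) (a b : Fin k → Finset P) :
    ∏ p : P, modelWeight J (p : ℕ) (slice a p) (slice b p) =
      if ∀ i, i ∉ J → a i = b i then (∏ i, mass (a i)) * ∏ j ∈ J, mass (b j) else 0 := by
  split_ifs with hab
  · have h1 : ∏ j ∈ J, mass (b j) =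
        ∏ p : P, ∏ _j ∈ slice b p ∩ J, 1 / (((p : ℕ) : ℝ) - 1) :=
      Finset.prod_comm' fun i p => by simp [mem_slice, and_comm]
    have h2 : ∏ i, mass (a i) = ∏ p : P, ∏ _i ∈ slice a p, 1 / (((p : ℕ) : ℝ) - 1) :=
      prod_slice a fun _ p => 1 / (((p : ℕ) : ℝ) - 1)
    rw [h1, h2, ← Finset.prod_mul_distrib]
    refine Finset.prod_congr rfl fun p _ => ?_
    rw [modelWeight, if_pos fun i hi => by rw [mem_slice, mem_slice, hab i hi],
      Finset.prod_const, Finset.prod_const]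
  · push Not at hab
    obtain ⟨i, hi, hne⟩ := hab
    obtain ⟨p, hp⟩ : ∃ p, ¬ (p ∈ a i ↔ p ∈ b i) := by
      by_contra hcon
      push Not at hcon
      exact hne (Finset.ext hcon)
    refine Finset.prod_eq_zero (Finset.mem_univ p) (if_neg fun hc => hp ?_)
    rw [← mem_slice, ← mem_slice]
    exact hc i hi

lemma prod_mass_idx {k : ℕ} {P : Finset ℕ} (J : Finset (Fin k)) (z : Idx J → Finset P) :
    ∏ l, mass (z l) = (∏ i, mass (z (idxFst J i))) * ∏ j ∈ J, mass (z (idxSnd J j)) := by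
  rw [Fintype.prod_sum_type, Fintype.prod_sum_type,
    ← Fintype.prod_subtype_mul_prod_subtype (· ∈ J) fun i => mass (z (idxFst J i)),
    ← Finset.prod_coe_sort J fun j => mass (z (idxSnd J j))]
  have h1 : ∀ j : {j // j ∈ J}, idxFst J j = .inr (.inl j) := fun j => by simp [idxFst]
  have h2 : ∀ j : {j // j ∈ J}, idxSnd J j = .inr (.inr j) := fun j => by simp [idxSnd]
  have h3 : ∀ i : {i // i ∉ J}, idxFst J i = .inl i := fun i => by simp [idxFst, i.2]
  simp only [h1, h2, h3]
  rw [← mul_assoc, mul_comm (∏ i : {i // i ∉ J}, mass (z (.inl i)))]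
  congr!

/-- The quadratic form with the main parts of the local factors, in terms of independent
variables. -/
lemma sum_modelWeight_eq {k : ℕ} {P : Finset ℕ} (J : Finset (Fin k))
    (Φ : (Fin k → Finset P) → (Fin k → Finset P) → ℝ) :
    ∑ a, ∑ b, Φ a b * ∏ p : P, modelWeight J (p : ℕ) (slice a p) (slice b p) =
      ∑ z : Idx J → Finset P,
        (∏ l, mass (z l)) * Φ (fun i => z (idxFst J i)) (fun i => z (idxSnd J i)) := by
  classical
  simp only [prod_modelWeight, mul_ite, mul_zero]
  rw [← Fintype.sum_prod_type' (f := fun a b => if ∀ i, i ∉ J → a i = b i then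
    Φ a b * ((∏ i, mass (a i)) * ∏ j ∈ J, mass (b j)) else 0), ← Finset.sum_filter]
  symm
  refine Finset.sum_bij' (fun z _ => (fun i => z (idxFst J i), fun i => z (idxSnd J i)))
    (fun ab _ => Sum.elim (fun i => ab.1 i) (Sum.elim (fun j => ab.1 j) fun j => ab.2 j))
    (fun z _ => ?_) (fun _ _ => Finset.mem_univ _) (fun z _ => ?_) (fun ab hab => ?_)
    fun z _ => ?_
  · refine Finset.mem_filter.2 ⟨Finset.mem_univ _, fun i hi => ?_⟩
    simp [idxFst, idxSnd, hi]
  · funext l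
    rcases l with i | j | j
    · simp [idxFst, i.2]
    · simp [idxFst]
    · simp [idxSnd]
  · have hab := (Finset.mem_filter.1 hab).2
    refine Prod.ext (funext fun i => ?_) (funext fun i => ?_)
    · by_cases hi : i ∈ J <;> simp [idxFst, hi]
    · by_cases hi : i ∈ J
      · simp [idxSnd, hi]
      · simpa [idxSnd, hi] using hab i hi
  · rw [prod_mass_idx, mul_comm]

/-- The main term of the sieve sum. -/
def mainTerm {k : ℕ} (θ : ℝ) (N : ℕ) (J : Finset (Fin k)) (F : (Fin k → ℝ) → ℝ) : ℝ :=
  ∑ a : Fin k → Finset (sievePrimes θ N), ∑ b : Fin k → Finset (sievePrimes θ N),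
    F (fun i => pos θ N (a i)) * F (fun i => pos θ N (b i)) *
      ∏ p : sievePrimes θ N, modelWeight J (p : ℕ) (slice a p) (slice b p)

lemma card_Idx {k : ℕ} (J : Finset (Fin k)) : Fintype.card (Idx J) = k + J.card := by
  have := Fintype.card_subtype_compl (· ∈ J)
  have h2 := Finset.card_le_univ J
  simp only [Fintype.card_fin, Fintype.card_coe] at *
  rw [Fintype.card_sum, Fintype.card_sum, this, Fintype.card_coe]
  omega

/-- The main term is the discrete analogue of L_J: one factor 1/B is absorbed by each of the k + |J|
independent variables. -/
lemma tendsto_mainTerm {k : ℕ} {θ : ℝ} (hθ : 0 < θ) (J : Finset (Fin k)) {F : (Fin k → ℝ) → ℝ}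
    (hF : IsSieveFunction F) :
    Tendsto (fun N => mainTerm θ N J F / B θ N ^ (k + J.card)) atTop (𝓝 (L J F)) := by
  refine (tendsto_quadratic J hF.smooth.continuousOn (cutMass θ) (pos θ)
    (Eventually.of_forall fun N => cutMass_nonneg)
    fun h => tendsto_cutMass hθ h.continuous).congr' ?_
  filter_upwards [(tendsto_log_R hθ).eventually_gt_atTop 0] with N hN
  rw [mainTerm, sum_modelWeight_eq J fun a b => F (fun i => pos θ N (a i)) *
    F (fun i => pos θ N (b i)), Finset.sum_div]
  refine Finset.sum_congr rfl fun z _ => ?_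
  by_cases hz : ∀ l, pos θ N (z l) ≤ 1
  · have h1 : ∀ w : Fin k → Idx J, (clamp fun i => pos θ N (z (w i))) = fun i => pos θ N (z (w i)) :=
      fun w => clamp_eq ⟨fun i => pos_nonneg hN _, fun i => hz _⟩
    have h2 : ∏ l, cutMass θ N (z l) = ∏ l, mass (z l) / B θ N :=
      Finset.prod_congr rfl fun l _ => if_pos (hz l)
    rw [h1, h1, h2, Finset.prod_div_distrib,
      Finset.prod_const, Finset.card_univ, card_Idx, div_mul_eq_mul_div]
  -- If some variable lies beyond 1, the cut mass is zero. So is the product of the two values of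
  -- `F`, since each index occurs in at least one of the two copies.
  · push Not at hz
    obtain ⟨l, hl⟩ := hz
    have h0 : ∀ (w : Fin k → Idx J) (i : Fin k), w i = l → F (fun i => pos θ N (z (w i))) = 0 :=
      fun w i hw => hF.supported _ fun hs => by
        have := hs.1.2 i
        simp only [hw, Pi.one_apply] at this
        linarith
    have h1 : F (fun i => pos θ N (z (idxFst J i))) * F (fun i => pos θ N (z (idxSnd J i))) = 0 := by
      rcases l with i | j | j
      · rw [h0 (idxFst J) i (by simp [idxFst, i.2]), zero_mul]
      · rw [h0 (idxFst J) j (by simp [idxFst]), zero_mul]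
      · rw [h0 (idxSnd J) j (by simp [idxSnd]), mul_zero]
    rw [h1, mul_zero, zero_div, Finset.prod_eq_zero (Finset.mem_univ l) (if_neg (not_le.2 hl)),
      zero_mul]

/-! ### The error term and the final bounds -/

lemma closeConst_nonneg (k : ℕ) (K : ℝ) : 0 ≤ closeConst k |K| := by
  have := abs_nonneg K
  rw [closeConst]
  positivity

/-- The sieve sum is close to its main term. -/
theorem abs_S_sub_mainTerm_le {k : ℕ} {θ : ℝ} {N : ℕ} (hR : 0 < Real.log (R θ N))
    (hD : ⌊D0 N⌋₊ ≠ 0) {J : Finset (Fin k)} {K : ℝ} {f g : ArithmeticFunction ℝ}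
    (hfg : IsWeightPair K J f g) {F : (Fin k → ℝ) → ℝ} (hF : IsSieveFunction F) (m : Fin k) :
    |S θ N F f g J 1 1 m - mainTerm θ N J F| ≤ Fmax F ^ 2 * Real.exp 1 ^ 2 *
      (laplace ⌊D0 N⌋₊ (1 / Real.log (R θ N)) ^ (k + J.card) *
        (Real.exp (closeConst k |K| * (1 / (⌊D0 N⌋₊ : ℝ))) - 1)) := by
  have hc0 := closeConst_nonneg k K
  rw [S_eq_sum_prod hR hfg hF.supported (.inl rfl) (.inl rfl) m, mainTerm]
  refine (abs_quadratic_sub_le hF _ _).trans ?_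
  refine mul_le_mul_of_nonneg_left ?_ (by positivity)
  set V : sievePrimes θ N → ℝ := fun p => ∑ A, ∑ B, |modelWeight J ((p : ℕ) : ℝ) A B| *
    (damp θ N p ^ A.card * damp θ N p ^ B.card) with hV
  set Δ : sievePrimes θ N → ℝ := fun p => ∑ A, ∑ B,
    |localWeight (fun i => coordWeight J f g i p) p (DivCond 1 1 m p) A B -
      modelWeight J ((p : ℕ) : ℝ) A B| * (damp θ N p ^ A.card * damp θ N p ^ B.card) with hΔ
  have hd0 : ∀ p : sievePrimes θ N, 0 ≤ damp θ N p := fun p => damp_nonneg _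
  have hV1 : ∀ p, 1 ≤ V p := fun p => by
    have h1 : ∀ A B, 0 ≤ |modelWeight J ((p : ℕ) : ℝ) A B| *
        (damp θ N p ^ A.card * damp θ N p ^ B.card) := fun A B => by
      have := hd0 p
      positivity
    calc (1 : ℝ) = |modelWeight J ((p : ℕ) : ℝ) ∅ ∅| * (damp θ N p ^ (∅ : Finset (Fin k)).card *
          damp θ N p ^ (∅ : Finset (Fin k)).card) := by simp [modelWeight]
      _ ≤ ∑ B, |modelWeight J ((p : ℕ) : ℝ) ∅ B| * (damp θ N p ^ (∅ : Finset (Fin k)).card *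
          damp θ N p ^ B.card) := Finset.single_le_sum (f := fun B : Finset (Fin k) =>
            |modelWeight J ((p : ℕ) : ℝ) ∅ B| * (damp θ N p ^ (∅ : Finset (Fin k)).card *
              damp θ N p ^ B.card)) (fun B _ => h1 ∅ B) (Finset.mem_univ ∅)
      _ ≤ V p := Finset.single_le_sum (f := fun A : Finset (Fin k) =>
            ∑ B, |modelWeight J ((p : ℕ) : ℝ) A B| * (damp θ N p ^ A.card *
              damp θ N p ^ B.card)) (fun A _ => Finset.sum_nonneg fun B _ => h1 A B)
              (Finset.mem_univ ∅)
  have hV2 : ∀ p : sievePrimes θ N,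
      V p ≤ (1 + 1 / (((p : ℕ) : ℝ) - 1) * damp θ N p) ^ (k + J.card) := fun p => by
    have H := localBounds hfg p
    simp only [hV, abs_of_nonneg (H.modelWeight_nonneg _ _)]
    exact H.sum_modelWeight_le (hd0 p) (damp_le_one hR p)
  have hΔ0 : ∀ p, 0 ≤ Δ p := fun p => Finset.sum_nonneg fun A _ => Finset.sum_nonneg fun B _ => by
    have := hd0 p
    positivity
  have hΔ1 : ∀ p : sievePrimes θ N, Δ p ≤ closeConst k |K| * (1 / ((p : ℕ) : ℝ) ^ 2) := fun p => by
    have hp := (sievePrimes_prime p p.2).ne_one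
    rw [mul_one_div]
    exact (localBounds hfg p).sum_close (V := DivCond 1 1 m p)
      (fun C E => ⟨fun h => absurd h hp, fun h => absurd h hp⟩) (hd0 p) (damp_le_one hR p)
  have hV0 : 0 ≤ ∏ p, V p := Finset.prod_nonneg fun p _ => zero_le_one.trans (hV1 p)
  -- As V p ≥ 1, the local error is also a relative error, and the total error is the product of the
  -- V p times exp(O(1/D₀)) - 1.
  have h1 : ∏ p, (V p + Δ p) ≤ (∏ p, V p) * ∏ p, (1 + Δ p) := by
    rw [← Finset.prod_mul_distrib]
    refine Finset.prod_le_prod (fun p _ => add_nonneg (zero_le_one.trans (hV1 p)) (hΔ0 p))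
      fun p _ => ?_
    nlinarith [mul_le_mul_of_nonneg_right (hV1 p) (hΔ0 p)]
  have h2 : ∏ p, (1 + Δ p) ≤ Real.exp (closeConst k |K| * (1 / (⌊D0 N⌋₊ : ℝ))) := by
    refine (prod_one_add_le_exp _ _ fun p _ => hΔ0 p).trans (Real.exp_le_exp.2 ?_)
    refine (Finset.sum_le_sum fun p _ => hΔ1 p).trans ?_
    rw [← Finset.mul_sum]
    exact mul_le_mul_of_nonneg_left (sum_inv_sq_sievePrimes_le hD) hc0
  have h3 : ∏ p, V p ≤ laplace ⌊D0 N⌋₊ (1 / Real.log (R θ N)) ^ (k + J.card) := by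
    refine (Finset.prod_le_prod (fun p _ => zero_le_one.trans (hV1 p)) fun p _ => hV2 p).trans ?_
    rw [Finset.prod_pow]
    refine pow_le_pow_left₀ (Finset.prod_nonneg fun p _ => ?_) (prod_damp_le_laplace hR) _
    have := mul_nonneg (localBounds hfg p).inv_bounds.1.le (hd0 p)
    linarith
  have h4 : 0 ≤ Real.exp (closeConst k |K| * (1 / (⌊D0 N⌋₊ : ℝ))) - 1 :=
    sub_nonneg.2 (Real.one_le_exp (by positivity))
  calc _ ≤ (∏ p, V p) * Real.exp (closeConst k |K| * (1 / (⌊D0 N⌋₊ : ℝ))) - ∏ p, V p :=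
        sub_le_sub_right (h1.trans (mul_le_mul_of_nonneg_left h2 hV0)) _
    _ = (∏ p, V p) * (Real.exp (closeConst k |K| * (1 / (⌊D0 N⌋₊ : ℝ))) - 1) := by ring
    _ ≤ _ := mul_le_mul_of_nonneg_right h3 h4

/-- The limit of the ratio at c = 1 is √π, which is less than 2. -/
lemma eventually_laplace_le {θ : ℝ} (hθ : 0 < θ) :
    ∀ᶠ N : ℕ in atTop, laplace ⌊D0 N⌋₊ (1 / Real.log (R θ N)) ≤ 2 * B θ N := by
  have hlt : √Real.pi / √1 < 2 := by
    rw [Real.sqrt_one, div_one, Real.sqrt_lt' two_pos]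
    linarith [Real.pi_lt_d2]
  filter_upwards [(tendsto_laplace hθ one_pos).eventually_lt_const hlt, eventually_B_pos hθ]
    with N h1 h2
  exact ((div_lt_iff₀ h2).1 h1).le

lemma laplace_nonneg (D : ℕ) (ε : ℝ) : 0 ≤ laplace D ε :=
  tsum_nonneg fun _ => Finset.prod_nonneg fun p _ => wt_rpow_nonneg D p ε

/-- After division by B^(k + |J|) the distance to the main term is a constant times exp(O(1/D₀)) -
1, which tends to 0 because D₀ → ∞. -/
theorem tendsto_S_div {k : ℕ} {θ : ℝ} (hθ : 0 < θ) {J : Finset (Fin k)} {K : ℝ}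
    {f g : ArithmeticFunction ℝ} (hfg : IsWeightPair K J f g) {F : (Fin k → ℝ) → ℝ}
    (hF : IsSieveFunction F) (m : Fin k) :
    Tendsto (fun N => S θ N F f g J 1 1 m / B θ N ^ (k + J.card)) atTop (𝓝 (L J F)) := by
  have h0 : Tendsto (fun N : ℕ => Fmax F ^ 2 * Real.exp 1 ^ 2 * (2 ^ (k + J.card) *
      (Real.exp (closeConst k |K| * (1 / (⌊D0 N⌋₊ : ℝ))) - 1))) atTop (𝓝 0) := by
    have h1 : Tendsto (fun N : ℕ => 1 / (⌊D0 N⌋₊ : ℝ)) atTop (𝓝 0) :=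
      (tendsto_natCast_atTop_atTop.comp tendsto_floor_D0).const_div_atTop 1
    have h2 := (Real.continuous_exp.tendsto _).comp (h1.const_mul (closeConst k |K|))
    have h3 := ((h2.sub_const 1).const_mul (2 ^ (k + J.card))).const_mul
      (Fmax F ^ 2 * Real.exp 1 ^ 2)
    simpa using h3
  have h1 : Tendsto (fun N => (S θ N F f g J 1 1 m - mainTerm θ N J F) / B θ N ^ (k + J.card))
      atTop (𝓝 0) := by
    refine squeeze_zero_norm' ?_ h0
    filter_upwards [(tendsto_log_R hθ).eventually_gt_atTop 0, tendsto_floor_D0.eventually_ne_atTop 0,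
      eventually_B_pos hθ, eventually_laplace_le hθ] with N hR hD hB hl
    have hB' : 0 < B θ N ^ (k + J.card) := by positivity
    rw [Real.norm_eq_abs, abs_div, abs_of_pos hB', div_le_iff₀ hB']
    refine (abs_S_sub_mainTerm_le hR hD hfg hF m).trans ?_
    have h4 : 0 ≤ Real.exp (closeConst k |K| * (1 / (⌊D0 N⌋₊ : ℝ))) - 1 :=
      sub_nonneg.2 (Real.one_le_exp (mul_nonneg (closeConst_nonneg k K) (by positivity)))
    have h5 := pow_le_pow_left₀ (laplace_nonneg _ _) hl (k + J.card)
    rw [mul_pow] at h5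
    calc _ ≤ Fmax F ^ 2 * Real.exp 1 ^ 2 * (2 ^ (k + J.card) * B θ N ^ (k + J.card) *
          (Real.exp (closeConst k |K| * (1 / (⌊D0 N⌋₊ : ℝ))) - 1)) := by gcongr
      _ = _ := by ring
  have h2 := (tendsto_mainTerm hθ J hF).add h1
  rw [add_zero] at h2
  refine h2.congr fun N => ?_
  ring

/-- The constant of the upper bounds. -/
def upperConst {k : ℕ} (J : Finset (Fin k)) (K : ℝ) : ℝ :=
  Real.exp 1 ^ 2 * (flagConst k K ^ 2 * (2 ^ (k + J.card) * Real.exp (closeConst k |K|)))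

/-- The exponent e records the decay of the weight at coordinate m: 2 on `J` and 1 off it. The
factor (log log R)² is at least 1 and only enlarges the bound. -/
lemma abs_S_le_B {k : ℕ} {θ : ℝ} {N : ℕ} (hR : 0 < Real.log (R θ N)) (hD : ⌊D0 N⌋₊ ≠ 0)
    (hl : laplace ⌊D0 N⌋₊ (1 / Real.log (R θ N)) ≤ 2 * B θ N)
    (hll : 1 ≤ Real.log (Real.log (R θ N)))
    {J : Finset (Fin k)} {K : ℝ} {f g : ArithmeticFunction ℝ} (hfg : IsWeightPair K J f g)
    {F : (Fin k → ℝ) → ℝ} (hF : IsSieveFunction F) {p₁ p₂ : ℕ}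
    (h1 : p₁ = 1 ∨ p₁.Prime) (h2 : p₂ = 1 ∨ p₂.Prime) (m : Fin k)
    {e : ℕ} (he : ∀ p : sievePrimes θ N, |coordWeight J f g m p| ≤ (1 + |K|) / ((p : ℕ) : ℝ) ^ e) :
    |S θ N F f g J p₁ p₂ m| ≤ upperConst J K * (Fmax F ^ 2 * B θ N ^ (k + J.card) *
      Real.log (Real.log (R θ N)) ^ 2 / (Nat.lcm p₁ p₂ : ℝ) ^ e) := by
  have hB := B_nonneg θ N
  have hfl := one_le_flagConst k K
  have hrhs : 0 ≤ upperConst J K * (Fmax F ^ 2 * B θ N ^ (k + J.card) *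
      Real.log (Real.log (R θ N)) ^ 2 / (Nat.lcm p₁ p₂ : ℝ) ^ e) := by
    rw [upperConst]
    positivity
  by_cases hz : (p₁.Prime ∧ p₁ ∉ sievePrimes θ N) ∨ (p₂.Prime ∧ p₂ ∉ sievePrimes θ N)
  · rwa [S_eq_zero m hz, abs_zero]
  have h1' : p₁ = 1 ∨ p₁ ∈ sievePrimes θ N := by tauto
  have h2' : p₂ = 1 ∨ p₂ ∈ sievePrimes θ N := by tauto
  refine (abs_S_le hR hD hfg hF h1' h2' m he).trans ?_
  have h3 := pow_le_pow_left₀ (laplace_nonneg _ _) hl (k + J.card)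
  rw [mul_pow] at h3
  have h4 : (1 : ℝ) ≤ Real.log (Real.log (R θ N)) ^ 2 := one_le_pow₀ hll
  calc _ ≤ Fmax F ^ 2 * Real.exp 1 ^ 2 * (flagConst k K ^ 2 / (Nat.lcm p₁ p₂ : ℝ) ^ e *
        (2 ^ (k + J.card) * B θ N ^ (k + J.card) * Real.exp (closeConst k |K|))) * 1 := by
        rw [mul_one]
        gcongr
    _ ≤ Fmax F ^ 2 * Real.exp 1 ^ 2 * (flagConst k K ^ 2 / (Nat.lcm p₁ p₂ : ℝ) ^ e *
        (2 ^ (k + J.card) * B θ N ^ (k + J.card) * Real.exp (closeConst k |K|))) *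
        Real.log (Real.log (R θ N)) ^ 2 := by gcongr
    _ = _ := by
        rw [upperConst]
        ring

end

end HalfSieve

end

theorem mainTheorem6 (k : ℕ) (J : Finset (Fin k)) (hJ : J.card ≤ 2) (K : ℝ) :
    (∃ C : ℝ, ∀ θ : ℝ, 0 < θ → θ < 1 / 18 → ∃ N₀ : ℕ, ∀ N : ℕ, N₀ ≤ N →
      ∀ f g : ArithmeticFunction ℝ, HalfSieve.IsWeightPair K J f g →
      ∀ F : (Fin k → ℝ) → ℝ, HalfSieve.IsSieveFunction F →
      ∀ (m : Fin k) (p₁ p₂ : ℕ), (p₁ = 1 ∨ p₁.Prime) → (p₂ = 1 ∨ p₂.Prime) →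
        (m ∈ J → |HalfSieve.S θ N F f g J p₁ p₂ m| ≤
          C * (HalfSieve.Fmax F ^ 2 * HalfSieve.B θ N ^ (k + J.card) *
            Real.log (Real.log (HalfSieve.R θ N)) ^ 2 / (Nat.lcm p₁ p₂ : ℝ) ^ 2)) ∧
        (m ∉ J → |HalfSieve.S θ N F f g J p₁ p₂ m| ≤
          C * (HalfSieve.Fmax F ^ 2 * HalfSieve.B θ N ^ (k + J.card) *
            Real.log (Real.log (HalfSieve.R θ N)) ^ 2 / (Nat.lcm p₁ p₂ : ℝ)))) ∧
    (∀ θ : ℝ, 0 < θ → θ < 1 / 18 →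
      ∀ f g : ArithmeticFunction ℝ, HalfSieve.IsWeightPair K J f g →
      ∀ F : (Fin k → ℝ) → ℝ, HalfSieve.IsSieveFunction F → HalfSieve.L J F ≠ 0 →
      ∀ m : Fin k, ∃ ε : ℕ → ℝ, Filter.Tendsto ε Filter.atTop (nhds 0) ∧
        ∀ᶠ N : ℕ in Filter.atTop, HalfSieve.S θ N F f g J 1 1 m =
          (1 + ε N) * HalfSieve.B θ N ^ (k + J.card) * HalfSieve.L J F) := by
  refine ⟨⟨HalfSieve.upperConst J K, fun θ hθ _ => ?_⟩, fun θ hθ _ f g hfg F hF hL m => ?_⟩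
  -- The four eventual conditions involve only θ and N, whence the uniformity in f, g, F, m, p₁ and
  -- p₂.
  · refine Filter.eventually_atTop.1 ?_
    have hlog := HalfSieve.tendsto_log_R hθ
    filter_upwards [hlog.eventually_gt_atTop 0, HalfSieve.tendsto_floor_D0.eventually_ne_atTop 0,
      HalfSieve.eventually_laplace_le hθ,
      (Real.tendsto_log_atTop.comp hlog).eventually_ge_atTop 1]
      with N hR hD hl hll f g hfg F hF m p₁ p₂ h1 h2
    refine ⟨fun hm => ?_, fun hm => ?_⟩
    · refine HalfSieve.abs_S_le_B hR hD hl hll hfg hF h1 h2 m fun p => ?_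
      exact (HalfSieve.localBounds hfg p).inside_le hm
    · have h := HalfSieve.abs_S_le_B hR hD hl hll hfg hF h1 h2 m (e := 1) fun p => by
        rw [pow_one]
        exact (HalfSieve.localBounds hfg p).abs_le m
      rwa [pow_one] at h
  -- The error is the ratio of `S` to its predicted size, minus 1; it tends to 0 because L_J(F) ≠ 0.
  · refine ⟨fun N => HalfSieve.S θ N F f g J 1 1 m / HalfSieve.B θ N ^ (k + J.card) /
      HalfSieve.L J F - 1, ?_, ?_⟩
    · have h := ((HalfSieve.tendsto_S_div hθ hfg hF m).div_const (HalfSieve.L J F)).sub_const 1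
      rwa [div_self hL, sub_self] at h
    · filter_upwards [HalfSieve.eventually_B_pos hθ] with N hB
      have hB' : HalfSieve.B θ N ^ (k + J.card) ≠ 0 := (pow_pos hB _).ne'
      field_simp
      ring
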